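/- **Proposition 2.2 (Non-degeneracy).** For every dimension $d\ge 1$ there are constants $\kappa_d>0$ and $C_d>0$, depending only on $d$, such that the following holds. Let $D\subset\mathbb R^d$ be open and bounded, let $\{1,\dots,k\}$ be the union of pairwise disjoint sets $A_1,\dots,A_n$, and let $\Lambda_1,\dots,\Lambda_n>0$. For $W\in H^1(D,\mathbb R^k)$ let $W_j$ be obtained from $W$ by replacing the components with index outside $A_j$ by $0$, let $|W_j|(x):=\lim_{r\to0^+}\frac1{|B_r|}\int_{B_r(x)}|W_j|\,dy$ be the canonical representative of $|W_j|$ (with the upper limit where the limit does not exist), and put $\Omega_{W_j}:=\{x\in D: |W_j|(x)\neq 0\}$. Let $H^1(D,\Sigma)$ be the set of $W\in H^1(D,\mathbb R^k)$ with $w_iw_{i'}=0$ a.e. in $D$ whenever $i\in A_j$, $i'\in A_{j'}$, $j\ne j'$, and let $H^1_0(D,\Sigma)=H^1(D,\Sigma)\cap H^1_0(D,\mathbb R^k)$. Given $g\in H^1(D,\Sigma)$, let $U$ minimize $$J_\Lambda(W,D)=\int_D|\nabla W|^2\,dx+\sum_{j=1}^n\Lambda_j|\Omega_{W_j}|$$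 among all $W\in H^1(D,\Sigma)$ with $W-g\in H^1_0(D,\Sigma)$. Then, for every $j\in\{1,\dots,n\}$: 1. for every $x\in\overline{\Omega}_{U_j}$ and every $r\in(0,d(x,\partial D))$, $$\|U_j\|_{L^\infty(B_r(x))}\ \ge\ \frac{1}{\mathcal H^{d-1}(\partial B_r(x))}\int_{\partial B_r(x)}|U_j|\,d\mathcal H^{d-1}\ \ge\ \kappa_d\,\sqrt{\Lambda_j}\;r;$$ 2. $|U_j|\in H^1(D)$, and for every $x\in D$ and every $r\in(0,d(x,\partial D)/2)$ one has $\|U_j\|_{L^\infty(B_{2r}(x))}<\infty$ and $$\frac12\int_{B_r(x)}|\nabla|U_j||^2\,dx+\Lambda_j\,|\Omega_{U_j}\cap B_r(x)|\ \le\ C_d\,r^{-1}\,\|U_j\|_{L^\infty(B_{2r}(x))}\int_{\partial B_r(x)}|U_j|\,d\mathcal H^{d-1}.$$ -/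

import Mathlib

open MeasureTheory Filter Topology Set Metric
open scoped ENNReal ContDiff

namespace MultiphaseBernoulli

noncomputable section

/-- `G` is the weak gradient of `u` on `D`, with `G ∈ L²(D)`:
`∫_D u ∂_v φ = - ∫_D (G · v) φ` for all `φ ∈ C_c^∞(D)` and all directions `v`. -/
def IsWeakGrad {d : ℕ} (D : Set (EuclideanSpace ℝ (Fin d)))
    (u : EuclideanSpace ℝ (Fin d) → ℝ)
    (G : EuclideanSpace ℝ (Fin d) → EuclideanSpace ℝ (Fin d)) : Prop :=
  MemLp G 2 (volume.restrict D) ∧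
    ∀ φ : EuclideanSpace ℝ (Fin d) → ℝ,
      ContDiff ℝ ∞ φ → HasCompactSupport φ → tsupport φ ⊆ D →
        ∀ v : EuclideanSpace ℝ (Fin d),
          ∫ x in D, u x * fderiv ℝ φ x v = - ∫ x in D, inner ℝ (G x) v * φ x

/-- `u ∈ H¹(D)`. -/
def MemH1 {d : ℕ} (D : Set (EuclideanSpace ℝ (Fin d)))
    (u : EuclideanSpace ℝ (Fin d) → ℝ) : Prop :=
  MemLp u 2 (volume.restrict D) ∧ ∃ G, IsWeakGrad D u G

open Classical in
/-- The weak gradient `∇u` on `D` (unique up to null sets; the value is `0` if there is none). -/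
def weakGrad {d : ℕ} (D : Set (EuclideanSpace ℝ (Fin d)))
    (u : EuclideanSpace ℝ (Fin d) → ℝ) :
    EuclideanSpace ℝ (Fin d) → EuclideanSpace ℝ (Fin d) :=
  if h : ∃ G, IsWeakGrad D u G then h.choose else 0

/-- `u ∈ H¹₀(D)`, the closure of `C_c^∞(D)` in `H¹(D)`. -/
def MemH10 {d : ℕ} (D : Set (EuclideanSpace ℝ (Fin d)))
    (u : EuclideanSpace ℝ (Fin d) → ℝ) : Prop :=
  MemH1 D u ∧
    ∃ φ : ℕ → EuclideanSpace ℝ (Fin d) → ℝ,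
      (∀ m, ContDiff ℝ ∞ (φ m) ∧ HasCompactSupport (φ m) ∧ tsupport (φ m) ⊆ D) ∧
      Tendsto (fun m => eLpNorm (fun x => u x - φ m x) 2 (volume.restrict D)) atTop (𝓝 0) ∧
      Tendsto (fun m => eLpNorm (fun x => weakGrad D u x - gradient (φ m) x) 2
        (volume.restrict D)) atTop (𝓝 0)

/-- The partition of `{1,…,k}` into `A_1,…,A_n` is encoded by the map `p` with `A_j = p⁻¹{j}`.
`phase p j W` is the `j`-th phase `W_j`: the components outside `A_j` are replaced by `0`. -/
def phase {d k n : ℕ} (p : Fin k → Fin n) (j : Fin n)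
    (W : EuclideanSpace ℝ (Fin d) → EuclideanSpace ℝ (Fin k)) :
    EuclideanSpace ℝ (Fin d) → EuclideanSpace ℝ (Fin k) :=
  fun x => WithLp.toLp 2 (fun i => if p i = j then W x i else 0)

/-- `W ∈ H¹(D, Σ)`: components in `H¹(D)`, and `w_i w_{i'} = 0` a.e. in `D` whenever
`i` and `i'` belong to different blocks. -/
def MemH1Sigma {d k n : ℕ} (p : Fin k → Fin n) (D : Set (EuclideanSpace ℝ (Fin d)))
    (W : EuclideanSpace ℝ (Fin d) → EuclideanSpace ℝ (Fin k)) : Prop :=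
  (∀ i, MemH1 D (fun x => W x i)) ∧
    ∀ i i', p i ≠ p i' → ∀ᵐ x ∂(volume.restrict D), W x i * W x i' = 0

/-- `W ∈ H¹₀(D, Σ)`. -/
def MemH10Sigma {d k n : ℕ} (p : Fin k → Fin n) (D : Set (EuclideanSpace ℝ (Fin d)))
    (W : EuclideanSpace ℝ (Fin d) → EuclideanSpace ℝ (Fin k)) : Prop :=
  MemH1Sigma p D W ∧ ∀ i, MemH10 D (fun x => W x i)

/-- The canonical representative of `|V|`, `|V|(x) = lim_{r → 0⁺} ⨍_{B_r(x)} |V|`. Written with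
an upper limit in `[0,∞]`, it is defined for every `V`, depends only on the a.e. class of `V`,
and is the limit wherever the limit exists (everywhere in `D`, if `|V|` is subharmonic). -/
def preciseModulus {d k : ℕ} (V : EuclideanSpace ℝ (Fin d) → EuclideanSpace ℝ (Fin k))
    (x : EuclideanSpace ℝ (Fin d)) : ℝ≥0∞ :=
  limsup (fun r : ℝ => ⨍⁻ y in ball x r, ‖V y‖ₑ ∂volume) (𝓝[>] (0 : ℝ))

/-- `Ω_{W_j} = {x ∈ D : |W_j|(x) ≠ 0}`, for the canonical representative of `|W_j|`. -/
def phaseSet {d k n : ℕ} (p : Fin k → Fin n) (j : Fin n) (D : Set (EuclideanSpace ℝ (Fin d)))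
    (W : EuclideanSpace ℝ (Fin d) → EuclideanSpace ℝ (Fin k)) :
    Set (EuclideanSpace ℝ (Fin d)) :=
  {x | x ∈ D ∧ preciseModulus (phase p j W) x ≠ 0}

/-- `J_Λ(W, D) = ∫_D |∇W|² + ∑_j Λ_j |Ω_{W_j}|`. -/
def J {d k n : ℕ} (p : Fin k → Fin n) (Λ : Fin n → ℝ) (D : Set (EuclideanSpace ℝ (Fin d)))
    (W : EuclideanSpace ℝ (Fin d) → EuclideanSpace ℝ (Fin k)) : ℝ≥0∞ :=
  (∑ i, ∫⁻ x in D, ‖weakGrad D (fun y => W y i) x‖ₑ ^ 2) +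
    ∑ j, ENNReal.ofReal (Λ j) * volume (phaseSet p j D W)

/-- The competitors for the boundary datum `g`: `W ∈ H¹(D, Σ)` with `W - g ∈ H¹₀(D, Σ)`. -/
def IsCompetitor {d k n : ℕ} (p : Fin k → Fin n) (D : Set (EuclideanSpace ℝ (Fin d)))
    (g W : EuclideanSpace ℝ (Fin d) → EuclideanSpace ℝ (Fin k)) : Prop :=
  MemH1Sigma p D W ∧ MemH10Sigma p D (fun x => W x - g x)

/-- `U` minimizes `J_Λ(·, D)` among the competitors for the datum `g`. -/
def IsMinimizer {d k n : ℕ} (p : Fin k → Fin n) (Λ : Fin n → ℝ)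
    (D : Set (EuclideanSpace ℝ (Fin d)))
    (g U : EuclideanSpace ℝ (Fin d) → EuclideanSpace ℝ (Fin k)) : Prop :=
  IsCompetitor p D g U ∧ ∀ W, IsCompetitor p D g W → J p Λ D U ≤ J p Λ D W

/-- `∫_{∂B_r(x)} f dH^{d-1}`, written as an integral over the unit sphere against its surface
measure. -/
def sphereIntegral {d : ℕ} (f : EuclideanSpace ℝ (Fin d) → ℝ≥0∞)
    (x : EuclideanSpace ℝ (Fin d)) (r : ℝ) : ℝ≥0∞ :=
  ENNReal.ofReal (r ^ (d - 1)) *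
    ∫⁻ s : sphere (0 : EuclideanSpace ℝ (Fin d)) 1,
      f (x + r • (s : EuclideanSpace ℝ (Fin d)))
        ∂((volume : Measure (EuclideanSpace ℝ (Fin d))).toSphere)

/-- `⨍_{∂B_r(x)} f dH^{d-1}`: the integral divided by the surface measure of `∂B_r(x)`. -/
def sphereMean {d : ℕ} (f : EuclideanSpace ℝ (Fin d) → ℝ≥0∞)
    (x : EuclideanSpace ℝ (Fin d)) (r : ℝ) : ℝ≥0∞ :=
  sphereIntegral f x r / sphereIntegral (fun _ => 1) x r

end

end MultiphaseBernoulli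

open MultiphaseBernoulli

/-!
A phase `U_j` of a minimizer is compared with its multiples `c U_j`, where the scalar function `c` is
`1` outside a compact subset of `D`; such competitors keep the segregation of the phases and change
neither the other phases nor the boundary values, so that only the energy of `U_j` and the volume of
`Ω_{U_j}` matter (`IsMinimizer.rescale`).

*Subharmonicity.* The choice `c = 1 + tψ/√(ε² + |U_j|²)` with both signs of `t` keeps the volume from
growing and shows that `u = |U_j|` is weakly subharmonic (`IsMinimizer.weaklySubharmonic`). Hence the
mollifications of `u` are smooth subharmonic functions, for which radial test functions show that
spherical means increase with the radius (`sphNormal_nonneg`). They decrease pointwise, as the scale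
tends to zero, to the canonical representative of `u` (`IsSubharmonic.tendsto_mol_rep`), and this
transfers to the representative the gradient bound for spherical means, the bound of `u` by the mean
over a larger sphere, and a trace inequality.

*The energy estimate.* Let `M` be the supremum of `u` on `B_{2r}(x)`, and let `w` be a radial function
that is negative in `B_r(x)`, vanishes on `∂B_r(x)`, is at least `M` outside `B_{3r/2}(x)`, and whose
flux through spheres decreases outside `B_r(x)`. With `b = (u - w⁺)⁺` the competitor `(1 - b/u) U_j`
has modulus `min(u, w⁺)`; it vanishes in `B_r(x)`, so that
`∫_{B_r} |∇U_j|² + Λ_j |Ω_{U_j} ∩ B_r|` is bounded by the change of the energy in the annulus, which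
is at most `-2 ∫ ∇w · ∇b` (`sum_norm_sq_sub_le`, `exists_cutoff`). Integration by parts in the radius
bounds this by the flux of `w` through `∂B_r(x)` times the mean of `u`
(`IsSubharmonic.neg_integral_barrier_le`, `IsMinimizer.energy_le`).

*Non-degeneracy.* If the mean of `u` over `∂B_r(x)` is small compared with `√Λ_j r`, then so is `u` on
`B_{r/2}(x)`. With `s = r/4`, the trace inequality bounds the right-hand side of the energy estimate
in `B_s(x)` by `∫_{B_s} u` and `∫_{B_s} |∇u|`, and both are at most a small multiple of the energy
in `B_s(x)` itself. So the energy vanishes, and `Ω_{U_j}` does not meet `B_s(x)`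
(`IsMinimizer.volume_phaseSet_eq_zero`).
-/

namespace MultiphaseBernoulli

variable {d : ℕ}

local notation:max "𝔼" n:max => EuclideanSpace ℝ (Fin n)

/-! ### Weak gradients -/

/-- `φ` is a test function on `D`, that is, `φ ∈ C_c^∞(D)`. -/
structure IsTest (D : Set 𝔼 d) (φ : 𝔼 d → ℝ) : Prop where
  contDiff : ContDiff ℝ ∞ φ
  compact : HasCompactSupport φ
  subset : tsupport φ ⊆ D

namespace IsTest

variable {D B : Set 𝔼 d} {φ ψ : 𝔼 d → ℝ}

lemma mono (h : IsTest B φ) (hBD : B ⊆ D) : IsTest D φ := ⟨h.1, h.2, h.3.trans hBD⟩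

lemma continuous (h : IsTest D φ) : Continuous φ := h.1.continuous

lemma differentiable (h : IsTest D φ) : Differentiable ℝ φ := h.1.differentiable (by simp)

lemma continuous_fderiv (h : IsTest D φ) (v : 𝔼 d) : Continuous fun x => fderiv ℝ φ x v :=
  (h.1.continuous_fderiv (by simp)).clm_apply continuous_const

lemma compact_fderiv (h : IsTest D φ) (v : 𝔼 d) : HasCompactSupport fun x => fderiv ℝ φ x v :=
  h.2.fderiv_apply (𝕜 := ℝ) v

lemma eq_zero (h : IsTest D φ) {x : 𝔼 d} (hx : x ∉ D) : φ x = 0 :=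
  image_eq_zero_of_notMem_tsupport fun hx' => hx (h.3 hx')

lemma fderiv_eq_zero (h : IsTest D φ) {x : 𝔼 d} (hx : x ∉ D) : fderiv ℝ φ x = 0 :=
  Function.notMem_support.1 fun hx' => hx (h.3 (support_fderiv_subset ℝ hx'))

lemma mul_left (h : IsTest D φ) (hψ : ContDiff ℝ ∞ ψ) : IsTest D (fun x => ψ x * φ x) :=
  ⟨hψ.mul h.1, h.2.mul_left, (tsupport_mul_subset_right).trans h.3⟩

end IsTest

section basics

variable {D B : Set 𝔼 d} {u u' : 𝔼 d → ℝ} {G G' : 𝔼 d → 𝔼 d} {φ : 𝔼 d → ℝ}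

lemma integrable_mul_of_memLp {f g : 𝔼 d → ℝ} (hf : MemLp f 2 (volume.restrict D))
    (hg : Continuous g) (hgs : HasCompactSupport g) :
    Integrable (fun x => f x * g x) (volume.restrict D) :=
  hf.integrable_mul (q := 2) (hg.memLp_of_hasCompactSupport hgs)

lemma memLp_inner {μ : Measure 𝔼 d} (hG : MemLp G 2 μ) (v : 𝔼 d) :
    MemLp (fun x => inner ℝ (G x) v) 2 μ := hG.inner_const v

lemma IsWeakGrad.integral_eq (h : IsWeakGrad D u G) (hφ : IsTest D φ) (v : 𝔼 d) :
    ∫ x, u x * fderiv ℝ φ x v = - ∫ x, inner ℝ (G x) v * φ x := by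
  have := h.2 φ hφ.1 hφ.2 hφ.3 v
  rwa [setIntegral_eq_integral_of_forall_compl_eq_zero,
    setIntegral_eq_integral_of_forall_compl_eq_zero] at this
  · intro x hx; rw [hφ.eq_zero hx, mul_zero]
  · intro x hx; rw [hφ.fderiv_eq_zero hx]; simp

lemma IsWeakGrad.of_integral (hG : MemLp G 2 (volume.restrict D))
    (h : ∀ φ, IsTest D φ → ∀ v : 𝔼 d,
      ∫ x, u x * fderiv ℝ φ x v = - ∫ x, inner ℝ (G x) v * φ x) : IsWeakGrad D u G := by
  refine ⟨hG, fun φ h1 h2 h3 v => ?_⟩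
  have hφ : IsTest D φ := ⟨h1, h2, h3⟩
  rw [setIntegral_eq_integral_of_forall_compl_eq_zero,
    setIntegral_eq_integral_of_forall_compl_eq_zero]
  · exact h φ hφ v
  · intro x hx; rw [hφ.eq_zero hx, mul_zero]
  · intro x hx; rw [hφ.fderiv_eq_zero hx]; simp

lemma IsWeakGrad.mono (h : IsWeakGrad D u G) (hBD : B ⊆ D) : IsWeakGrad B u G :=
  .of_integral (h.1.mono_measure (Measure.restrict_mono hBD le_rfl))
    fun _ hφ v => h.integral_eq (hφ.mono hBD) v

lemma IsWeakGrad.congr (h : IsWeakGrad D u G) (hu : u =ᵐ[volume.restrict D] u')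
    (hG : G =ᵐ[volume.restrict D] G') : IsWeakGrad D u' G' := by
  refine ⟨h.1.ae_eq hG, fun φ h1 h2 h3 v => ?_⟩
  have := h.2 φ h1 h2 h3 v
  have e1 : ∫ x in D, u' x * fderiv ℝ φ x v = ∫ x in D, u x * fderiv ℝ φ x v :=
    integral_congr_ae (by filter_upwards [hu] with x hx; rw [hx])
  have e2 : ∫ x in D, inner ℝ (G' x) v * φ x = ∫ x in D, inner ℝ (G x) v * φ x :=
    integral_congr_ae (by filter_upwards [hG] with x hx; rw [hx])
  rw [e1, e2, this]

lemma IsWeakGrad.add {u₁ u₂ : 𝔼 d → ℝ} {G₁ G₂ : 𝔼 d → 𝔼 d}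
    (h₁ : IsWeakGrad D u₁ G₁) (h₂ : IsWeakGrad D u₂ G₂)
    (hu₁ : MemLp u₁ 2 (volume.restrict D)) (hu₂ : MemLp u₂ 2 (volume.restrict D)) :
    IsWeakGrad D (fun x => u₁ x + u₂ x) (fun x => G₁ x + G₂ x) := by
  refine ⟨h₁.1.add h₂.1, fun φ h1 h2 h3 v => ?_⟩
  have hφ : IsTest D φ := ⟨h1, h2, h3⟩
  simp only [add_mul, inner_add_left]
  rw [integral_add, integral_add, h₁.2 φ h1 h2 h3 v, h₂.2 φ h1 h2 h3 v]
  · ring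
  · exact integrable_mul_of_memLp (memLp_inner h₁.1 v) h1.continuous h2
  · exact integrable_mul_of_memLp (memLp_inner h₂.1 v) h1.continuous h2
  · exact integrable_mul_of_memLp hu₁ (hφ.continuous_fderiv v) (hφ.compact_fderiv v)
  · exact integrable_mul_of_memLp hu₂ (hφ.continuous_fderiv v) (hφ.compact_fderiv v)

lemma IsWeakGrad.const_mul (h : IsWeakGrad D u G) (c : ℝ) :
    IsWeakGrad D (fun x => c * u x) (fun x => c • G x) := by
  refine ⟨h.1.const_smul c, fun φ h1 h2 h3 v => ?_⟩
  simp only [real_inner_smul_left, mul_assoc]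
  rw [integral_const_mul, integral_const_mul, h.2 φ h1 h2 h3 v]
  ring

lemma IsWeakGrad.sub {u₁ u₂ : 𝔼 d → ℝ} {G₁ G₂ : 𝔼 d → 𝔼 d}
    (h₁ : IsWeakGrad D u₁ G₁) (h₂ : IsWeakGrad D u₂ G₂)
    (hu₁ : MemLp u₁ 2 (volume.restrict D)) (hu₂ : MemLp u₂ 2 (volume.restrict D)) :
    IsWeakGrad D (fun x => u₁ x - u₂ x) (fun x => G₁ x - G₂ x) := by
  have := h₁.add (h₂.const_mul (-1)) hu₁ (hu₂.const_mul (-1))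
  convert this using 2 <;> simp [sub_eq_add_neg]

/-- The weak gradient vanishes on open sets where the function does. -/
lemma IsWeakGrad.ae_eq_zero (hD : IsOpen D) (h : IsWeakGrad D u G)
    (hu : ∀ᵐ x ∂(volume.restrict D), u x = 0) : ∀ᵐ x ∂(volume.restrict D), G x = 0 := by
  rw [ae_restrict_iff' hD.measurableSet]
  have hloc : LocallyIntegrableOn G D :=
    locallyIntegrableOn_of_locallyIntegrable_restrict
      (h.1.locallyIntegrable (by norm_num))
  refine hD.ae_eq_zero_of_integral_contDiff_smul_eq_zero hloc fun φ h1 h2 h3 => ?_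
  have hφ : IsTest D φ := ⟨h1, h2, h3⟩
  refine ext_inner_right ℝ fun v => ?_
  have hint : Integrable (fun x => φ x • G x) (volume.restrict D) :=
    memLp_one_iff_integrable.1
      (h.1.smul (p := 2) (r := 1) (h1.continuous.memLp_of_hasCompactSupport h2))
  have e : ∫ x, φ x • G x = ∫ x in D, φ x • G x := by
    rw [setIntegral_eq_integral_of_forall_compl_eq_zero]
    intro x hx; rw [hφ.eq_zero hx, zero_smul]
  rw [e, inner_zero_left, real_inner_comm, ← integral_inner hint]
  have := h.2 φ h1 h2 h3 v
  have e1 : ∫ x in D, u x * fderiv ℝ φ x v = 0 :=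
    integral_eq_zero_of_ae (by filter_upwards [hu] with x hx; simp [hx])
  rw [e1, eq_comm, neg_eq_zero] at this
  rw [← this]
  refine integral_congr_ae (Eventually.of_forall fun x => ?_)
  simp only [real_inner_smul_right, real_inner_comm]
  ring

lemma IsWeakGrad.unique (hD : IsOpen D) (hu : MemLp u 2 (volume.restrict D))
    (h : IsWeakGrad D u G) (h' : IsWeakGrad D u G') : G =ᵐ[volume.restrict D] G' := by
  have := (h.sub h' hu hu).ae_eq_zero hD (by simp)
  filter_upwards [this] with x hx using sub_eq_zero.1 hx

lemma isWeakGrad_weakGrad (h : ∃ G, IsWeakGrad D u G) : IsWeakGrad D u (weakGrad D u) := by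
  rw [weakGrad, dif_pos h]; exact h.choose_spec

lemma IsWeakGrad.weakGrad_ae (hD : IsOpen D) (hu : MemLp u 2 (volume.restrict D))
    (h : IsWeakGrad D u G) : weakGrad D u =ᵐ[volume.restrict D] G :=
  (isWeakGrad_weakGrad ⟨G, h⟩).unique hD hu h

/-- Dominated convergence for weak gradients. -/
lemma IsWeakGrad.of_tendsto {un : ℕ → 𝔼 d → ℝ} {Gn : ℕ → 𝔼 d → 𝔼 d}
    (h : ∀ n, IsWeakGrad D (un n) (Gn n)) (hun : ∀ n, MemLp (un n) 2 (volume.restrict D))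
    {a A : 𝔼 d → ℝ} (ha : MemLp a 2 (volume.restrict D)) (hA : MemLp A 2 (volume.restrict D))
    (hua : ∀ n, ∀ᵐ x ∂(volume.restrict D), |un n x| ≤ a x)
    (hGA : ∀ n, ∀ᵐ x ∂(volume.restrict D), ‖Gn n x‖ ≤ A x)
    (hu : ∀ᵐ x ∂(volume.restrict D), Tendsto (fun n => un n x) atTop (𝓝 (u x)))
    (hG : ∀ᵐ x ∂(volume.restrict D), Tendsto (fun n => Gn n x) atTop (𝓝 (G x))) :
    MemLp u 2 (volume.restrict D) ∧ IsWeakGrad D u G := by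
  have mu : AEStronglyMeasurable u (volume.restrict D) :=
    aestronglyMeasurable_of_tendsto_ae atTop (fun n => (hun n).1) hu
  have mG : AEStronglyMeasurable G (volume.restrict D) :=
    aestronglyMeasurable_of_tendsto_ae atTop (fun n => (h n).1.1) hG
  refine ⟨ha.mono mu ?_, hA.mono mG ?_, fun φ h1 h2 h3 v => ?_⟩
  · filter_upwards [hu, ae_all_iff.2 hua] with x hx hx'
    refine le_of_tendsto hx.norm (Eventually.of_forall fun n => (hx' n).trans (le_abs_self _))
  · filter_upwards [hG, ae_all_iff.2 hGA] with x hx hx'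
    refine le_of_tendsto hx.norm (Eventually.of_forall fun n => (hx' n).trans (le_abs_self _))
  have hφ : IsTest D φ := ⟨h1, h2, h3⟩
  have t1 : Tendsto (fun n => ∫ x in D, un n x * fderiv ℝ φ x v) atTop
      (𝓝 (∫ x in D, u x * fderiv ℝ φ x v)) := by
    refine tendsto_integral_of_dominated_convergence (fun x => a x * |fderiv ℝ φ x v|) ?_ ?_ ?_ ?_
    · intro n
      exact (integrable_mul_of_memLp (hun n) (hφ.continuous_fderiv v) (hφ.compact_fderiv v)).1
    · exact integrable_mul_of_memLp ha (hφ.continuous_fderiv v).abs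
        (hφ.compact_fderiv v).norm
    · intro n
      filter_upwards [hua n] with x hx
      rw [norm_mul]
      exact mul_le_mul_of_nonneg_right hx (norm_nonneg _)
    · filter_upwards [hu] with x hx using hx.mul_const _
  have t2 : Tendsto (fun n => ∫ x in D, inner ℝ (Gn n x) v * φ x) atTop
      (𝓝 (∫ x in D, inner ℝ (G x) v * φ x)) := by
    refine tendsto_integral_of_dominated_convergence (fun x => (A x * ‖v‖) * |φ x|) ?_ ?_ ?_ ?_
    · intro n
      exact (integrable_mul_of_memLp (memLp_inner (h n).1 v) h1.continuous h2).1
    · exact integrable_mul_of_memLp (hA.mul_const _) h1.continuous.abs h2.norm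
    · intro n
      filter_upwards [hGA n] with x hx
      rw [norm_mul]
      refine mul_le_mul_of_nonneg_right ?_ (norm_nonneg _)
      exact (norm_inner_le_norm _ _).trans (mul_le_mul_of_nonneg_right hx (norm_nonneg _))
    · filter_upwards [hG] with x hx
      exact (hx.inner tendsto_const_nhds).mul_const _
  have t3 := t2.neg
  refine tendsto_nhds_unique t1 (t3.congr fun n => ?_)
  rw [(h n).2 φ h1 h2 h3 v]

lemma inner_gradient_eq (f : 𝔼 d → ℝ) (x v : 𝔼 d) : inner ℝ (gradient f x) v = fderiv ℝ f x v := by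
  simp [gradient]

/-- Product with a smooth compactly supported function. -/
lemma IsWeakGrad.smooth_mul {ψ : 𝔼 d → ℝ} (hψ : ContDiff ℝ ∞ ψ) (hψc : HasCompactSupport ψ)
    (h : IsWeakGrad D u G) (hu : MemLp u 2 (volume.restrict D)) :
    MemLp (fun x => ψ x * u x) 2 (volume.restrict D) ∧
    IsWeakGrad D (fun x => ψ x * u x) (fun x => ψ x • G x + u x • gradient ψ x) := by
  have hψ' : IsTest univ ψ := ⟨hψ, hψc, subset_univ _⟩
  have cg : Continuous (gradient ψ) :=
    (InnerProductSpace.toDual ℝ 𝔼 d).symm.continuous.comp (hψ.continuous_fderiv (by simp))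
  have cgc : HasCompactSupport (gradient ψ) :=
    (hψc.fderiv (𝕜 := ℝ)).comp_left (g := (InnerProductSpace.toDual ℝ 𝔼 d).symm) (by simp)
  have mψ : MemLp ψ ⊤ (volume.restrict D) := hψ.continuous.memLp_of_hasCompactSupport hψc
  have mgψ : MemLp (gradient ψ) ⊤ (volume.restrict D) := cg.memLp_of_hasCompactSupport cgc
  have m1 : MemLp (ψ • G) 2 (volume.restrict D) := h.1.smul mψ
  have m2 : MemLp (u • gradient ψ) 2 (volume.restrict D) := mgψ.smul hu
  have m3 : MemLp (ψ • u) 2 (volume.restrict D) := hu.smul mψ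
  refine ⟨m3, m1.add m2, fun φ h1 h2 h3 v => ?_⟩
  have hφ : IsTest D φ := ⟨h1, h2, h3⟩
  have hp := hφ.mul_left hψ
  have := h.2 _ hp.1 hp.2 hp.3 v
  have e : ∀ x, fderiv ℝ (fun x => ψ x * φ x) x v
      = ψ x * fderiv ℝ φ x v + φ x * fderiv ℝ ψ x v := by
    intro x
    have := ((hψ'.differentiable x).hasFDerivAt.mul (hφ.differentiable x).hasFDerivAt).fderiv
    rw [show (fun x => ψ x * φ x) = ψ * φ from rfl, this]
    simp
  simp only [e, mul_add] at this
  rw [integral_add] at this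
  · simp only [inner_add_left, real_inner_smul_left, inner_gradient_eq, add_mul]
    rw [integral_add]
    · have e1 : ∫ x in D, ψ x * u x * fderiv ℝ φ x v
          = ∫ x in D, u x * (ψ x * fderiv ℝ φ x v) := by
        congr 1; ext x; ring
      have e2 : ∫ x in D, u x * fderiv ℝ ψ x v * φ x
          = ∫ x in D, u x * (φ x * fderiv ℝ ψ x v) := by
        congr 1; ext x; ring
      have e3 : ∫ x in D, ψ x * inner ℝ (G x) v * φ x
          = ∫ x in D, inner ℝ (G x) v * (ψ x * φ x) := by
        congr 1; ext x; ring
      rw [e1, e2, e3]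
      linarith
    · have := integrable_mul_of_memLp (memLp_inner h.1 v) hp.continuous hp.compact
      refine this.congr (Eventually.of_forall fun x => ?_)
      simp only; ring
    · have := integrable_mul_of_memLp hu ((hψ'.continuous_fderiv v).mul h1.continuous)
        h2.mul_left
      refine this.congr (Eventually.of_forall fun x => ?_)
      simp only [Pi.mul_apply]; ring
  · exact integrable_mul_of_memLp hu (hψ.continuous.mul (hφ.continuous_fderiv v))
      (hφ.compact_fderiv v).mul_left
  · exact integrable_mul_of_memLp hu (h1.continuous.mul (hψ'.continuous_fderiv v))
      h2.mul_right

/-- Classical gradients of `C¹` functions are weak gradients. -/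
lemma ContDiff.isWeakGrad {w : 𝔼 d → ℝ} (hw : ContDiff ℝ 1 w)
    (hG : MemLp (gradient w) 2 (volume.restrict D)) : IsWeakGrad D w (gradient w) := by
  refine .of_integral hG fun φ hφ v => ?_
  simp only [inner_gradient_eq]
  have cw : Continuous fun x => fderiv ℝ w x v :=
    (hw.continuous_fderiv (by simp)).clm_apply continuous_const
  refine integral_mul_fderiv_eq_neg_fderiv_mul_of_integrable ?_ ?_ ?_
    (fun x _ => hw.differentiable (by simp) x) (fun x _ => hφ.differentiable x)
  · exact (cw.mul hφ.continuous).integrable_of_hasCompactSupport hφ.compact.mul_left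
  · exact (hw.continuous.mul (hφ.continuous_fderiv v)).integrable_of_hasCompactSupport
      (hφ.compact_fderiv v).mul_left
  · exact (hw.continuous.mul hφ.continuous).integrable_of_hasCompactSupport hφ.compact.mul_left

/-- Extension by zero: an `H¹` function on `B` that vanishes off a compact subset of `B` belongs to
`H¹` of every larger set. -/
lemma IsWeakGrad.extend {K : Set 𝔼 d} (hB : IsOpen B) (hK : IsCompact K) (hKB : K ⊆ B)
    (h : IsWeakGrad B u G) (huK : ∀ x ∉ K, u x = 0) :
    IsWeakGrad univ u (K.indicator G) := by
  have hG0 : ∀ᵐ x ∂(volume.restrict (B \ K)), G x = 0 :=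
    (h.mono sdiff_subset).ae_eq_zero (hB.sdiff hK.isClosed) (by
      rw [ae_restrict_iff' (hB.sdiff hK.isClosed).measurableSet]
      exact Eventually.of_forall fun x hx => huK x hx.2)
  rw [ae_restrict_iff' (hB.sdiff hK.isClosed).measurableSet] at hG0
  have mG : MemLp (K.indicator G) 2 volume := by
    rw [memLp_indicator_iff_restrict hK.measurableSet]
    exact h.1.mono_measure (Measure.restrict_mono hKB le_rfl)
  refine .of_integral (mG.restrict _) fun φ hφ v => ?_
  obtain ⟨L, hL, hKL, hLB⟩ := exists_compact_between hK hB hKB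
  obtain ⟨χ, hχ, hχ1⟩ : ∃ χ : 𝔼 d → ℝ, IsTest B χ ∧ ∀ x ∈ interior L, χ x = 1 := by
    obtain ⟨L', hL', hLL', hLB'⟩ := exists_compact_between hL hB hLB
    obtain ⟨f, hf1, -, hf⟩ := exists_contMDiff_zero_iff_one_iff_of_isClosed
      (n := (⊤ : ℕ∞)) (modelWithCornersSelf ℝ 𝔼 d) (s := (interior L')ᶜ) (t := L)
      isOpen_interior.isClosed_compl hL.isClosed
      (disjoint_left.2 fun x hx hx' => hx (hLL' hx'))
    have hs : Function.support f ⊆ L' := by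
      intro x hx
      by_contra hxL
      exact hx ((hf.1 x).1 (fun h => hxL (interior_subset h)))
    refine ⟨f, ⟨hf1.contDiff, ?_, ?_⟩, ?_⟩
    · exact HasCompactSupport.of_support_subset_isCompact hL' hs
    · exact (closure_minimal hs hL'.isClosed).trans hLB'
    · intro x hx
      exact (hf.2 x).1 (interior_subset hx)
  have hp : IsTest B fun x => φ x * χ x := hχ.mul_left hφ.1
  have := h.integral_eq hp v
  have e1 : ∀ x, u x * fderiv ℝ (fun x => φ x * χ x) x v = u x * fderiv ℝ φ x v := by
    intro x
    by_cases hx : x ∈ K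
    · have : (fun x => φ x * χ x) =ᶠ[𝓝 x] φ := by
        filter_upwards [isOpen_interior.mem_nhds (hKL hx)] with y hy
        rw [hχ1 y hy, mul_one]
      rw [this.fderiv_eq]
    · rw [huK x hx]; simp
  simp only [e1] at this
  rw [this]
  congr 1
  refine integral_congr_ae ?_
  filter_upwards [hG0] with x hx
  by_cases hxK : x ∈ K
  · simp only [hxK, indicator_of_mem]
    rw [hχ1 x (hKL hxK), mul_one]
  · simp only [hxK, not_false_eq_true, indicator_of_notMem, inner_zero_left, zero_mul]
    by_cases hxB : x ∈ B
    · rw [hx ⟨hxB, hxK⟩]; simp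
    · rw [hχ.eq_zero hxB]; simp

end basics

/-! ### Radial mollification -/

noncomputable section

/-- The standard radial mollifier, a smooth probability density supported in the unit ball. -/
def rho (y : 𝔼 d) : ℝ :=
  (∫ z : 𝔼 d, expNegInvGlue (1 - ‖z‖ ^ 2))⁻¹ * expNegInvGlue (1 - ‖y‖ ^ 2)

lemma contDiff_profile : ContDiff ℝ ∞ fun y : 𝔼 d => expNegInvGlue (1 - ‖y‖ ^ 2) :=
  expNegInvGlue.contDiff.comp (contDiff_const.sub (contDiff_norm_sq ℝ))

lemma profile_eq_zero {y : 𝔼 d} (hy : 1 ≤ ‖y‖) : expNegInvGlue (1 - ‖y‖ ^ 2) = 0 :=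
  expNegInvGlue.zero_of_nonpos (by nlinarith)

lemma compact_profile : HasCompactSupport fun y : 𝔼 d => expNegInvGlue (1 - ‖y‖ ^ 2) := by
  refine HasCompactSupport.of_support_subset_isCompact (isCompact_closedBall (0 : 𝔼 d) 1) ?_
  intro y hy
  by_contra h
  exact hy (profile_eq_zero (by simpa using (not_le.1 (by simpa using h)).le))

lemma integral_profile_pos : 0 < ∫ z : 𝔼 d, expNegInvGlue (1 - ‖z‖ ^ 2) := by
  refine contDiff_profile.continuous.integral_pos_of_hasCompactSupport_nonneg_nonzero
    compact_profile (fun y => expNegInvGlue.nonneg _) (x := 0) ?_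
  exact (expNegInvGlue.pos_of_pos (by simp)).ne'

lemma contDiff_rho : ContDiff ℝ ∞ (rho (d := d)) := contDiff_const.mul contDiff_profile

lemma continuous_rho : Continuous (rho (d := d)) := contDiff_rho.continuous

lemma compact_rho : HasCompactSupport (rho (d := d)) := compact_profile.mul_left

lemma rho_nonneg (y : 𝔼 d) : 0 ≤ rho y :=
  mul_nonneg (inv_nonneg.2 integral_profile_pos.le) (expNegInvGlue.nonneg _)

lemma rho_eq_zero {y : 𝔼 d} (hy : 1 ≤ ‖y‖) : rho y = 0 := by
  rw [rho, profile_eq_zero hy, mul_zero]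

lemma rho_eq_of_norm_eq {y z : 𝔼 d} (h : ‖y‖ = ‖z‖) : rho y = rho z := by
  rw [rho, rho, h]

lemma integrable_rho : Integrable (rho (d := d)) :=
  continuous_rho.integrable_of_hasCompactSupport compact_rho

lemma integral_rho : ∫ y : 𝔼 d, rho y = 1 := by
  simp only [rho]
  rw [integral_const_mul, inv_mul_cancel₀ integral_profile_pos.ne']

variable (d) in
/-- The probability measure with density `rho`. -/
def molMeasure : Measure (𝔼 d) :=
  volume.withDensity fun y => ((rho y).toNNReal : ℝ≥0∞)

instance : IsProbabilityMeasure (molMeasure d) := by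
  refine ⟨?_⟩
  rw [molMeasure, withDensity_apply _ MeasurableSet.univ, setLIntegral_univ]
  change ∫⁻ y : 𝔼 d, ENNReal.ofReal (rho y) = 1
  rw [← ofReal_integral_eq_lintegral_ofReal integrable_rho (Eventually.of_forall rho_nonneg),
    integral_rho, ENNReal.ofReal_one]

lemma integral_molMeasure {F : Type*} [NormedAddCommGroup F] [NormedSpace ℝ F] (f : 𝔼 d → F) :
    ∫ y, f y ∂(molMeasure d) = ∫ y, rho y • f y := by
  rw [molMeasure, integral_withDensity_eq_integral_smul continuous_rho.measurable.real_toNNReal]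
  congr 1
  ext y
  rw [NNReal.smul_def, Real.coe_toNNReal _ (rho_nonneg y)]

lemma ae_molMeasure_norm_lt : ∀ᵐ y ∂(molMeasure d), ‖y‖ < 1 := by
  rw [molMeasure, ae_withDensity_iff (by exact continuous_rho.measurable.real_toNNReal.coe_nnreal_ennreal)]
  refine Eventually.of_forall fun y hy => ?_
  by_contra h
  exact hy (by simp [rho_eq_zero (not_lt.1 h)])

lemma exists_molMeasure_le : ∃ c : ℝ≥0∞, c ≠ ⊤ ∧ molMeasure d ≤ c • volume := by
  obtain ⟨C, hC⟩ := compact_rho.exists_bound_of_continuous (continuous_rho (d := d))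
  refine ⟨ENNReal.ofReal C, ENNReal.ofReal_ne_top, ?_⟩
  rw [molMeasure, ← withDensity_const]
  refine withDensity_mono (Eventually.of_forall fun y => ?_)
  exact ENNReal.ofReal_le_ofReal ((le_abs_self _).trans (hC y))

lemma molMeasure_ac : molMeasure d ≪ volume := withDensity_absolutelyContinuous _ _

/-- `mol δ f x = ∫ ρ(y) f(x - δ y) dy`, the mollification of `f` at scale `δ`. -/
def mol {F : Type*} [NormedAddCommGroup F] [NormedSpace ℝ F] (δ : ℝ) (f : 𝔼 d → F)
    (x : 𝔼 d) : F :=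
  ∫ y, f (x - δ • y) ∂(molMeasure d)

variable {F : Type*} [NormedAddCommGroup F] [NormedSpace ℝ F]

lemma map_sub_smul (x : 𝔼 d) {δ : ℝ} (hδ : δ ≠ 0) :
    Measure.map (fun y : 𝔼 d => x - δ • y) volume = ENNReal.ofReal |(δ ^ d)⁻¹| • volume := by
  have : (fun y : 𝔼 d => x - δ • y) = (fun z => x - z) ∘ (fun y => δ • y) := rfl
  rw [this, ← Measure.map_map (by fun_prop) (by fun_prop), Measure.map_addHaar_smul _ hδ,
    Measure.map_smul, Measure.map_sub_left_eq_self]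
  simp

lemma memLp_comp_sub_smul {f : 𝔼 d → F} (hf : MemLp f 2) (x : 𝔼 d) {δ : ℝ} (hδ : δ ≠ 0) :
    MemLp (fun y => f (x - δ • y)) 2 := by
  refine MemLp.comp_of_map (f := fun y : 𝔼 d => x - δ • y) (g := f) ?_ (by fun_prop)
  rw [map_sub_smul x hδ]
  exact hf.smul_measure ENNReal.ofReal_ne_top

lemma memLp_mol {f : 𝔼 d → F} (hf : MemLp f 2) (x : 𝔼 d) {δ : ℝ} (hδ : δ ≠ 0) :
    MemLp (fun y => f (x - δ • y)) 2 (molMeasure d) := by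
  obtain ⟨c, hc, hle⟩ := exists_molMeasure_le (d := d)
  exact (memLp_comp_sub_smul hf x hδ).of_measure_le_smul hc hle

lemma integrable_mol {f : 𝔼 d → F} (hf : MemLp f 2) (x : 𝔼 d) {δ : ℝ} (hδ : δ ≠ 0) :
    Integrable (fun y => f (x - δ • y)) (molMeasure d) :=
  (memLp_mol hf x hδ).integrable (by norm_num)

lemma ae_comp_sub_smul {p : 𝔼 d → Prop} (hp : ∀ᵐ x, p x) (x : 𝔼 d) {δ : ℝ} (hδ : δ ≠ 0) :
    ∀ᵐ y ∂(molMeasure d), p (x - δ • y) := by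
  refine molMeasure_ac.ae_le ?_
  have : ∀ᵐ z ∂(Measure.map (fun y : 𝔼 d => x - δ • y) volume), p z := by
    rw [map_sub_smul x hδ]
    exact Measure.ae_smul_measure hp _
  exact ae_of_ae_map (by fun_prop) this

lemma mol_congr {f g : 𝔼 d → F} (hfg : f =ᵐ[volume] g) {δ : ℝ} (hδ : δ ≠ 0) :
    mol δ f = mol δ g := by
  ext x
  refine integral_congr_ae ?_
  exact ae_comp_sub_smul hfg x hδ

lemma mol_eq_zero {f : 𝔼 d → F} {x : 𝔼 d} {δ : ℝ} (hδ : 0 ≤ δ)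
    (h : ∀ z ∈ closedBall x δ, f z = 0) : mol δ f x = 0 := by
  refine integral_eq_zero_of_ae ?_
  filter_upwards [ae_molMeasure_norm_lt] with y hy
  refine h _ ?_
  rw [mem_closedBall, dist_eq_norm]
  simp only [sub_sub_cancel_left, norm_neg, norm_smul, Real.norm_eq_abs, abs_of_nonneg hδ]
  nlinarith

lemma mol_nonneg {f : 𝔼 d → ℝ} (hf : ∀ x, 0 ≤ f x) (δ : ℝ) (x : 𝔼 d) : 0 ≤ mol δ f x :=
  integral_nonneg fun _ => hf _

lemma mol_mono {f g : 𝔼 d → ℝ} (hf : MemLp f 2) (hg : MemLp g 2) (h : f ≤ᵐ[volume] g)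
    {δ : ℝ} (hδ : δ ≠ 0) (x : 𝔼 d) : mol δ f x ≤ mol δ g x :=
  integral_mono_ae (integrable_mol hf x hδ) (integrable_mol hg x hδ)
    (ae_comp_sub_smul h x hδ)

/-! #### Convergence in `L²` -/

lemma enorm_integral_sq_le {α : Type*} [MeasurableSpace α] {μ : Measure α}
    [IsProbabilityMeasure μ] {f : α → F} (hf : AEStronglyMeasurable f μ) :
    ‖∫ y, f y ∂μ‖ₑ ^ 2 ≤ ∫⁻ y, ‖f y‖ₑ ^ 2 ∂μ := by
  have h1 : ‖∫ y, f y ∂μ‖ₑ ≤ eLpNorm f 1 μ := by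
    rw [eLpNorm_one_eq_lintegral_enorm]; exact enorm_integral_le_lintegral_enorm f
  have h2 := h1.trans (eLpNorm_le_eLpNorm_of_exponent_le (q := 2) (by norm_num) hf)
  have h3 : eLpNorm f 2 μ ^ 2 = ∫⁻ y, ‖f y‖ₑ ^ 2 ∂μ := by
    have := eLpNorm_nnreal_pow_eq_lintegral (μ := μ) (f := f) (p := 2) (by norm_num)
    simpa using this
  rw [← h3]
  gcongr

lemma eLpNorm_two_sq {α H : Type*} [MeasurableSpace α] [NormedAddCommGroup H] (μ : Measure α)
    (f : α → H) :
    eLpNorm f 2 μ ^ 2 = ∫⁻ y, ‖f y‖ₑ ^ 2 ∂μ := by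
  have := eLpNorm_nnreal_pow_eq_lintegral (μ := μ) (f := f) (p := 2) (by norm_num)
  simpa using this

/-- Translations are continuous in `L²`. -/
lemma tendsto_eLpNorm_translate {f : 𝔼 d → F} (hf : MemLp f 2) :
    Tendsto (fun z : 𝔼 d => eLpNorm (fun x => f (x - z) - f x) 2) (𝓝 0) (𝓝 0) := by
  let g : 𝔼 d → C(𝔼 d, 𝔼 d) := fun z => ⟨fun x => x - z, by fun_prop⟩
  have hgm : ∀ z, MeasurePreserving (g z) volume volume := fun z =>
    measurePreserving_sub_right volume z
  have hg : Tendsto g (𝓝 0) (𝓝 (g 0)) := by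
    let k : C(𝔼 d × 𝔼 d, 𝔼 d) := ⟨fun q => q.2 - q.1, by fun_prop⟩
    exact k.curry.continuous.tendsto 0
  have : Fact ((1 : ℝ≥0∞) ≤ 2) := ⟨by norm_num⟩
  have := Filter.Tendsto.compMeasurePreservingLp (p := 2) (f := fun _ => hf.toLp f)
    (f₀ := hf.toLp f) tendsto_const_nhds hg hgm (hgm 0) (by norm_num)
  have h0 : Lp.compMeasurePreserving (g 0) (hgm 0) (hf.toLp f) = hf.toLp f := by
    refine Lp.ext ?_
    refine (Lp.coeFn_compMeasurePreserving _ _).trans ?_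
    refine Eventually.of_forall fun x => ?_
    simp [g]
  rw [h0, tendsto_iff_edist_tendsto_0] at this
  refine this.congr fun z => ?_
  rw [Lp.edist_def]
  refine eLpNorm_congr_ae ?_
  have e1 := (hf.coeFn_toLp)
  have e2 := (hgm z).quasiMeasurePreserving.ae e1
  filter_upwards [Lp.coeFn_compMeasurePreserving (hf.toLp f) (hgm z), e1, e2] with x h1 h2 h3
  simp only [Pi.sub_apply]
  rw [h1, h2]
  simp only [Function.comp]
  rw [h3]
  rfl

/-- Mollifications converge in `L²`. -/
lemma tendsto_mol [CompleteSpace F] {f : 𝔼 d → F} (hf : MemLp f 2) :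
    Tendsto (fun δ : ℝ => eLpNorm (fun x => mol δ f x - f x) 2) (𝓝[>] 0) (𝓝 0) := by
  wlog hsm : StronglyMeasurable f generalizing f
  · have h1 := this (hf.ae_eq hf.1.ae_eq_mk) hf.1.stronglyMeasurable_mk
    refine h1.congr' ?_
    filter_upwards [self_mem_nhdsWithin] with δ hδ
    rw [← mol_congr hf.1.ae_eq_mk (ne_of_gt hδ)]
    refine eLpNorm_congr_ae ?_
    filter_upwards [hf.1.ae_eq_mk] with x hx
    rw [hx]
  rw [ENNReal.tendsto_nhds_zero]
  intro ε hε
  have h1 := tendsto_eLpNorm_translate hf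
  rw [ENNReal.tendsto_nhds_zero] at h1
  obtain ⟨r, hr, hball⟩ := Metric.eventually_nhds_iff.1 (h1 ε hε)
  filter_upwards [Ioo_mem_nhdsGT hr] with δ hδ
  have hδ0 : δ ≠ 0 := ne_of_gt hδ.1
  have key : eLpNorm (fun x => mol δ f x - f x) 2 ^ 2 ≤ ε ^ 2 := by
    rw [eLpNorm_two_sq]
    calc ∫⁻ x, ‖mol δ f x - f x‖ₑ ^ 2
        ≤ ∫⁻ x, ∫⁻ y, ‖f (x - δ • y) - f x‖ₑ ^ 2 ∂(molMeasure d) := by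
          refine lintegral_mono fun x => ?_
          have : mol δ f x - f x = ∫ y, (f (x - δ • y) - f x) ∂(molMeasure d) := by
            rw [integral_sub (integrable_mol hf x hδ0) (integrable_const _)]
            simp [mol]
          rw [this]
          exact enorm_integral_sq_le
            ((integrable_mol hf x hδ0).sub (integrable_const _)).1
      _ = ∫⁻ y, (∫⁻ x, ‖f (x - δ • y) - f x‖ₑ ^ 2) ∂(molMeasure d) := by
          refine lintegral_lintegral_swap ?_
          have hm : StronglyMeasurable (fun q : 𝔼 d × 𝔼 d => f (q.1 - δ • q.2) - f q.1) :=
            (hsm.comp_measurable (by fun_prop)).sub (hsm.comp_measurable (by fun_prop))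
          exact (hm.enorm.pow_const 2).aemeasurable
      _ ≤ ∫⁻ y, ε ^ 2 ∂(molMeasure d) := by
          refine lintegral_mono_ae ?_
          filter_upwards [ae_molMeasure_norm_lt] with y hy
          rw [← eLpNorm_two_sq]
          gcongr
          refine hball ?_
          rw [dist_zero_right, norm_smul, Real.norm_eq_abs, abs_of_pos hδ.1]
          nlinarith [hδ.1, hδ.2, norm_nonneg y]
      _ = ε ^ 2 := by simp
  exact (ENNReal.pow_le_pow_left_iff (by norm_num)).1 key

/-! #### Smoothness -/

/-- The rescaled mollifier `δ^{-d} ρ(·/δ)`. -/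
def rhoScaled (δ : ℝ) (z : 𝔼 d) : ℝ := |(δ⁻¹ ^ d)| * rho (δ⁻¹ • z)

lemma contDiff_rhoScaled (δ : ℝ) : ContDiff ℝ ∞ (rhoScaled (d := d) δ) :=
  contDiff_const.mul (contDiff_rho.comp (contDiff_const_smul _))

lemma rhoScaled_eq_zero {δ : ℝ} (hδ : 0 < δ) {z : 𝔼 d} (hz : δ ≤ ‖z‖) : rhoScaled δ z = 0 := by
  rw [rhoScaled, rho_eq_zero, mul_zero]
  rw [norm_smul, norm_inv, Real.norm_eq_abs, abs_of_pos hδ, inv_mul_eq_div, one_le_div hδ]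
  exact hz

lemma compact_rhoScaled {δ : ℝ} (hδ : 0 < δ) : HasCompactSupport (rhoScaled (d := d) δ) := by
  refine HasCompactSupport.of_support_subset_isCompact (isCompact_closedBall (0 : 𝔼 d) δ) ?_
  intro y hy
  by_contra h
  exact hy (rhoScaled_eq_zero hδ (by simpa using (not_le.1 (by simpa using h)).le))

lemma mol_eq_integral (f : 𝔼 d → F) {δ : ℝ} (hδ : 0 < δ) (x : 𝔼 d) :
    mol δ f x = ∫ z, rhoScaled δ (x - z) • f z := by
  rw [mol, integral_molMeasure]
  have e1 : ∫ z, rhoScaled δ (x - z) • f z = ∫ t, rhoScaled δ t • f (x - t) := by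
    rw [← integral_sub_left_eq_self _ volume x]
    simp
  have e2 := Measure.integral_comp_smul volume (fun t : 𝔼 d => rhoScaled δ t • f (x - t)) δ
  have e3 : ∀ y : 𝔼 d, rhoScaled δ (δ • y) = |(δ⁻¹ ^ d)| * rho y := by
    intro y; rw [rhoScaled, smul_smul, inv_mul_cancel₀ hδ.ne', one_smul]
  simp only [e3, mul_smul] at e2
  rw [integral_smul, finrank_euclideanSpace_fin, inv_pow] at e2
  rw [e1]
  refine smul_right_injective F (r := |(δ ^ d)⁻¹|) (by positivity) ?_
  simpa using e2

lemma mol_eq_convolution (f : 𝔼 d → F) {δ : ℝ} (hδ : 0 < δ) :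
    mol δ f = convolution f (rhoScaled δ) (ContinuousLinearMap.lsmul ℝ ℝ).flip volume := by
  ext x
  rw [mol_eq_integral f hδ, convolution_def]
  rfl

lemma contDiff_mol {f : 𝔼 d → F} (hf : MemLp f 2) {δ : ℝ} (hδ : 0 < δ) :
    ContDiff ℝ ∞ (mol δ f) := by
  rw [mol_eq_convolution f hδ]
  exact (compact_rhoScaled hδ).contDiff_convolution_right _
    (hf.locallyIntegrable (by norm_num)) (contDiff_rhoScaled δ)

lemma fderiv_mol {f : 𝔼 d → ℝ} (hf : MemLp f 2) {δ : ℝ} (hδ : 0 < δ) (x v : 𝔼 d) :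
    fderiv ℝ (mol δ f) x v = ∫ z, f z * fderiv ℝ (rhoScaled δ) (x - z) v := by
  have hl : LocallyIntegrable f volume := hf.locallyIntegrable (by norm_num)
  have hc := compact_rhoScaled (d := d) hδ
  have h1 : ContDiff ℝ 1 (rhoScaled (d := d) δ) := (contDiff_rhoScaled δ).of_le (by simp)
  rw [mol_eq_convolution f hδ, (hc.hasFDerivAt_convolution_right _ hl h1 x).fderiv,
    convolution_precompR_apply _ hl (hc.fderiv ℝ) (h1.continuous_fderiv (by simp)),
    convolution_def]
  simp [mul_comm]

/-- The translate `z ↦ ρ_δ(x - z)` is a test function on every set that contains the closed ball. -/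
lemma isTest_rhoScaled {D : Set (𝔼 d)} {δ : ℝ} (hδ : 0 < δ) {x : 𝔼 d}
    (hx : closedBall x δ ⊆ D) : IsTest D fun z => rhoScaled δ (x - z) := by
  have hs : Function.support (fun z => rhoScaled δ (x - z)) ⊆ closedBall x δ := by
    intro y hy
    by_contra h
    refine hy (rhoScaled_eq_zero hδ ?_)
    rw [mem_closedBall, not_le, dist_comm, dist_eq_norm] at h
    exact h.le
  refine ⟨(contDiff_rhoScaled δ).comp (contDiff_const.sub contDiff_id), ?_, ?_⟩
  · exact HasCompactSupport.of_support_subset_isCompact (isCompact_closedBall x δ) hs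
  · exact (closure_minimal hs isClosed_closedBall).trans hx

/-- Mollification commutes with the weak gradient at points at distance more than `δ` from the
complement of `D`. -/
lemma gradient_mol {D : Set (𝔼 d)} {u : 𝔼 d → ℝ} {G : 𝔼 d → 𝔼 d} (h : IsWeakGrad D u G)
    (hu : MemLp u 2) (hG : MemLp G 2) {δ : ℝ} (hδ : 0 < δ) {x : 𝔼 d}
    (hx : closedBall x δ ⊆ D) : gradient (mol δ u) x = mol δ G x := by
  refine ext_inner_right ℝ fun v => ?_
  have hφ := isTest_rhoScaled hδ hx
  rw [inner_gradient_eq, fderiv_mol hu hδ, mol_eq_integral G hδ]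
  have h1 := h.integral_eq hφ v
  have e1 : ∀ z, fderiv ℝ (fun z => rhoScaled δ (x - z)) z v
      = - fderiv ℝ (rhoScaled δ) (x - z) v := by
    intro z
    have hK : DifferentiableAt ℝ (rhoScaled δ) (x - z) :=
      (contDiff_rhoScaled δ).differentiable (by simp) _
    have := hK.hasFDerivAt.comp z ((hasFDerivAt_id z).const_sub x)
    rw [show (fun z => rhoScaled δ (x - z)) = rhoScaled δ ∘ HSub.hSub x from rfl, this.fderiv]
    simp
  simp only [e1, mul_neg, integral_neg, neg_inj] at h1
  rw [h1, real_inner_comm, ← integral_inner]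
  · congr 1; ext z; rw [real_inner_smul_right, real_inner_comm, mul_comm]
  · exact memLp_one_iff_integrable.1 (hG.smul (p := 2) (r := 1)
      (hφ.continuous.memLp_of_hasCompactSupport hφ.compact))

end

/-! ### Passage to the limit in `L²` -/

section limits

variable {α F : Type*} [MeasurableSpace α] {μ : Measure α} [NormedAddCommGroup F]

lemma memLp_two_mol [NormedSpace ℝ F] {f : 𝔼 d → F} (hf : MemLp f 2) {δ : ℝ} (hδ : 0 < δ) :
    MemLp (mol δ f) 2 := by
  have hg : MemLp (hf.1.mk f) 2 := hf.ae_eq hf.1.ae_eq_mk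
  have hsm : StronglyMeasurable (hf.1.mk f) := hf.1.stronglyMeasurable_mk
  have e : mol δ f = mol δ (hf.1.mk f) := mol_congr hf.1.ae_eq_mk hδ.ne'
  generalize hf.1.mk f = g at hg hsm e
  rw [e]
  refine ⟨(contDiff_mol hg hδ).continuous.aestronglyMeasurable, ?_⟩
  have key : eLpNorm (mol δ g) 2 volume ^ 2 ≤ eLpNorm g 2 volume ^ 2 := by
    have h1 : ∫⁻ x, ‖mol δ g x‖ₑ ^ 2
        ≤ ∫⁻ x, ∫⁻ y, ‖g (x - δ • y)‖ₑ ^ 2 ∂(molMeasure d) :=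
      lintegral_mono fun x => enorm_integral_sq_le (integrable_mol hg x hδ.ne').1
    have h2 : ∫⁻ x, ∫⁻ y, ‖g (x - δ • y)‖ₑ ^ 2 ∂(molMeasure d)
        = ∫⁻ y, (∫⁻ x, ‖g (x - δ • y)‖ₑ ^ 2) ∂(molMeasure d) := by
      refine lintegral_lintegral_swap ?_
      have hm : StronglyMeasurable (fun q : 𝔼 d × 𝔼 d => g (q.1 - δ • q.2)) :=
        hsm.comp_measurable (by fun_prop)
      exact (hm.enorm.pow_const 2).aemeasurable
    have h3 : ∀ y : 𝔼 d, ∫⁻ x, ‖g (x - δ • y)‖ₑ ^ 2 = eLpNorm g 2 volume ^ 2 := fun y => by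
      rw [eLpNorm_two_sq]
      exact lintegral_sub_right_eq_self (μ := volume) (fun x => ‖g x‖ₑ ^ 2) (δ • y)
    simp only [h3, lintegral_const, measure_univ, mul_one] at h2
    rw [eLpNorm_two_sq volume (mol δ g), ← h2]
    exact h1
  exact ((ENNReal.pow_le_pow_left_iff (by norm_num)).1 key).trans_lt hg.2

/-- The integrated inner product is continuous for convergence in `L²`. -/
lemma tendsto_integral_inner {H : Type*} [NormedAddCommGroup H] [InnerProductSpace ℝ H]
    {f g : α → H} {fn gn : ℕ → α → H} (hf : MemLp f 2 μ) (hg : MemLp g 2 μ)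
    (hfn : ∀ n, MemLp (fn n) 2 μ) (hgn : ∀ n, MemLp (gn n) 2 μ)
    (h1 : Tendsto (fun n => eLpNorm (fun x => fn n x - f x) 2 μ) atTop (𝓝 0))
    (h2 : Tendsto (fun n => eLpNorm (fun x => gn n x - g x) 2 μ) atTop (𝓝 0)) :
    Tendsto (fun n => ∫ x, inner ℝ (fn n x) (gn n x) ∂μ) atTop (𝓝 (∫ x, inner ℝ (f x) (g x) ∂μ)) := by
  have t1 := (Lp.tendsto_Lp_iff_tendsto_eLpNorm'' fn hfn f hf).2 h1
  have t2 := (Lp.tendsto_Lp_iff_tendsto_eLpNorm'' gn hgn g hg).2 h2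
  have := t1.inner t2 (𝕜 := ℝ)
  simp only [L2.inner_def] at this
  have e : ∀ {a b : α → H} (ha : MemLp a 2 μ) (hb : MemLp b 2 μ),
      ∫ x, inner ℝ (ha.toLp a x) (hb.toLp b x) ∂μ = ∫ x, inner ℝ (a x) (b x) ∂μ := by
    intro a b ha hb
    refine integral_congr_ae ?_
    filter_upwards [ha.coeFn_toLp, hb.coeFn_toLp] with x h1 h2
    rw [h1, h2]
  rw [e hf hg] at this
  refine this.congr fun n => e _ _

lemma integrable_inner_of_memLp {H : Type*} [NormedAddCommGroup H] [InnerProductSpace ℝ H]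
    {f g : α → H} (hf : MemLp f 2 μ) (hg : MemLp g 2 μ) :
    Integrable (fun x => inner ℝ (f x) (g x)) μ := by
  refine memLp_one_iff_integrable.1 ?_
  exact MemLp.of_bilin (p := 2) (q := 2) (fun a b => inner ℝ a b) 1 hf hg (hf.1.inner hg.1)
    (Eventually.of_forall fun x => by simpa using nnnorm_inner_le_nnnorm (𝕜 := ℝ) (f x) (g x))

/-- Dominated convergence in `L²`. -/
lemma tendsto_eLpNorm_of_dominated {f : α → F} {fn : ℕ → α → F} {g : α → ℝ}
    (hg : MemLp g 2 μ) (hfn : ∀ n, AEStronglyMeasurable (fn n) μ)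
    (hb : ∀ n, ∀ᵐ x ∂μ, ‖fn n x‖ ≤ g x)
    (h : ∀ᵐ x ∂μ, Tendsto (fun n => fn n x) atTop (𝓝 (f x))) :
    MemLp f 2 μ ∧ Tendsto (fun n => eLpNorm (fun x => fn n x - f x) 2 μ) atTop (𝓝 0) := by
  have mf : AEStronglyMeasurable f μ := aestronglyMeasurable_of_tendsto_ae atTop hfn h
  have bf : ∀ᵐ x ∂μ, ‖f x‖ ≤ g x := by
    filter_upwards [h, ae_all_iff.2 hb] with x hx hx'
    exact le_of_tendsto hx.norm (Eventually.of_forall hx')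
  refine ⟨hg.mono mf (bf.mono fun x hx => hx.trans (le_abs_self _)), ?_⟩
  have key : Tendsto (fun n => eLpNorm (fun x => fn n x - f x) 2 μ ^ 2) atTop (𝓝 0) := by
    have e2 := fun n => eLpNorm_two_sq μ (fun x => fn n x - f x)
    simp only [e2]
    have : (0 : ℝ≥0∞) = ∫⁻ x, 0 ∂μ := by simp
    rw [this]
    refine tendsto_lintegral_of_dominated_convergence' (fun x => ‖2 * g x‖ₑ ^ 2) ?_ ?_ ?_ ?_
    · exact fun n => (((hfn n).sub mf).enorm.pow_const 2)
    · intro n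
      filter_upwards [hb n, bf] with x h1 h2
      gcongr
      rw [← ofReal_norm, ← ofReal_norm]
      refine ENNReal.ofReal_le_ofReal ?_
      calc ‖fn n x - f x‖ ≤ ‖fn n x‖ + ‖f x‖ := norm_sub_le _ _
        _ ≤ 2 * g x := by linarith
        _ ≤ ‖2 * g x‖ := le_abs_self _
    · rw [← eLpNorm_two_sq]
      exact (ENNReal.pow_lt_top (hg.const_mul 2).2).ne
    · filter_upwards [h] with x hx
      have h0 : Tendsto (fun n => fn n x - f x) atTop (𝓝 0) := by
        simpa using hx.sub_const (f x)
      have h1 := h0.enorm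
      simpa [Function.comp_def] using (ENNReal.continuous_pow 2).tendsto _ |>.comp h1
  have := (ENNReal.continuous_rpow_const (y := (1 / 2 : ℝ))).tendsto 0 |>.comp key
  rw [ENNReal.zero_rpow_of_pos (by norm_num)] at this
  refine this.congr fun n => ?_
  simp only [Function.comp]
  rw [← ENNReal.rpow_natCast, ← ENNReal.rpow_mul]
  norm_num

lemma memLp_indicator_of_restrict {D : Set (𝔼 d)} (hD : MeasurableSet D) {f : 𝔼 d → F}
    (hf : MemLp f 2 (volume.restrict D)) : MemLp (D.indicator f) 2 :=
  (memLp_indicator_iff_restrict hD).2 hf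

end limits

lemma IsWeakGrad.indicator {D : Set (𝔼 d)} (hD : MeasurableSet D) {u : 𝔼 d → ℝ} {G : 𝔼 d → 𝔼 d}
    (h : IsWeakGrad D u G) : IsWeakGrad D (D.indicator u) (D.indicator G) :=
  h.congr (indicator_ae_eq_restrict hD).symm (indicator_ae_eq_restrict hD).symm

/-! ### The chain rule -/

section chain

variable {ι : Type*} [Fintype ι] {D : Set (𝔼 d)} {V : ι → 𝔼 d → ℝ} {G : ι → 𝔼 d → 𝔼 d}
  {F : (ι → ℝ) → ℝ} {dF : ι → (ι → ℝ) → ℝ} {L : ℝ}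

lemma lipschitz_of_partials
    (hF : ∀ y, HasFDerivAt F (∑ i, dF i y • ContinuousLinearMap.proj (R := ℝ) (φ := fun _ : ι => ℝ) i) y)
    (hL : ∀ i y, |dF i y| ≤ L) (a b : ι → ℝ) : |F a - F b| ≤ Fintype.card ι * L * ‖a - b‖ := by
  have hb : ∀ y ∈ (univ : Set (ι → ℝ)),
      ‖∑ i, dF i y • ContinuousLinearMap.proj (R := ℝ) (φ := fun _ : ι => ℝ) i‖
        ≤ Fintype.card ι * L := by
    intro y _
    refine (norm_sum_le _ _).trans ?_
    calc ∑ i, ‖dF i y • ContinuousLinearMap.proj (R := ℝ) (φ := fun _ : ι => ℝ) i‖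
        ≤ ∑ i : ι, L := by
          refine Finset.sum_le_sum fun i _ => ?_
          rw [norm_smul]
          have : ‖ContinuousLinearMap.proj (R := ℝ) (φ := fun _ : ι => ℝ) i‖ ≤ 1 :=
            ContinuousLinearMap.opNorm_le_bound _ zero_le_one fun z => by
              simpa using norm_le_pi_norm z i
          calc ‖dF i y‖ * _ ≤ ‖dF i y‖ * 1 := by gcongr
            _ ≤ L := by simpa using hL i y
      _ = _ := by simp
  have := convex_univ.norm_image_sub_le_of_norm_hasFDerivWithin_le
    (fun y _ => (hF y).hasFDerivWithinAt) hb (mem_univ b) (mem_univ a)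
  simpa using this

/-- The chain rule for functions defined on the whole space. -/
lemma IsWeakGrad.chain_aux (hD : IsOpen D)
    (hF : ∀ y, HasFDerivAt F (∑ i, dF i y • ContinuousLinearMap.proj (R := ℝ) (φ := fun _ : ι => ℝ) i) y)
    (hdF : ∀ i, Continuous (dF i)) (hL : ∀ i y, |dF i y| ≤ L)
    (hV : ∀ i, MemLp (V i) 2) (hG : ∀ i, MemLp (G i) 2)
    (h : ∀ i, IsWeakGrad D (V i) (G i)) :
    IsWeakGrad D (fun x => F fun i => V i x) (fun x => ∑ i, dF i (fun i => V i x) • G i x) := by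
  classical
  have hVm : AEMeasurable (fun x => fun i => V i x) volume := aemeasurable_pi_lambda _ fun i => (hV i).1.aemeasurable
  have hGt : ∀ i, MemLp (fun x => dF i (fun i => V i x) • G i x) 2 := by
    intro i
    refine ((hG i).const_smul L).mono ?_ ?_
    · exact ((hdF i).measurable.comp_aemeasurable hVm).aestronglyMeasurable.smul (hG i).1
    · refine Eventually.of_forall fun x => ?_
      simp only [Pi.smul_apply, norm_smul]
      gcongr
      exact (hL i _).trans (le_abs_self _)
  have hcF : Continuous F := continuous_iff_continuousAt.2 fun y => (hF y).continuousAt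
  refine .of_integral ((memLp_finsetSum _ fun i _ => hGt i).restrict D) fun φ hφ v => ?_
  have hK : IsCompact (tsupport φ) := hφ.compact
  have hK0 : ∀ x ∉ tsupport φ, fderiv ℝ φ x = 0 := fun x hx =>
    Function.notMem_support.1 fun hx' => hx (support_fderiv_subset ℝ hx')
  obtain ⟨δ₀, hδ₀, hδD⟩ := hK.exists_cthickening_subset_open hD hφ.subset
  -- a sequence of scales along which the mollifications converge almost everywhere
  have hW : MemLp (fun x => fun i => V i x) 2 := memLp_pi_iff.2 hV
  obtain ⟨δ, hδ, hδae⟩ : ∃ δ : ℕ → ℝ, Tendsto δ atTop (𝓝[>] 0) ∧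
      ∀ᵐ x, Tendsto (fun n => mol (δ n) (fun x => fun i => V i x) x) atTop (𝓝 fun i => V i x) := by
    have hlim := tendsto_mol hW
    let s : ℕ → ℝ := fun n => δ₀ / (n + 1)
    have hs : Tendsto s atTop (𝓝[>] 0) := by
      refine tendsto_nhdsWithin_iff.2 ⟨?_, Eventually.of_forall fun n => by
        simp only [s, mem_Ioi]; positivity⟩
      exact (tendsto_const_div_atTop_nhds_zero_nat δ₀).comp (tendsto_add_atTop_nat 1) |>.congr
        fun n => by simp [s]
    have hm := tendstoInMeasure_of_tendsto_eLpNorm (p := 2) (by norm_num)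
      (fun n => (memLp_two_mol hW (show 0 < s n by simp only [s]; positivity)).1) hW.1 (hlim.comp hs)
    obtain ⟨ns, hns, hae⟩ := hm.exists_seq_tendsto_ae
    exact ⟨s ∘ ns, hs.comp hns.tendsto_atTop, hae⟩
  obtain ⟨N, hN⟩ := eventually_atTop.1 (hδ (Ioo_mem_nhdsGT hδ₀))
  replace hδ : Tendsto (fun n => δ (n + N)) atTop (𝓝[>] 0) := hδ.comp (tendsto_add_atTop_nat N)
  replace hδae : ∀ᵐ x, Tendsto (fun n => mol (δ (n + N)) (fun x => fun i => V i x) x) atTop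
      (𝓝 fun i => V i x) := hδae.mono fun x hx => hx.comp (tendsto_add_atTop_nat N)
  have hN' : ∀ n, δ (n + N) ∈ Ioo 0 δ₀ := fun n => hN _ (by simp)
  generalize hη : (fun n => δ (n + N)) = η at *
  have hη' : ∀ n, δ (n + N) = η n := fun n => congrFun hη n
  simp only [hη'] at hδae hN'
  clear hη hη' hN
  let Vn : ℕ → 𝔼 d → ι → ℝ := fun n x i => mol (η n) (V i) x
  have hVn : ∀ n x, mol (η n) (fun x => fun i => V i x) x = Vn n x := by
    intro n x
    ext i
    simp only [mol, Vn]
    exact eval_integral (fun j => integrable_mol (hV j) x (hN' n).1.ne') i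
  simp only [hVn] at hδae
  have cVn : ∀ n i, ContDiff ℝ ∞ (mol (η n) (V i)) := fun n i => contDiff_mol (hV i) (hN' n).1
  have cVn' : ∀ n, Continuous (Vn n) := fun n => continuous_pi fun i => (cVn n i).continuous
  have dVn : ∀ n x, HasFDerivAt (fun x => F (Vn n x))
      ((∑ i, dF i (Vn n x) • ContinuousLinearMap.proj (R := ℝ) (φ := fun _ : ι => ℝ) i).comp
        (ContinuousLinearMap.pi fun i => fderiv ℝ (mol (η n) (V i)) x)) x := fun n x =>
    (hF (Vn n x)).comp x (hasFDerivAt_pi.2 fun i =>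
      ((cVn n i).differentiable (by simp) x).hasFDerivAt)
  have fVn : ∀ n x, fderiv ℝ (fun x => F (Vn n x)) x v
      = ∑ i, dF i (Vn n x) * inner ℝ (gradient (mol (η n) (V i)) x) v := by
    intro n x
    rw [(dVn n x).fderiv]
    simp [inner_gradient_eq]
  have cg : ∀ n i, Continuous fun x => dF i (Vn n x) * inner ℝ (gradient (mol (η n) (V i)) x) v := by
    intro n i
    refine ((hdF i).comp (cVn' n)).mul ?_
    simp only [inner_gradient_eq]
    exact ((cVn n i).continuous_fderiv (by simp)).clm_apply continuous_const
  -- integration by parts for the smooth approximations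
  set K := tsupport φ
  have m1 : ∀ n i, MemLp (fun x => (dF i (Vn n x) * φ x) • v) 2 := fun n i =>
    Continuous.memLp_of_hasCompactSupport
      ((((hdF i).comp (cVn' n)).mul hφ.continuous).smul continuous_const)
      (hφ.compact.mul_left).smul_right
  have ibp : ∀ n, ∫ x in K, inner ℝ (F (Vn n x)) (fderiv ℝ φ x v)
      = - ∑ i, ∫ x, inner ℝ (mol (η n) (G i) x) ((dF i (Vn n x) * φ x) • v) := by
    intro n
    have hc : Continuous fun x => F (Vn n x) := hcF.comp (cVn' n)
    have hcf : Continuous fun x => fderiv ℝ (fun x => F (Vn n x)) x v := by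
      simp only [fVn]; exact continuous_finsetSum _ fun i _ => cg n i
    have := integral_mul_fderiv_eq_neg_fderiv_mul_of_integrable (μ := volume) (v := v)
      (f := fun x => F (Vn n x)) (g := φ)
      ((hcf.mul hφ.continuous).integrable_of_hasCompactSupport hφ.compact.mul_left)
      ((hc.mul (hφ.continuous_fderiv v)).integrable_of_hasCompactSupport
        (hφ.compact_fderiv v).mul_left)
      ((hc.mul hφ.continuous).integrable_of_hasCompactSupport hφ.compact.mul_left)
      (fun x _ => (dVn n x).differentiableAt) (fun x _ => hφ.differentiable x)
    have e1 : ∫ x in K, inner ℝ (F (Vn n x)) (fderiv ℝ φ x v)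
      = ∫ x, F (Vn n x) * fderiv ℝ φ x v := by
      rw [setIntegral_eq_integral_of_forall_compl_eq_zero]
      · congr 1; ext x; simp [mul_comm]
      · intro x hx
        rw [hK0 x hx]
        simp
    rw [e1, this, ← integral_finsetSum]
    · congr 1
      refine integral_congr_ae (Eventually.of_forall fun x => ?_)
      simp only
      rw [fVn, Finset.sum_mul]
      refine Finset.sum_congr rfl fun i _ => ?_
      by_cases hx : x ∈ tsupport φ
      · rw [gradient_mol (h i) (hV i) (hG i) (hN' n).1, real_inner_smul_right]
        · ring
        · refine ((closedBall_subset_closedBall (hN' n).2.le).trans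
            (closedBall_subset_cthickening hx δ₀)).trans hδD
      · rw [image_eq_zero_of_notMem_tsupport hx]; simp
    · intro i _
      exact integrable_inner_of_memLp (memLp_two_mol (hG i) (hN' n).1) (m1 n i)
  -- convergence of both sides
  have : IsFiniteMeasure ((volume : Measure (𝔼 d)).restrict K) :=
    isFiniteMeasure_restrict.2 hK.measure_lt_top.ne
  have hφv : MemLp (fun x => fderiv ℝ φ x v) 2 (volume.restrict K) :=
    ((hφ.continuous_fderiv v).memLp_of_hasCompactSupport (hφ.compact_fderiv v)).restrict K
  have hLn : 0 ≤ Fintype.card ι * L := by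
    rcases isEmpty_or_nonempty ι with hι | ⟨⟨i⟩⟩
    · simp
    · exact mul_nonneg (by positivity) ((abs_nonneg _).trans (hL i 0))
  have lip := lipschitz_of_partials hF hL
  have mFW : ∀ W : 𝔼 d → ι → ℝ, MemLp W 2 → MemLp (fun x => F (W x)) 2 (volume.restrict K) := by
    intro W hW
    have : MemLp (fun x => F (W x) - F 0) 2 (volume.restrict K) := by
      refine ((hW.restrict K).const_smul (Fintype.card ι * L)).mono
        ((hcF.comp_aestronglyMeasurable (hW.restrict K).1).sub aestronglyMeasurable_const)
        (Eventually.of_forall fun x => ?_)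
      refine (lip _ _).trans ?_
      simp only [sub_zero, Pi.smul_apply, norm_smul, Real.norm_eq_abs, abs_of_nonneg hLn, le_refl]
    exact (this.add (memLp_const (F 0))).ae_eq (Eventually.of_forall fun x => by simp)
  have hVnW : ∀ n, Vn n = mol (η n) (fun x => fun i => V i x) := fun n => by
    ext1 x; exact (hVn n x).symm
  have hVnm : ∀ n, MemLp (Vn n) 2 := fun n => by
    rw [hVnW]; exact memLp_two_mol hW (hN' n).1
  have t1 : Tendsto (fun n => ∫ x in K, inner ℝ (F (Vn n x)) (fderiv ℝ φ x v)) atTop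
      (𝓝 (∫ x in K, inner ℝ (F fun i => V i x) (fderiv ℝ φ x v))) := by
    refine tendsto_integral_inner (mFW _ hW) hφv (fun n => mFW _ (hVnm n)) (fun _ => hφv) ?_
      (by simp)
    have l1 : Tendsto (fun n => ENNReal.ofReal (Fintype.card ι * L) *
        eLpNorm (fun x => Vn n x - fun i => V i x) 2) atTop (𝓝 0) := by
      have := ENNReal.Tendsto.const_mul ((tendsto_mol hW).comp hδ)
        (Or.inr (ENNReal.ofReal_ne_top (r := Fintype.card ι * L)))
      simpa only [mul_zero, Function.comp_def, hVn] using this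
    refine tendsto_of_tendsto_of_tendsto_of_le_of_le tendsto_const_nhds l1
      (fun _ => zero_le) fun n => ?_
    refine (eLpNorm_mono_measure _ Measure.restrict_le_self).trans ?_
    exact eLpNorm_le_mul_eLpNorm_of_ae_le_mul (Eventually.of_forall fun x => lip _ _) 2
  have t2 : ∀ i, Tendsto (fun n => ∫ x, inner ℝ (mol (η n) (G i) x) ((dF i (Vn n x) * φ x) • v))
      atTop (𝓝 (∫ x, inner ℝ (G i x) ((dF i (fun i => V i x) * φ x) • v))) := by
    intro i
    have hLv : MemLp (fun x => (L * ‖v‖) * |φ x|) 2 :=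
      (hφ.continuous.abs.memLp_of_hasCompactSupport hφ.compact.norm).const_mul _
    obtain ⟨l1, l2⟩ := tendsto_eLpNorm_of_dominated (fn := fun n x => (dF i (Vn n x) * φ x) • v)
      (f := fun x => (dF i (fun i => V i x) * φ x) • v) hLv (fun n => (m1 n i).1)
      (fun n => Eventually.of_forall fun x => by
        rw [norm_smul, norm_mul, Real.norm_eq_abs, Real.norm_eq_abs]
        calc |dF i (Vn n x)| * |φ x| * ‖v‖ ≤ L * |φ x| * ‖v‖ := by gcongr; exact hL _ _
          _ = _ := by ring)
      (by
        filter_upwards [hδae] with x hx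
        exact ((((hdF i).tendsto _).comp hx).mul_const _).smul_const v)
    exact tendsto_integral_inner (hG i) l1 (fun n => memLp_two_mol (hG i) (hN' n).1)
      (fun n => m1 n i) ((tendsto_mol (hG i)).comp hδ) l2
  have t3 := (tendsto_finsetSum Finset.univ fun i _ => t2 i).neg
  have fin := tendsto_nhds_unique t1 (t3.congr fun n => (ibp n).symm)
  have e1 : ∫ x in K, inner ℝ (F fun i => V i x) (fderiv ℝ φ x v)
      = ∫ x, F (fun i => V i x) * fderiv ℝ φ x v := by
    rw [setIntegral_eq_integral_of_forall_compl_eq_zero]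
    · congr 1; ext x; simp [mul_comm]
    · intro x hx
      rw [hK0 x hx]
      simp
  rw [← e1, fin, ← integral_finsetSum]
  · congr 2
    ext x
    rw [sum_inner, Finset.sum_mul]
    refine Finset.sum_congr rfl fun i _ => ?_
    rw [real_inner_smul_right, real_inner_smul_left]
    ring
  · intro i _
    have := integrable_inner_of_memLp (hGt i)
      (hφ.continuous.smul continuous_const |>.memLp_of_hasCompactSupport
        (hφ.compact.smul_right (f' := fun _ => v)))
    refine this.congr (Eventually.of_forall fun x => ?_)
    simp only [real_inner_smul_left, real_inner_smul_right, Pi.smul_apply']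
    ring

/-- The chain rule `∇(F ∘ V) = ∑ i, ∂ᵢF(V) ∇Vᵢ` for `F` of class `C¹` with bounded derivatives. -/
lemma IsWeakGrad.chain (hD : IsOpen D) (hDv : volume D ≠ ⊤)
    (hF : ∀ y, HasFDerivAt F (∑ i, dF i y • ContinuousLinearMap.proj (R := ℝ) (φ := fun _ : ι => ℝ) i) y)
    (hdF : ∀ i, Continuous (dF i)) (hL : ∀ i y, |dF i y| ≤ L)
    (hV : ∀ i, MemLp (V i) 2 (volume.restrict D))
    (h : ∀ i, IsWeakGrad D (V i) (G i)) :
    MemLp (fun x => F fun i => V i x) 2 (volume.restrict D) ∧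
    IsWeakGrad D (fun x => F fun i => V i x) (fun x => ∑ i, dF i (fun i => V i x) • G i x) := by
  constructor
  · have : IsFiniteMeasure ((volume : Measure (𝔼 d)).restrict D) := isFiniteMeasure_restrict.2 hDv
    have hLn : 0 ≤ Fintype.card ι * L := by
      rcases isEmpty_or_nonempty ι with hι | ⟨⟨i⟩⟩
      · simp
      · exact mul_nonneg (by positivity) ((abs_nonneg _).trans (hL i 0))
    have lip := lipschitz_of_partials hF hL
    have hcF : Continuous F := continuous_iff_continuousAt.2 fun y => (hF y).continuousAt
    have hW : MemLp (fun x => fun i => V i x) 2 (volume.restrict D) := memLp_pi_iff.2 hV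
    have : MemLp (fun x => F (fun i => V i x) - F 0) 2 (volume.restrict D) := by
      refine (hW.const_smul (Fintype.card ι * L)).mono
        ((hcF.comp_aestronglyMeasurable hW.1).sub aestronglyMeasurable_const)
        (Eventually.of_forall fun x => ?_)
      refine (lip _ _).trans ?_
      simp only [sub_zero, Pi.smul_apply, norm_smul, Real.norm_eq_abs, abs_of_nonneg hLn, le_refl]
    exact (this.add (memLp_const (F 0))).ae_eq (Eventually.of_forall fun x => by simp)
  · have := IsWeakGrad.chain_aux hD hF hdF hL
      (fun i => memLp_indicator_of_restrict hD.measurableSet (hV i))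
      (fun i => memLp_indicator_of_restrict hD.measurableSet (h i).1)
      (fun i => (h i).indicator hD.measurableSet)
    refine this.congr ?_ ?_
    · filter_upwards [ae_restrict_mem hD.measurableSet] with x hx
      simp [hx]
    · filter_upwards [ae_restrict_mem hD.measurableSet] with x hx
      simp [hx]

end chain

/-! ### The modulus, positive parts and directions of `H¹` maps -/

noncomputable section

section smoothing

variable {ι : Type*} [Fintype ι]

/-- The regularized modulus `√(ε² + |y|²)`. -/
def regNorm (ε : ℝ) (y : ι → ℝ) : ℝ := √(ε ^ 2 + ∑ i, y i ^ 2)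

lemma regNorm_pos {ε : ℝ} (hε : 0 < ε) (y : ι → ℝ) : 0 < regNorm ε y :=
  Real.sqrt_pos.2 (add_pos_of_pos_of_nonneg (by positivity)
    (Finset.sum_nonneg fun i _ => sq_nonneg _))

lemma regNorm_sq (ε : ℝ) (y : ι → ℝ) : regNorm ε y ^ 2 = ε ^ 2 + ∑ i, y i ^ 2 :=
  Real.sq_sqrt (add_nonneg (sq_nonneg _) (Finset.sum_nonneg fun i _ => sq_nonneg _))

lemma le_regNorm {ε : ℝ} (hε : 0 ≤ ε) (y : ι → ℝ) : ε ≤ regNorm ε y :=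
  Real.le_sqrt_of_sq_le (le_add_of_nonneg_right (Finset.sum_nonneg fun i _ => sq_nonneg _))

lemma abs_le_regNorm (ε : ℝ) (y : ι → ℝ) (i : ι) : |y i| ≤ regNorm ε y := by
  refine Real.le_sqrt_of_sq_le ?_
  rw [sq_abs]
  have := Finset.single_le_sum (f := fun i => y i ^ 2) (fun i _ => sq_nonneg _) (Finset.mem_univ i)
  nlinarith [sq_nonneg ε]

lemma sqrt_le_regNorm (ε : ℝ) (y : ι → ℝ) : √(∑ i, y i ^ 2) ≤ regNorm ε y :=
  Real.sqrt_le_sqrt (by nlinarith [sq_nonneg ε])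

lemma regNorm_le {ε : ℝ} (hε : 0 ≤ ε) (y : ι → ℝ) : regNorm ε y ≤ √(∑ i, y i ^ 2) + ε := by
  refine Real.sqrt_le_iff.2 ⟨by positivity, ?_⟩
  have h : √(∑ i, y i ^ 2) ^ 2 = ∑ i, y i ^ 2 :=
    Real.sq_sqrt (Finset.sum_nonneg fun i _ => sq_nonneg _)
  nlinarith [Real.sqrt_nonneg (∑ i, y i ^ 2)]

lemma continuous_regNorm (ε : ℝ) : Continuous (regNorm (ι := ι) ε) := by
  unfold regNorm; fun_prop

lemma hasFDerivAt_regNorm {ε : ℝ} (hε : 0 < ε) (y : ι → ℝ) :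
    HasFDerivAt (regNorm ε) (∑ i, (y i / regNorm ε y) •
      ContinuousLinearMap.proj (R := ℝ) (φ := fun _ : ι => ℝ) i) y := by
  have h1 : HasFDerivAt (fun y : ι → ℝ => ε ^ 2 + ∑ i, y i ^ 2)
      (∑ i, (2 * y i) • ContinuousLinearMap.proj (R := ℝ) (φ := fun _ : ι => ℝ) i) y := by
    refine HasFDerivAt.const_add _ (HasFDerivAt.fun_sum fun i _ => ?_)
    have := (ContinuousLinearMap.proj (R := ℝ) (φ := fun _ : ι => ℝ) i).hasFDerivAt (x := y)
    simpa using this.pow 2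
  have h2 := h1.sqrt (by rw [← regNorm_sq]; exact (pow_pos (regNorm_pos hε y) 2).ne')
  refine h2.congr_fderiv ?_
  rw [Finset.smul_sum]
  refine Finset.sum_congr rfl fun i _ => ?_
  rw [smul_smul]
  congr 1
  change 1 / (2 * regNorm ε y) * (2 * y i) = _
  have := (regNorm_pos hε y).ne'
  field_simp

/-- The partial derivatives of `y ↦ yᵢ / √(ε² + |y|²)`. -/
def dirDeriv [DecidableEq ι] (ε : ℝ) (i j : ι) (y : ι → ℝ) : ℝ :=
  (if i = j then 1 else 0) / regNorm ε y - y i * y j / regNorm ε y ^ 3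

variable [DecidableEq ι]

lemma hasFDerivAt_dir {ε : ℝ} (hε : 0 < ε) (i : ι) (y : ι → ℝ) :
    HasFDerivAt (fun y => y i / regNorm ε y) (∑ j, dirDeriv ε i j y •
      ContinuousLinearMap.proj (R := ℝ) (φ := fun _ : ι => ℝ) j) y := by
  have hq := (regNorm_pos hε y).ne'
  have h1 := (ContinuousLinearMap.proj (R := ℝ) (φ := fun _ : ι => ℝ) i).hasFDerivAt (x := y)
  have h2 := h1.mul ((hasDerivAt_inv hq).comp_hasFDerivAt y (hasFDerivAt_regNorm hε y))
  refine h2.congr_fderiv ?_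
  ext h
  simp only [dirDeriv, ContinuousLinearMap.add_apply, ContinuousLinearMap.smul_apply,
    ContinuousLinearMap.sum_apply, ContinuousLinearMap.proj_apply, smul_eq_mul, Finset.mul_sum,
    sub_mul, Finset.sum_sub_distrib, Function.comp]
  have : ∑ j, (if i = j then 1 else 0) / regNorm ε y * h j = (regNorm ε y)⁻¹ * h i := by
    rw [Finset.sum_eq_single i]
    · simp
    · intro j _ hj; simp [hj.symm]
    · simp
  rw [this, sub_eq_add_neg, add_comm, ← Finset.sum_neg_distrib]
  congr 1
  refine Finset.sum_congr rfl fun j _ => ?_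
  field_simp

lemma continuous_dirDeriv {ε : ℝ} (hε : 0 < ε) (i j : ι) :
    Continuous (dirDeriv ε i j) := by
  unfold dirDeriv
  have hq := continuous_regNorm (ι := ι) ε
  refine (continuous_const.div hq fun y => (regNorm_pos hε y).ne').sub ?_
  exact (by fun_prop : Continuous fun y : ι → ℝ => y i * y j).div (hq.pow 3)
    fun y => (pow_pos (regNorm_pos hε y) 3).ne'

lemma abs_dirDeriv_le {ε : ℝ} (hε : 0 < ε) (i j : ι) (y : ι → ℝ) :
    |dirDeriv ε i j y| ≤ 2 / regNorm ε y := by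
  have hq := regNorm_pos hε y
  have h1 : |(if i = j then 1 else 0) / regNorm ε y| ≤ 1 / regNorm ε y := by
    rw [abs_div, abs_of_pos hq]
    gcongr
    split_ifs <;> simp
  have h2 : |y i * y j / regNorm ε y ^ 3| ≤ 1 / regNorm ε y := by
    rw [abs_div, abs_of_pos (pow_pos hq 3), div_le_div_iff₀ (pow_pos hq 3) hq, abs_mul]
    have := mul_le_mul (abs_le_regNorm ε y i) (abs_le_regNorm ε y j) (abs_nonneg _) hq.le
    nlinarith
  calc |dirDeriv ε i j y| ≤ _ := abs_sub _ _
    _ ≤ 1 / regNorm ε y + 1 / regNorm ε y := add_le_add h1 h2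
    _ = 2 / regNorm ε y := by ring

end smoothing

/-- The scales `1/(n+1)`. -/
def scale (n : ℕ) : ℝ := 1 / (n + 1)

lemma scale_pos (n : ℕ) : 0 < scale n := by unfold scale; positivity

lemma scale_le_one (n : ℕ) : scale n ≤ 1 := by
  unfold scale
  rw [div_le_one (by positivity)]
  have : (0 : ℝ) ≤ n := by positivity
  linarith

lemma tendsto_scale : Tendsto scale atTop (𝓝 0) := tendsto_one_div_add_atTop_nhds_zero_nat

section limits

variable {ι : Type*} [Fintype ι]

lemma tendsto_regNorm (y : ι → ℝ) :
    Tendsto (fun n => regNorm (scale n) y) atTop (𝓝 √(∑ i, y i ^ 2)) := by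
  refine tendsto_of_tendsto_of_tendsto_of_le_of_le tendsto_const_nhds ?_
    (fun n => sqrt_le_regNorm _ y) (fun n => regNorm_le (scale_pos n).le y)
  simpa using tendsto_const_nhds.add tendsto_scale

lemma eq_zero_of_sqrt_eq_zero {y : ι → ℝ} (h : √(∑ i, y i ^ 2) = 0) (i : ι) : y i = 0 := by
  rw [Real.sqrt_eq_zero (Finset.sum_nonneg fun i _ => sq_nonneg _),
    Finset.sum_eq_zero_iff_of_nonneg fun i _ => sq_nonneg _] at h
  simpa using h i (Finset.mem_univ i)

lemma tendsto_div_regNorm (y : ι → ℝ) (i : ι) :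
    Tendsto (fun n => y i / regNorm (scale n) y) atTop (𝓝 (y i / √(∑ i, y i ^ 2))) := by
  by_cases h : √(∑ i, y i ^ 2) = 0
  · simp [eq_zero_of_sqrt_eq_zero h i]
  · exact tendsto_const_nhds.div (tendsto_regNorm y) h

end limits

section H1

variable {ι : Type*} [Fintype ι] {D : Set (𝔼 d)} {V : ι → 𝔼 d → ℝ} {G : ι → 𝔼 d → 𝔼 d}

/-- The regularized modulus of an `H¹` map belongs to `H¹`. -/
lemma IsWeakGrad.regNorm (hD : IsOpen D) (hDv : volume D ≠ ⊤)
    (hV : ∀ i, MemLp (V i) 2 (volume.restrict D)) (h : ∀ i, IsWeakGrad D (V i) (G i))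
    {ε : ℝ} (hε : 0 < ε) :
    MemLp (fun x => regNorm ε fun i => V i x) 2 (volume.restrict D) ∧
    IsWeakGrad D (fun x => regNorm ε fun i => V i x)
      (fun x => ∑ i, (V i x / MultiphaseBernoulli.regNorm ε fun i => V i x) • G i x) := by
  refine IsWeakGrad.chain (F := MultiphaseBernoulli.regNorm ε)
    (dF := fun i y => y i / MultiphaseBernoulli.regNorm ε y) (L := 1) hD hDv
    (hasFDerivAt_regNorm hε) ?_ ?_ hV h
  · exact fun i => (continuous_apply i).div (continuous_regNorm ε) fun y => (regNorm_pos hε y).ne'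
  · intro i y
    rw [abs_div, abs_of_pos (regNorm_pos hε y), div_le_one (regNorm_pos hε y)]
    exact abs_le_regNorm ε y i

/-- The modulus of an `H¹` map belongs to `H¹`. -/
lemma IsWeakGrad.modulus (hD : IsOpen D) (hDv : volume D ≠ ⊤)
    (hV : ∀ i, MemLp (V i) 2 (volume.restrict D)) (h : ∀ i, IsWeakGrad D (V i) (G i)) :
    MemLp (fun x => √(∑ i, V i x ^ 2)) 2 (volume.restrict D) ∧
    IsWeakGrad D (fun x => √(∑ i, V i x ^ 2))
      (fun x => ∑ i, (V i x / √(∑ i, V i x ^ 2)) • G i x) := by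
  have hn := fun n => IsWeakGrad.regNorm hD hDv hV h (scale_pos n)
  refine IsWeakGrad.of_tendsto (fun n => (hn n).2) (fun n => (hn n).1)
    (a := fun x => MultiphaseBernoulli.regNorm 1 fun i => V i x) (A := fun x => ∑ i, ‖G i x‖)
    (IsWeakGrad.regNorm hD hDv hV h one_pos).1
    (memLp_finsetSum _ fun i _ => (h i).1.norm) ?_ ?_ ?_ ?_
  · refine fun n => Eventually.of_forall fun x => ?_
    rw [abs_of_pos (regNorm_pos (scale_pos n) _)]
    refine Real.sqrt_le_sqrt ?_
    have := scale_le_one n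
    have := scale_pos n
    nlinarith
  · refine fun n => Eventually.of_forall fun x => ?_
    refine (norm_sum_le _ _).trans (Finset.sum_le_sum fun i _ => ?_)
    rw [norm_smul, Real.norm_eq_abs, abs_div, abs_of_pos (regNorm_pos (scale_pos n) _)]
    refine mul_le_of_le_one_left (norm_nonneg _) ?_
    rw [div_le_one (regNorm_pos (scale_pos n) _)]
    exact abs_le_regNorm _ (fun i => V i x) i
  · exact Eventually.of_forall fun x => tendsto_regNorm fun i => V i x
  · refine Eventually.of_forall fun x => tendsto_finsetSum _ fun i _ => ?_
    exact (tendsto_div_regNorm (fun i => V i x) i).smul_const _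

/-- Positive parts of `H¹` functions. -/
lemma IsWeakGrad.posPart {u : 𝔼 d → ℝ} {Gu : 𝔼 d → 𝔼 d} (hD : IsOpen D) (hDv : volume D ≠ ⊤)
    (hu : MemLp u 2 (volume.restrict D)) (h : IsWeakGrad D u Gu) :
    MemLp (fun x => max (u x) 0) 2 (volume.restrict D) ∧
    IsWeakGrad D (fun x => max (u x) 0) (fun x => ((1 + u x / |u x|) / 2) • Gu x) := by
  obtain ⟨h1, h2⟩ := IsWeakGrad.modulus (ι := Unit) (V := fun _ => u) (G := fun _ => Gu) hD hDv
    (fun _ => hu) (fun _ => h)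
  simp only [Finset.univ_unique, Finset.sum_const, Finset.card_singleton, one_smul,
    Real.sqrt_sq_eq_abs] at h1 h2
  have e : (fun x => max (u x) 0) = fun x => (1 / 2) * (u x + |u x|) := by
    ext x
    rcases le_total 0 (u x) with h | h
    · rw [max_eq_left h, abs_of_nonneg h]; ring
    · rw [max_eq_right h, abs_of_nonpos h]; ring
  have e2 : (fun x => ((1 + u x / |u x|) / 2) • Gu x)
      = fun x => (1 / 2 : ℝ) • (Gu x + (u x / |u x|) • Gu x) := by
    ext1 x
    module
  rw [e, e2]
  exact ⟨(hu.add h1).const_mul _, (h.add h2 hu h1).const_mul _⟩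

variable [DecidableEq ι]

/-- The regularized directions of an `H¹` map belong to `H¹`. -/
lemma IsWeakGrad.dir (hD : IsOpen D) (hDv : volume D ≠ ⊤)
    (hV : ∀ i, MemLp (V i) 2 (volume.restrict D)) (h : ∀ i, IsWeakGrad D (V i) (G i))
    {ε : ℝ} (hε : 0 < ε) (i : ι) :
    MemLp (fun x => V i x / MultiphaseBernoulli.regNorm ε fun i => V i x) 2 (volume.restrict D) ∧
    IsWeakGrad D (fun x => V i x / MultiphaseBernoulli.regNorm ε fun i => V i x)
      (fun x => ∑ j, dirDeriv ε i j (fun i => V i x) • G j x) := by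
  refine IsWeakGrad.chain (F := fun y => y i / MultiphaseBernoulli.regNorm ε y)
    (dF := fun j y => dirDeriv ε i j y) (L := 2 / ε) hD hDv
    (hasFDerivAt_dir hε i) (continuous_dirDeriv hε i) ?_ hV h
  intro j y
  refine (abs_dirDeriv_le hε i j y).trans ?_
  gcongr
  exact le_regNorm hε.le y

/-- If `|b| ≤ |V|`, then `b Vᵢ / |V|` belongs to `H¹`: the regularizations
`b/(1+ε²b²) · Vᵢ/√(ε²+|V|²)` have gradients bounded by `|∇b| + 2 ∑ |∇Vⱼ|`. -/
lemma IsWeakGrad.mul_dir (hD : IsOpen D) (hDv : volume D ≠ ⊤)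
    (hV : ∀ i, MemLp (V i) 2 (volume.restrict D)) (h : ∀ i, IsWeakGrad D (V i) (G i))
    {b : 𝔼 d → ℝ} {Gb : 𝔼 d → 𝔼 d} (hb : MemLp b 2 (volume.restrict D)) (hGb : IsWeakGrad D b Gb)
    (hbV : ∀ x, |b x| ≤ √(∑ i, V i x ^ 2)) (i : ι) :
    MemLp (fun x => b x * (V i x / √(∑ i, V i x ^ 2))) 2 (volume.restrict D) ∧
    IsWeakGrad D (fun x => b x * (V i x / √(∑ i, V i x ^ 2)))
      (fun x => (V i x / √(∑ i, V i x ^ 2)) • Gb x +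
        ∑ j, (b x * dirDeriv 0 i j fun i => V i x) • G j x) := by
  let W : Option ι → 𝔼 d → ℝ := fun o => o.elim b V
  let GW : Option ι → 𝔼 d → 𝔼 d := fun o => o.elim Gb G
  let τ : ℝ → ℝ → ℝ := fun ε s => s / (1 + ε ^ 2 * s ^ 2)
  let τ' : ℝ → ℝ → ℝ := fun ε s => (1 - ε ^ 2 * s ^ 2) / (1 + ε ^ 2 * s ^ 2) ^ 2
  have hden : ∀ ε s : ℝ, 0 < 1 + ε ^ 2 * s ^ 2 := fun ε s => by positivity
  have hτ' : ∀ ε s, HasDerivAt (τ ε) (τ' ε s) s := by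
    intro ε s
    have h1 : HasDerivAt (fun s : ℝ => 1 + ε ^ 2 * s ^ 2) (ε ^ 2 * (2 * s)) s := by
      simpa using ((hasDerivAt_pow 2 s).const_mul (ε ^ 2)).const_add 1
    refine ((hasDerivAt_id s).div h1 (hden ε s).ne').congr_deriv ?_
    simp only [τ', id]
    congr 1; ring
  have hτb : ∀ ε s, |τ ε s| ≤ |s| := by
    intro ε s
    simp only [τ]
    rw [abs_div, abs_of_pos (hden ε s)]
    exact div_le_self (abs_nonneg _) (by nlinarith [sq_nonneg (ε * s)])
  have hτε : ∀ ε s, 0 < ε → |τ ε s| ≤ 1 / ε := by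
    intro ε s hε
    simp only [τ]
    rw [abs_div, abs_of_pos (hden ε s), div_le_div_iff₀ (hden ε s) hε]
    have : (ε * |s|) ^ 2 = ε ^ 2 * s ^ 2 := by rw [mul_pow, sq_abs]
    nlinarith [sq_nonneg (ε * |s| - 1), sq_nonneg (ε * |s|)]
  have hτ'b : ∀ ε s, |τ' ε s| ≤ 1 := by
    intro ε s
    simp only [τ']
    rw [abs_div, abs_of_pos (pow_pos (hden ε s) 2), div_le_one (pow_pos (hden ε s) 2), abs_le]
    have : 0 ≤ ε ^ 2 * s ^ 2 := by positivity
    constructor <;> nlinarith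
  let F : ℝ → (Option ι → ℝ) → ℝ := fun ε y =>
    τ ε (y none) * (y (some i) / MultiphaseBernoulli.regNorm ε fun j => y (some j))
  let dF : ℝ → Option ι → (Option ι → ℝ) → ℝ := fun ε o y =>
    o.elim (τ' ε (y none) * (y (some i) / MultiphaseBernoulli.regNorm ε fun j => y (some j)))
      (fun j => τ ε (y none) * dirDeriv ε i j fun j => y (some j))
  have hF : ∀ ε, 0 < ε → ∀ y, HasFDerivAt (F ε) (∑ o, dF ε o y •
      ContinuousLinearMap.proj (R := ℝ) (φ := fun _ : Option ι => ℝ) o) y := by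
    intro ε hε y
    have h1 := (ContinuousLinearMap.proj (R := ℝ) (φ := fun _ : Option ι => ℝ) none).hasFDerivAt
      (x := y)
    have h2 := (hτ' ε (y none)).comp_hasFDerivAt y h1
    have h3 : HasFDerivAt (fun y : Option ι → ℝ => fun j => y (some j))
      (ContinuousLinearMap.pi fun j => ContinuousLinearMap.proj (R := ℝ)
        (φ := fun _ : Option ι => ℝ) (some j)) y :=
    hasFDerivAt_pi.2 fun j => (ContinuousLinearMap.proj (R := ℝ)
      (φ := fun _ : Option ι => ℝ) (some j)).hasFDerivAt
    have h4 := (hasFDerivAt_dir hε i (fun j => y (some j))).comp y h3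
    refine (h2.mul h4).congr_fderiv ?_
    ext z
    simp [dF, Fintype.sum_option, Finset.mul_sum, Function.comp]
    rw [add_comm]
    congr 1
    · ring
    · exact Finset.sum_congr rfl fun j _ => by ring
  have hdirb : ∀ ε, 0 < ε → ∀ y : Option ι → ℝ,
      |y (some i) / MultiphaseBernoulli.regNorm ε fun j => y (some j)| ≤ 1 := by
    intro ε hε y
    rw [abs_div, abs_of_pos (regNorm_pos hε _), div_le_one (regNorm_pos hε _)]
    exact abs_le_regNorm ε (fun j => y (some j)) i
  have hsome : Continuous fun y : Option ι → ℝ => fun j => y (some j) := by fun_prop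
  have hcont : ∀ ε, 0 < ε → ∀ o, Continuous (dF ε o) := by
    intro ε hε o
    cases o with
    | none =>
      refine Continuous.mul ?_ ?_
      · simp only [τ']
        exact Continuous.div (by fun_prop) (by fun_prop) fun y => (pow_pos (hden _ _) 2).ne'
      · exact (continuous_apply (some i)).div ((continuous_regNorm ε).comp hsome)
          fun y => (regNorm_pos hε _).ne'
    | some j =>
      refine Continuous.mul ?_ ((continuous_dirDeriv hε i j).comp hsome)
      simp only [τ]
      exact Continuous.div (by fun_prop) (by fun_prop) fun y => (hden _ _).ne'
  have hbd : ∀ ε, 0 < ε → ∀ o y, |dF ε o y| ≤ 1 + 1 / ε * (2 / ε) := by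
    intro ε hε o y
    cases o with
    | none =>
      simp only [dF, Option.elim, abs_mul]
      have := mul_le_mul (hτ'b ε (y none)) (hdirb ε hε y) (abs_nonneg _) zero_le_one
      have h0 : 0 ≤ 1 / ε * (2 / ε) := by positivity
      linarith
    | some j =>
      simp only [dF, Option.elim, abs_mul]
      have h1 : |dirDeriv ε i j fun j => y (some j)| ≤ 2 / ε :=
        (abs_dirDeriv_le hε i j _).trans (by gcongr; exact le_regNorm hε.le _)
      have := mul_le_mul (hτε ε (y none) hε) h1 (abs_nonneg _) (by positivity)
      linarith
  have hW : ∀ o, MemLp (W o) 2 (volume.restrict D) := fun o => by cases o <;> simp [W, hb, hV]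
  have hGW : ∀ o, IsWeakGrad D (W o) (GW o) := fun o => by cases o <;> simp [W, GW, hGb, h]
  have hn := fun n => IsWeakGrad.chain hD hDv (hF (scale n) (scale_pos n))
    (hcont _ (scale_pos n)) (hbd _ (scale_pos n)) hW hGW
  refine IsWeakGrad.of_tendsto (fun n => (hn n).2) (fun n => (hn n).1)
    (a := fun x => |b x|) (A := fun x => ‖Gb x‖ + ∑ j, 2 * ‖G j x‖)
    hb.norm (hGb.1.norm.add (memLp_finsetSum _ fun j _ => (h j).1.norm.const_mul 2)) ?_ ?_ ?_ ?_
  · refine fun n => Eventually.of_forall fun x => ?_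
    simp only [F, abs_mul]
    exact (mul_le_of_le_one_right (abs_nonneg _) (hdirb _ (scale_pos n) fun o => W o x)).trans
      (hτb _ _)
  · refine fun n => Eventually.of_forall fun x => ?_
    rw [Fintype.sum_option]
    refine (norm_add_le _ _).trans (add_le_add ?_ ((norm_sum_le _ _).trans
      (Finset.sum_le_sum fun j _ => ?_)))
    · rw [norm_smul]
      refine mul_le_of_le_one_left (norm_nonneg _) ?_
      simp only [dF, Option.elim, norm_mul]
      exact mul_le_one₀ (hτ'b _ _) (norm_nonneg _) (hdirb _ (scale_pos n) fun o => W o x)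
    · rw [norm_smul]
      refine mul_le_mul_of_nonneg_right ?_ (norm_nonneg _)
      simp only [dF, Option.elim, norm_mul, Real.norm_eq_abs]
      have hq := regNorm_pos (scale_pos n) fun j => V j x
      have h1 : |τ (scale n) (b x)| ≤ MultiphaseBernoulli.regNorm (scale n) fun j => V j x :=
        (hτb _ _).trans ((hbV x).trans (sqrt_le_regNorm _ _))
      have h2 := abs_dirDeriv_le (scale_pos n) i j fun j => V j x
      have := mul_le_mul h1 h2 (abs_nonneg _) hq.le
      rwa [mul_div_cancel₀ _ hq.ne'] at this
  · refine Eventually.of_forall fun x => ?_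
    refine Tendsto.mul ?_ (tendsto_div_regNorm (fun i => V i x) i)
    have : Tendsto (fun n => b x / (1 + scale n ^ 2 * b x ^ 2)) atTop
        (𝓝 (b x / (1 + 0 ^ 2 * b x ^ 2))) :=
      tendsto_const_nhds.div (((tendsto_scale.pow 2).mul_const _).const_add 1) (by norm_num)
    simpa [τ, W] using this
  · refine Eventually.of_forall fun x => ?_
    have hfe : (fun n => ∑ o, dF (scale n) o (fun o => W o x) • GW o x) = fun n =>
        (τ' (scale n) (b x) * (V i x / MultiphaseBernoulli.regNorm (scale n) fun j => V j x)) • Gb x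
        + ∑ j, (τ (scale n) (b x) * dirDeriv (scale n) i j fun j => V j x) • G j x := by
      ext1 n
      rw [Fintype.sum_option]
      rfl
    rw [hfe]
    have t0 : Tendsto (fun n => τ (scale n) (b x)) atTop (𝓝 (b x)) := by
      have : Tendsto (fun n => b x / (1 + scale n ^ 2 * b x ^ 2)) atTop
          (𝓝 (b x / (1 + 0 ^ 2 * b x ^ 2))) :=
        tendsto_const_nhds.div (((tendsto_scale.pow 2).mul_const _).const_add 1) (by norm_num)
      simpa using this
    have t1 : Tendsto (fun n => τ' (scale n) (b x)) atTop (𝓝 1) := by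
      have : Tendsto (fun n => (1 - scale n ^ 2 * b x ^ 2) / (1 + scale n ^ 2 * b x ^ 2) ^ 2) atTop
          (𝓝 ((1 - 0 ^ 2 * b x ^ 2) / (1 + 0 ^ 2 * b x ^ 2) ^ 2)) :=
        (((tendsto_scale.pow 2).mul_const _).const_sub 1).div
          ((((tendsto_scale.pow 2).mul_const _).const_add 1).pow 2) (by norm_num)
      simpa using this
    refine Tendsto.add ?_ (tendsto_finsetSum _ fun j _ => ?_)
    · have := (t1.mul (tendsto_div_regNorm (fun i => V i x) i)).smul_const (Gb x)
      simpa using this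
    · refine Tendsto.smul_const ?_ _
      by_cases hx : √(∑ i, V i x ^ 2) = 0
      · have hb0 : b x = 0 := by
          have := hbV x
          rw [hx] at this
          exact abs_nonpos_iff.1 this
        simp [hb0, τ]
      · refine t0.mul ?_
        have e0 : MultiphaseBernoulli.regNorm 0 (fun i => V i x) = √(∑ i, V i x ^ 2) := by
          simp [MultiphaseBernoulli.regNorm]
        simp only [dirDeriv, e0]
        have tq := tendsto_regNorm fun i => V i x
        exact (tendsto_const_nhds.div tq hx).sub (tendsto_const_nhds.div (tq.pow 3) (pow_ne_zero 3 hx))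

end H1

end

/-! ### Compactly supported `H¹` functions and `H¹₀` -/

section H10

variable {D : Set (𝔼 d)}

lemma MemH10.add (hD : IsOpen D) {u v : 𝔼 d → ℝ} (hu : MemH10 D u) (hv : MemH10 D v) :
    MemH10 D (fun x => u x + v x) := by
  obtain ⟨⟨mu, Gu, hGu⟩, φ, hφ, hφ1, hφ2⟩ := hu
  obtain ⟨⟨mv, Gv, hGv⟩, ψ, hψ, hψ1, hψ2⟩ := hv
  have hs := hGu.add hGv mu mv
  refine ⟨⟨mu.add mv, _, hs⟩, fun m x => φ m x + ψ m x, fun m => ?_, ?_, ?_⟩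
  · refine ⟨(hφ m).1.add (hψ m).1, (hφ m).2.1.add (hψ m).2.1, ?_⟩
    exact (tsupport_add (φ m) (ψ m)).trans (union_subset (hφ m).2.2 (hψ m).2.2)
  · refine tendsto_of_tendsto_of_tendsto_of_le_of_le tendsto_const_nhds
      (by simpa using hφ1.add hψ1) (fun _ => zero_le) fun m => ?_
    have := eLpNorm_add_le (μ := volume.restrict D) (p := 2)
      (f := fun x => u x - φ m x) (g := fun x => v x - ψ m x)
      (mu.1.sub (hφ m).1.continuous.aestronglyMeasurable)
      (mv.1.sub (hψ m).1.continuous.aestronglyMeasurable) (by norm_num)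
    refine le_trans (le_of_eq (congrArg (fun f => eLpNorm f 2 (volume.restrict D)) ?_)) this
    ext x
    simp only [Pi.add_apply]
    ring
  · refine tendsto_of_tendsto_of_tendsto_of_le_of_le tendsto_const_nhds
      (by simpa using hφ2.add hψ2) (fun _ => zero_le) fun m => ?_
    have c1 : ∀ {f : 𝔼 d → ℝ}, ContDiff ℝ ∞ f → Continuous (gradient f) := fun hf =>
      (InnerProductSpace.toDual ℝ (𝔼 d)).symm.continuous.comp (hf.continuous_fderiv (by simp))
    have := eLpNorm_add_le (μ := volume.restrict D) (p := 2)
      (f := fun x => weakGrad D u x - gradient (φ m) x)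
      (g := fun x => weakGrad D v x - gradient (ψ m) x)
      ((isWeakGrad_weakGrad ⟨Gu, hGu⟩).1.1.sub (c1 (hφ m).1).aestronglyMeasurable)
      ((isWeakGrad_weakGrad ⟨Gv, hGv⟩).1.1.sub (c1 (hψ m).1).aestronglyMeasurable) (by norm_num)
    refine le_trans (le_of_eq (eLpNorm_congr_ae ?_)) this
    filter_upwards [hs.weakGrad_ae hD (mu.add mv), hGu.weakGrad_ae hD mu,
      hGv.weakGrad_ae hD mv] with x h1 h2 h3
    have e : gradient (fun x => φ m x + ψ m x) x = gradient (φ m) x + gradient (ψ m) x := by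
      refine ext_inner_right ℝ fun w => ?_
      rw [inner_add_left, inner_gradient_eq, inner_gradient_eq, inner_gradient_eq,
        fderiv_fun_add ((hφ m).1.differentiable (by simp) x)
          ((hψ m).1.differentiable (by simp) x)]
      simp
    replace h1 : weakGrad D (fun x => u x + v x) x = Gu x + Gv x := h1
    rw [h1, e, Pi.add_apply, h2, h3]
    abel

/-- `H¹` functions with compact support in `D` belong to `H¹₀(D)`. -/
lemma memH10_of_compact (hD : IsOpen D) {K : Set (𝔼 d)} (hK : IsCompact K) (hKD : K ⊆ D)
    {u : 𝔼 d → ℝ} {G : 𝔼 d → 𝔼 d} (mu : MemLp u 2 (volume.restrict D)) (h : IsWeakGrad D u G)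
    (huK : ∀ x ∉ K, u x = 0) : MemH10 D u := by
  have hu : MemLp u 2 := by
    rw [← indicator_eq_self.2 (show Function.support u ⊆ D from fun x hx => by
      by_contra hxD; exact hx (huK x fun hxK => hxD (hKD hxK)))]
    exact memLp_indicator_of_restrict hD.measurableSet mu
  have hext := h.extend hD hK hKD huK
  have hG : MemLp (K.indicator G) 2 := by simpa using hext.1
  obtain ⟨δ₀, hδ₀, hδD⟩ := hK.exists_cthickening_subset_open hD hKD
  let δ : ℕ → ℝ := fun m => δ₀ * scale m
  have hδ : ∀ m, 0 < δ m := fun m => mul_pos hδ₀ (scale_pos m)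
  have hδ' : ∀ m, δ m ≤ δ₀ := fun m => mul_le_of_le_one_right hδ₀.le (scale_le_one m)
  have hδt : Tendsto δ atTop (𝓝[>] 0) := by
    refine tendsto_nhdsWithin_iff.2 ⟨?_, Eventually.of_forall hδ⟩
    simpa using tendsto_scale.const_mul δ₀
  have hs : ∀ m, Function.support (mol (δ m) u) ⊆ cthickening δ₀ K := by
    intro m x hx
    by_contra hxK
    refine hx (mol_eq_zero (hδ m).le fun z hz => huK z fun hzK => hxK ?_)
    exact mem_cthickening_of_dist_le x z δ₀ K hzK
      ((dist_comm x z).le.trans ((mem_closedBall.1 hz).trans (hδ' m)))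
  have hc : IsCompact (cthickening δ₀ K) := hK.cthickening
  refine ⟨⟨mu, G, h⟩, fun m => mol (δ m) u, fun m => ⟨contDiff_mol hu (hδ m), ?_, ?_⟩, ?_, ?_⟩
  · exact HasCompactSupport.of_support_subset_isCompact hc (hs m)
  · exact (closure_minimal (hs m) hc.isClosed).trans hδD
  · have := (tendsto_mol hu).comp hδt
    refine tendsto_of_tendsto_of_tendsto_of_le_of_le tendsto_const_nhds this
      (fun _ => zero_le) fun m => ?_
    refine (eLpNorm_mono_measure _ Measure.restrict_le_self).trans (le_of_eq ?_)
    exact eLpNorm_sub_comm _ _ _ _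
  · have := (tendsto_mol hG).comp hδt
    refine tendsto_of_tendsto_of_tendsto_of_le_of_le tendsto_const_nhds this
      (fun _ => zero_le) fun m => ?_
    have e : (fun x => weakGrad D u x - gradient (mol (δ m) u) x) =ᵐ[volume.restrict D]
        fun x => K.indicator G x - mol (δ m) (K.indicator G) x := by
      filter_upwards [(hext.mono (subset_univ D)).weakGrad_ae hD mu] with x hx
      rw [hx, gradient_mol hext hu hG (hδ m) (subset_univ _)]
    rw [eLpNorm_congr_ae e]
    refine (eLpNorm_mono_measure _ Measure.restrict_le_self).trans (le_of_eq ?_)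
    exact eLpNorm_sub_comm _ _ _ _

end H10

/-! ### The canonical representative and the phase sets -/

section precise

variable {D : Set (𝔼 d)} {k n : ℕ} {p : Fin k → Fin n} {j : Fin n}

/-- Lebesgue's differentiation theorem: the canonical representative of `|V|` is `|V|` a.e. -/
lemma preciseModulus_ae (hD : IsOpen D) (hDv : volume D ≠ ⊤) {V : 𝔼 d → 𝔼 k}
    (hV : MemLp V 2 (volume.restrict D)) :
    ∀ᵐ x ∂(volume.restrict D), preciseModulus V x = ‖V x‖ₑ := by
  have : IsFiniteMeasure ((volume : Measure (𝔼 d)).restrict D) := isFiniteMeasure_restrict.2 hDv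
  have hf : AEMeasurable (D.indicator fun x => ‖V x‖ₑ) volume :=
    (aemeasurable_indicator_iff hD.measurableSet).2 hV.1.enorm
  have hfin : ∫⁻ x, D.indicator (fun x => ‖V x‖ₑ) x ≠ ⊤ := by
    rw [lintegral_indicator hD.measurableSet, ← eLpNorm_one_eq_lintegral_enorm]
    exact (hV.mono_exponent (p := 1) (by norm_num)).2.ne
  have hd := (Besicovitch.vitaliFamily (volume : Measure (𝔼 d))).ae_tendsto_lintegral_div hf hfin
  rw [ae_restrict_iff' hD.measurableSet]
  filter_upwards [hd] with x hx hxD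
  have h1 := hx.comp (Besicovitch.tendsto_filterAt volume x)
  rw [indicator_of_mem hxD] at h1
  refine Tendsto.limsup_eq (h1.congr' ?_)
  obtain ⟨r, hr, hrD⟩ := Metric.isOpen_iff.1 hD x hxD
  filter_upwards [Ioo_mem_nhdsGT hr] with s hs
  simp only [Function.comp]
  rw [setLAverage_eq]
  have e0 : closedBall x s =ᵐ[volume] ball x s := by
    rw [ae_eq_set, closedBall_sdiff_ball, Measure.addHaar_sphere_of_ne_zero _ _ hs.1.ne',
      sdiff_eq_empty.2 ball_subset_closedBall]
    simp
  have e1 : volume (closedBall x s) = volume (ball x s) := measure_congr e0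
  have e2 : ∫⁻ y in closedBall x s, D.indicator (fun x => ‖V x‖ₑ) y = ∫⁻ y in ball x s, ‖V y‖ₑ := by
    have : (volume : Measure (𝔼 d)).restrict (closedBall x s) = volume.restrict (ball x s) :=
      Measure.restrict_congr_set e0
    rw [this]
    refine setLIntegral_congr_fun measurableSet_ball fun y hy => ?_
    exact indicator_of_mem (hrD (ball_subset_ball hs.2.le hy)) _
  rw [e1, e2]

lemma memLp_phase {W : 𝔼 d → 𝔼 k} (hW : ∀ i, MemH1 D fun x => W x i) :
    MemLp (phase p j W) 2 (volume.restrict D) := by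
  refine memLp_piLp_iff.2 fun i => ?_
  by_cases hi : p i = j
  · simpa [phase, hi] using (hW i).1
  · simp [phase, hi]

/-- By Lebesgue differentiation the canonical representative may be replaced by the function itself in
the definition of `phaseSet`, up to null sets. -/
lemma phaseSet_ae (hD : IsOpen D) (hDv : volume D ≠ ⊤) {W : 𝔼 d → 𝔼 k}
    (hW : ∀ i, MemH1 D fun x => W x i) :
    phaseSet p j D W =ᵐ[volume] {x | x ∈ D ∧ phase p j W x ≠ 0} := by
  have := preciseModulus_ae hD hDv (memLp_phase (p := p) (j := j) hW)
  rw [ae_restrict_iff' hD.measurableSet] at this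
  refine eventuallyEq_set.2 ?_
  filter_upwards [this] with x hx
  simp only [phaseSet, mem_ofPred_eq, and_congr_right_iff]
  intro hxD
  rw [hx hxD]
  simp

end precise

/-! ### Variations that rescale one phase -/

section variation

variable {D : Set (𝔼 d)} {k n : ℕ} {p : Fin k → Fin n} {j : Fin n} {Λ : Fin n → ℝ}
  {g U : 𝔼 d → 𝔼 k}

lemma lintegral_enorm_sq_lt_top {G : 𝔼 d → 𝔼 d} (hG : MemLp G 2 (volume.restrict D)) :
    ∫⁻ x in D, ‖G x‖ₑ ^ 2 < ⊤ := by
  rw [← eLpNorm_two_sq]; exact ENNReal.pow_lt_top hG.2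

lemma phase_apply (W : 𝔼 d → 𝔼 k) (x : 𝔼 d) (i : Fin k) :
    phase p j W x i = if p i = j then W x i else 0 := rfl

/-- Competitors `W_j = c U_j` with `c = 1` off a compact subset of `D`. -/
lemma IsMinimizer.rescale (hU : IsMinimizer p Λ D g U) (hg : MemH1Sigma p D g) (hD : IsOpen D)
    (hDb : Bornology.IsBounded D)
    {G H : Fin k → 𝔼 d → 𝔼 d} (hG : ∀ i, IsWeakGrad D (fun x => phase p j U x i) (G i))
    {c : 𝔼 d → ℝ} {K : Set (𝔼 d)} (hK : IsCompact K) (hKD : K ⊆ D) (hcK : ∀ x ∉ K, c x = 1)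
    (mH : ∀ i, MemLp (fun x => (c x - 1) * phase p j U x i) 2 (volume.restrict D))
    (hH : ∀ i, IsWeakGrad D (fun x => (c x - 1) * phase p j U x i) (H i)) :
    (∑ i, ∫⁻ x in D, ‖G i x‖ₑ ^ 2) + ENNReal.ofReal (Λ j) * volume (phaseSet p j D U) ≤
      (∑ i, ∫⁻ x in D, ‖G i x + H i x‖ₑ ^ 2) +
        ENNReal.ofReal (Λ j) * volume {x | x ∈ D ∧ c x ≠ 0 ∧ phase p j U x ≠ 0} := by
  have hDv : volume D ≠ ⊤ := hDb.measure_lt_top.ne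
  obtain ⟨⟨⟨hU1, hU2⟩, ⟨hUg1, hUg2⟩, hUg3⟩, hmin⟩ := hU
  let W : 𝔼 d → 𝔼 k := fun x => WithLp.toLp 2 fun i => if p i = j then c x * U x i else U x i
  have hW : ∀ i x, W x i = U x i + (c x - 1) * phase p j U x i := by
    intro i x
    simp only [W, phase_apply]
    split_ifs <;> ring
  have hWi : ∀ i, (fun x => W x i) = fun x => U x i + (c x - 1) * phase p j U x i :=
    fun i => funext (hW i)
  have gW : ∀ i, IsWeakGrad D (fun x => W x i) (fun x => weakGrad D (fun y => U y i) x + H i x) := by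
    intro i
    rw [hWi]
    exact (isWeakGrad_weakGrad (hU1 i).2).add (hH i) (hU1 i).1 (mH i)
  have mW : ∀ i, MemH1 D fun x => W x i := fun i =>
    ⟨by rw [hWi]; exact (hU1 i).1.add (mH i), _, gW i⟩
  have hcomp : IsCompetitor p D g W := by
    refine ⟨⟨mW, fun i i' hii => ?_⟩, ⟨fun i => ?_, fun i i' hii => ?_⟩, fun i => ?_⟩
    · filter_upwards [hU2 i i' hii] with x hx
      rcases mul_eq_zero.1 hx with h | h <;> simp [hW, phase_apply, h]
    · have : (fun x => (W x - g x) i) = fun x => (U x - g x) i + (c x - 1) * phase p j U x i := by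
        ext x; simp [hW]; ring
      rw [this]
      obtain ⟨m, G', hG'⟩ := hUg1 i
      exact ⟨m.add (mH i), _, hG'.add (hH i) m (mH i)⟩
    · filter_upwards [hU2 i i' hii, hUg2 i i' hii, hg.2 i i' hii] with x h1 h2 h3
      simp only [PiLp.sub_apply, W] at h2 ⊢
      -- where a phase of `U` is nonzero, `g` has no component in any other phase
      by_cases hi : p i = j
      · have hi' : p i' ≠ j := fun h => hii (hi.trans h.symm)
        simp only [hi, hi', if_true, if_false]
        rcases eq_or_ne (U x i) 0 with h | h
        · rw [h, mul_zero]; rwa [h] at h2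
        · have h0 : U x i' = 0 := (mul_eq_zero.1 h1).resolve_left h
          rcases eq_or_ne (g x i') 0 with hg' | hg'
          · simp [h0, hg']
          · have h0g : g x i = 0 := (mul_eq_zero.1 h3).resolve_right hg'
            simp [h0, h0g, h, hg'] at h2
      · simp only [hi, if_false]
        by_cases hi' : p i' = j
        · simp only [hi', if_true]
          rcases eq_or_ne (U x i') 0 with h | h
          · rw [h, mul_zero]; rwa [h] at h2
          · have h0 : U x i = 0 := (mul_eq_zero.1 h1).resolve_right h
            rcases eq_or_ne (g x i) 0 with hg' | hg'
            · simp [h0, hg']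
            · have h0g : g x i' = 0 := (mul_eq_zero.1 h3).resolve_left hg'
              simp [h0, h0g, h, hg'] at h2
        · simpa only [hi', if_false] using h2
    · have : (fun x => (W x - g x) i) = fun x => (U x - g x) i + (c x - 1) * phase p j U x i := by
        ext x; simp [hW]; ring
      rw [this]
      exact (hUg3 i).add hD (memH10_of_compact hD hK hKD (mH i) (hH i) fun x hx => by
        rw [hcK x hx]; simp)
  have hJ := hmin W hcomp
  -- the energy of the other phases cancels
  have eG : ∀ i, ∫⁻ x in D, ‖G i x‖ₑ ^ 2 =
      if p i = j then ∫⁻ x in D, ‖weakGrad D (fun y => U y i) x‖ₑ ^ 2 else 0 := by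
    intro i
    have hGi := hG i
    split_ifs with hi
    · simp only [phase_apply, hi, if_true] at hGi
      refine lintegral_congr_ae ?_
      filter_upwards [hGi.weakGrad_ae hD (hU1 i).1] with x hx
      rw [hx]
    · simp only [phase_apply, hi, if_false] at hGi
      rw [lintegral_eq_zero_iff' ((hGi.1.1.enorm).pow_const 2)]
      filter_upwards [hGi.ae_eq_zero hD (by simp)] with x hx
      simp [hx]
  have eH : ∀ i, ∫⁻ x in D, ‖G i x + H i x‖ₑ ^ 2 =
      if p i = j then ∫⁻ x in D, ‖weakGrad D (fun y => W y i) x‖ₑ ^ 2 else 0 := by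
    intro i
    have hGi := hG i
    have hHi := hH i
    split_ifs with hi
    · simp only [phase_apply, hi, if_true] at hGi
      refine lintegral_congr_ae ?_
      filter_upwards [hGi.weakGrad_ae hD (hU1 i).1, (gW i).weakGrad_ae hD (mW i).1] with x hx hx'
      rw [hx', hx]
    · simp only [phase_apply, hi, if_false, mul_zero] at hGi hHi
      rw [← lintegral_zero (μ := volume.restrict D)]
      refine lintegral_congr_ae ?_
      filter_upwards [hGi.ae_eq_zero hD (by simp), hHi.ae_eq_zero hD (by simp)] with x hx hx'
      simp [hx, hx']
  have eJ : ∀ (f : Fin k → ℝ≥0∞), ∑ i, f i =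
      (∑ i, if p i = j then f i else 0) + ∑ i, if p i = j then 0 else f i := by
    intro f
    rw [← Finset.sum_add_distrib]
    exact Finset.sum_congr rfl fun i _ => by split_ifs <;> simp
  have hWother : ∀ i, p i ≠ j → (fun x => W x i) = fun x => U x i := fun i hi => by
    ext x; simp [W, hi]
  have hphase : ∀ j', j' ≠ j → phaseSet p j' D W = phaseSet p j' D U := by
    intro j' hj'
    have : phase p j' W = phase p j' U := by
      ext x i
      simp only [phase_apply, W]
      by_cases hi : p i = j'
      · simp [hi, hj']
      · simp [hi]
    simp [phaseSet, this]
  have hvW : volume (phaseSet p j D W) = volume {x | x ∈ D ∧ c x ≠ 0 ∧ phase p j U x ≠ 0} := by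
    rw [measure_congr (phaseSet_ae hD hDv mW)]
    congr 1
    ext x
    have : phase p j W x = c x • phase p j U x := by
      ext i
      simp only [phase_apply, W, PiLp.smul_apply, smul_eq_mul]
      split_ifs <;> simp
    simp only [mem_ofPred_eq, this, smul_ne_zero_iff]
  have key : ∀ f : Fin n → ℝ≥0∞, ∑ j', f j' = f j + ∑ j' ∈ Finset.univ.erase j, f j' := fun f =>
    (Finset.add_sum_erase _ _ (Finset.mem_univ j)).symm
  unfold J at hJ
  rw [eJ, key, eJ (fun i => ∫⁻ x in D, ‖weakGrad D (fun y => W y i) x‖ₑ ^ 2),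
    key fun j' => ENNReal.ofReal (Λ j') * volume (phaseSet p j' D W)] at hJ
  have c1 : (∑ i, if p i = j then 0 else ∫⁻ x in D, ‖weakGrad D (fun y => W y i) x‖ₑ ^ 2)
      = ∑ i, if p i = j then 0 else ∫⁻ x in D, ‖weakGrad D (fun y => U y i) x‖ₑ ^ 2 := by
    refine Finset.sum_congr rfl fun i _ => ?_
    split_ifs with hi
    · rfl
    · rw [hWother i hi]
  have c2 : (∑ j' ∈ Finset.univ.erase j, ENNReal.ofReal (Λ j') * volume (phaseSet p j' D W))
      = ∑ j' ∈ Finset.univ.erase j, ENNReal.ofReal (Λ j') * volume (phaseSet p j' D U) := by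
    refine Finset.sum_congr rfl fun j' hj' => ?_
    rw [hphase j' (Finset.ne_of_mem_erase hj')]
  rw [c1, c2] at hJ
  simp only [eG, eH]
  rw [← hvW]
  set R1 := ∑ i, if p i = j then 0 else ∫⁻ x in D, ‖weakGrad D (fun y => U y i) x‖ₑ ^ 2
  set R2 := ∑ j' ∈ Finset.univ.erase j, ENNReal.ofReal (Λ j') * volume (phaseSet p j' D U)
  have f1 : R1 ≠ ⊤ := by
    refine (ENNReal.sum_lt_top.2 fun i _ => ?_).ne
    split_ifs
    · simp
    · exact lintegral_enorm_sq_lt_top (isWeakGrad_weakGrad (hU1 i).2).1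
  have f2 : R2 ≠ ⊤ := by
    refine (ENNReal.sum_lt_top.2 fun j' _ => ?_).ne
    refine ENNReal.mul_lt_top ENNReal.ofReal_lt_top ((measure_mono ?_).trans_lt hDv.lt_top)
    exact fun x hx => hx.1
  refine (ENNReal.add_le_add_iff_right (ENNReal.add_ne_top.2 ⟨f1, f2⟩)).1 ?_
  calc _ = _ := by ring
    _ ≤ _ := hJ
    _ = _ := by ring

end variation

/-! ### The first variation -/

section firstvariation

variable {D : Set (𝔼 d)} {k n : ℕ} {p : Fin k → Fin n} {j : Fin n} {Λ : Fin n → ℝ}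
  {g U : 𝔼 d → 𝔼 k}

/-- `G` is the gradient of a function that is weakly subharmonic in `D`. -/
def WeaklySubharmonic (D : Set (𝔼 d)) (G : 𝔼 d → 𝔼 d) : Prop :=
  ∀ ψ, IsTest D ψ → (∀ x, 0 ≤ ψ x) → ∫ x in D, inner ℝ (G x) (gradient ψ x) ≤ 0

lemma lintegral_enorm_sq_eq {α H : Type*} [MeasurableSpace α] {μ : Measure α}
    [NormedAddCommGroup H] {G : α → H} (hG : MemLp G 2 μ) :
    ∫⁻ x, ‖G x‖ₑ ^ 2 ∂μ = ENNReal.ofReal (∫ x, ‖G x‖ ^ 2 ∂μ) := by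
  rw [ofReal_integral_eq_lintegral_ofReal (hG.integrable_norm_pow (by norm_num))
    (Eventually.of_forall fun x => by positivity)]
  congr 1
  ext x
  rw [ENNReal.ofReal_pow (norm_nonneg _), ofReal_norm]

lemma continuous_gradient {ψ : 𝔼 d → ℝ} (hψ : ContDiff ℝ 1 ψ) : Continuous (gradient ψ) :=
  (InnerProductSpace.toDual ℝ (𝔼 d)).symm.continuous.comp (hψ.continuous_fderiv (by simp))

lemma IsTest.compact_gradient {ψ : 𝔼 d → ℝ} (hψ : IsTest D ψ) : HasCompactSupport (gradient ψ) :=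
  (hψ.compact.fderiv (𝕜 := ℝ)).comp_left (g := (InnerProductSpace.toDual ℝ (𝔼 d)).symm) (by simp)

/-- The first variation along `U_j ↦ (1 + tψ/√(ε²+|U_j|²)) U_j` vanishes, since both signs of `t`
are admissible. -/
lemma IsMinimizer.firstVariation (hU : IsMinimizer p Λ D g U) (hg : MemH1Sigma p D g)
    (hD : IsOpen D) (hDb : Bornology.IsBounded D)
    {G : Fin k → 𝔼 d → 𝔼 d} (hG : ∀ i, IsWeakGrad D (fun x => phase p j U x i) (G i))
    {ψ : 𝔼 d → ℝ} (hψ : IsTest D ψ) {ε : ℝ} (hε : 0 < ε) :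
    ∑ i, ∫ x in D, inner ℝ (G i x)
      (ψ x • ∑ l, dirDeriv ε i l (fun i => phase p j U x i) • G l x +
        (phase p j U x i / regNorm ε fun i => phase p j U x i) • gradient ψ x) = 0 := by
  have hDv : volume D ≠ ⊤ := hDb.measure_lt_top.ne
  have mph : MemLp (phase p j U) 2 (volume.restrict D) := memLp_phase hU.1.1.1
  have mV : ∀ i, MemLp (fun x => phase p j U x i) 2 (volume.restrict D) := memLp_piLp_iff.1 mph
  have hdir := fun i => IsWeakGrad.dir hD hDv mV hG hε i
  have hmul := fun i => (hdir i).2.smooth_mul hψ.contDiff hψ.compact (hdir i).1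
  set Z : Fin k → 𝔼 d → 𝔼 d := fun i x =>
    ψ x • ∑ l, dirDeriv ε i l (fun i => phase p j U x i) • G l x +
        (phase p j U x i / regNorm ε fun i => phase p j U x i) • gradient ψ x with hZ
  have mZ : ∀ i, MemLp (Z i) 2 (volume.restrict D) := fun i => (hmul i).2.1
  have mG : ∀ i, MemLp (G i) 2 (volume.restrict D) := fun i => (hG i).1
  have key : ∀ t : ℝ, 0 ≤ (∑ i, ∫ x in D, ‖Z i x‖ ^ 2) * (t * t) +
      (2 * ∑ i, ∫ x in D, inner ℝ (G i x) (Z i x)) * t + 0 := by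
    intro t
    let c : 𝔼 d → ℝ := fun x => 1 + t * (ψ x / regNorm ε fun i => phase p j U x i)
    have ec : ∀ i, (fun x => (c x - 1) * phase p j U x i)
        = fun x => t * (ψ x * (phase p j U x i / regNorm ε fun i => phase p j U x i)) := by
      intro i; ext x; simp only [c]; ring
    have h1 := hU.rescale hg hD hDb hG (c := c) (H := fun i x => t • Z i x) hψ.compact hψ.subset
      (fun x hx => by simp [c, image_eq_zero_of_notMem_tsupport hx])
      (fun i => by rw [ec]; exact (hmul i).1.const_mul t)
      (fun i => by rw [ec]; exact (hmul i).2.const_mul t)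
    have h2 : volume {x | x ∈ D ∧ c x ≠ 0 ∧ phase p j U x ≠ 0} ≤ volume (phaseSet p j D U) := by
      rw [measure_congr (phaseSet_ae hD hDv hU.1.1.1)]
      exact measure_mono fun x hx => ⟨hx.1, hx.2.2⟩
    have h3 : ENNReal.ofReal (Λ j) * volume (phaseSet p j D U) ≠ ⊤ := by
      refine ENNReal.mul_ne_top ENNReal.ofReal_ne_top ((measure_mono ?_).trans_lt hDv.lt_top).ne
      exact fun x hx => hx.1
    have h4 : (∑ i, ∫⁻ x in D, ‖G i x‖ₑ ^ 2) ≤ ∑ i, ∫⁻ x in D, ‖G i x + t • Z i x‖ₑ ^ 2 := by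
      refine (ENNReal.add_le_add_iff_right h3).1 (h1.trans ?_)
      gcongr
    have e5 : ∀ i, ∫⁻ x in D, ‖G i x + t • Z i x‖ₑ ^ 2
        = ENNReal.ofReal (∫ x in D, ‖G i x + t • Z i x‖ ^ 2) := fun i =>
      lintegral_enorm_sq_eq ((mG i).add ((mZ i).const_smul t))
    simp only [e5, fun i => lintegral_enorm_sq_eq (mG i)] at h4
    rw [← ENNReal.ofReal_sum_of_nonneg (fun i _ => by positivity),
      ← ENNReal.ofReal_sum_of_nonneg (fun i _ => by positivity),
      ENNReal.ofReal_le_ofReal_iff (Finset.sum_nonneg fun i _ => by positivity)] at h4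
    have e6 : ∀ i, ∫ x in D, ‖G i x + t • Z i x‖ ^ 2 = (∫ x in D, ‖G i x‖ ^ 2) +
        (2 * t * (∫ x in D, inner ℝ (G i x) (Z i x)) + t ^ 2 * ∫ x in D, ‖Z i x‖ ^ 2) := by
      intro i
      rw [← integral_const_mul, ← integral_const_mul, ← integral_add, ← integral_add]
      · congr 1
        ext x
        rw [norm_add_sq_real, real_inner_smul_right, norm_smul, mul_pow, Real.norm_eq_abs, sq_abs]
        ring
      · exact (mG i).integrable_norm_pow (by norm_num)
      · exact ((integrable_inner_of_memLp (mG i) (mZ i)).const_mul _).add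
          (((mZ i).integrable_norm_pow (by norm_num)).const_mul _)
      · exact (integrable_inner_of_memLp (mG i) (mZ i)).const_mul _
      · exact ((mZ i).integrable_norm_pow (by norm_num)).const_mul _
    simp only [e6, Finset.sum_add_distrib, ← Finset.mul_sum] at h4
    nlinarith
  have := discrim_le_zero key
  rw [discrim] at this
  have h0 : (2 * ∑ i, ∫ x in D, inner ℝ (G i x) (Z i x)) ^ 2 ≤ 0 := by linarith
  have := pow_eq_zero_iff (two_ne_zero) |>.1 (le_antisymm h0 (sq_nonneg _))
  linarith

/-- Cauchy–Schwarz in the form `∑ᵢⱼ (δᵢⱼ/q - VᵢVⱼ/q³) ⟨Gᵢ, Gⱼ⟩ ≥ 0` for `q² = ε² + |V|²`. -/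
lemma sum_inner_dirDeriv_nonneg {ι : Type*} [Fintype ι] [DecidableEq ι] {ε : ℝ} (hε : 0 < ε)
    (y : ι → ℝ) (v : ι → 𝔼 d) : 0 ≤ ∑ i, inner ℝ (v i) (∑ l, dirDeriv ε i l y • v l) := by
  have hq := regNorm_pos hε y
  have e1 : ∑ i, inner ℝ (v i) (∑ l, dirDeriv ε i l y • v l)
      = (∑ i, ‖v i‖ ^ 2) / regNorm ε y - ‖∑ i, y i • v i‖ ^ 2 / regNorm ε y ^ 3 := by
    have e2 : ∀ i, inner ℝ (v i) (∑ l, dirDeriv ε i l y • v l)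
        = ‖v i‖ ^ 2 / regNorm ε y - inner ℝ (y i • v i) (∑ l, y l • v l) / regNorm ε y ^ 3 := by
      intro i
      simp only [inner_sum, real_inner_smul_right, real_inner_smul_left, dirDeriv, sub_mul,
        Finset.sum_sub_distrib, Finset.sum_div]
      congr 1
      · rw [Finset.sum_eq_single i]
        · rw [if_pos rfl, real_inner_self_eq_norm_sq]; ring
        · intro l _ hl; simp [hl.symm]
        · simp
      · exact Finset.sum_congr rfl fun l _ => by ring
    simp only [e2, Finset.sum_sub_distrib, ← Finset.sum_div, ← sum_inner,
      real_inner_self_eq_norm_sq]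
  have h1 : ‖∑ i, y i • v i‖ ^ 2 ≤ (∑ i, y i ^ 2) * ∑ i, ‖v i‖ ^ 2 := by
    have : ‖∑ i, y i • v i‖ ≤ ∑ i, |y i| * ‖v i‖ :=
      (norm_sum_le _ _).trans (Finset.sum_le_sum fun i _ => by rw [norm_smul, Real.norm_eq_abs])
    calc ‖∑ i, y i • v i‖ ^ 2 ≤ (∑ i, |y i| * ‖v i‖) ^ 2 := by gcongr
      _ ≤ (∑ i, |y i| ^ 2) * ∑ i, ‖v i‖ ^ 2 := Finset.sum_mul_sq_le_sq_mul_sq _ _ _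
      _ = _ := by simp only [sq_abs]
  have h2 : ∑ i, y i ^ 2 ≤ regNorm ε y ^ 2 := by rw [regNorm_sq]; nlinarith
  have h3 : 0 ≤ ∑ i, ‖v i‖ ^ 2 := by positivity
  rw [e1, sub_nonneg, div_le_div_iff₀ (pow_pos hq 3) hq]
  have h4 := mul_le_mul_of_nonneg_right h2 h3
  have h5 := mul_le_mul_of_nonneg_right (h1.trans h4) hq.le
  nlinarith

/-- The modulus of a phase of a minimizer is weakly subharmonic. -/
lemma IsMinimizer.weaklySubharmonic (hU : IsMinimizer p Λ D g U) (hg : MemH1Sigma p D g)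
    (hD : IsOpen D) (hDb : Bornology.IsBounded D)
    {G : Fin k → 𝔼 d → 𝔼 d} (hG : ∀ i, IsWeakGrad D (fun x => phase p j U x i) (G i)) :
    WeaklySubharmonic D fun x =>
      ∑ i, (phase p j U x i / √(∑ i, phase p j U x i ^ 2)) • G i x := by
  intro ψ hψ hψ0
  have mV : ∀ i, MemLp (fun x => phase p j U x i) 2 (volume.restrict D) :=
    memLp_piLp_iff.1 (memLp_phase hU.1.1.1)
  have hDv : volume D ≠ ⊤ := hDb.measure_lt_top.ne
  have mgψ : MemLp (gradient ψ) 2 (volume.restrict D) :=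
    (continuous_gradient (hψ.contDiff.of_le (by simp))).memLp_of_hasCompactSupport hψ.compact_gradient
  have hn := fun m => IsWeakGrad.regNorm hD hDv mV hG (scale_pos m)
  have le0 : ∀ m, ∫ x in D, inner ℝ (∑ i, (phase p j U x i /
      regNorm (scale m) fun i => phase p j U x i) • G i x) (gradient ψ x) ≤ 0 := by
    intro m
    have hε := scale_pos m
    have h1 := hU.firstVariation hg hD hDb hG hψ hε
    have hdir := fun i => IsWeakGrad.dir hD hDv mV hG hε i
    have hmul := fun i => (hdir i).2.smooth_mul hψ.contDiff hψ.compact (hdir i).1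
    rw [← integral_finsetSum _ fun i _ => integrable_inner_of_memLp (hG i).1 (hmul i).2.1] at h1
    rw [← h1]
    refine integral_mono (integrable_inner_of_memLp (hn m).2.1 mgψ)
      (integrable_finsetSum _ fun i _ => integrable_inner_of_memLp (hG i).1 (hmul i).2.1)
      fun x => ?_
    simp only [inner_add_right, Finset.sum_add_distrib, real_inner_smul_right, ← Finset.mul_sum]
    rw [sum_inner]
    have h2 := mul_nonneg (hψ0 x) (sum_inner_dirDeriv_nonneg hε (fun i => phase p j U x i)
      fun i => G i x)
    simp only [real_inner_smul_left]
    linarith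
  obtain ⟨l1, l2⟩ := tendsto_eLpNorm_of_dominated (μ := volume.restrict D)
    (fn := fun m x => ∑ i, (phase p j U x i /
      regNorm (scale m) fun i => phase p j U x i) • G i x)
    (f := fun x => ∑ i, (phase p j U x i / √(∑ i, phase p j U x i ^ 2)) • G i x)
    (g := fun x => ∑ i, ‖G i x‖) (memLp_finsetSum _ fun i _ => (hG i).1.norm)
    (fun m => (hn m).2.1.1)
    (fun m => Eventually.of_forall fun x => by
      refine (norm_sum_le _ _).trans (Finset.sum_le_sum fun i _ => ?_)
      rw [norm_smul, Real.norm_eq_abs, abs_div, abs_of_pos (regNorm_pos (scale_pos m) _)]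
      refine mul_le_of_le_one_left (norm_nonneg _) ?_
      rw [div_le_one (regNorm_pos (scale_pos m) _)]
      exact abs_le_regNorm _ (fun i => phase p j U x i) i)
    (Eventually.of_forall fun x => tendsto_finsetSum _ fun i _ =>
      (tendsto_div_regNorm (fun i => phase p j U x i) i).smul_const _)
  refine le_of_tendsto (tendsto_integral_inner l1 mgψ (fun m => (hn m).2.1) (fun _ => mgψ) l2
    (by simp)) (Eventually.of_forall le0)

end firstvariation

/-! ### Polar coordinates and spherical means of smooth functions -/

section polar

/-- The surface measure of the unit sphere. -/
noncomputable abbrev surface (d : ℕ) : Measure (sphere (0 : 𝔼 d) 1) :=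
  (volume : Measure (𝔼 d)).toSphere

/-- The unnormalized spherical mean `∫_{|s| = 1} f (x + t s) ds`. -/
noncomputable def sphInt (f : 𝔼 d → ℝ) (x : 𝔼 d) (t : ℝ) : ℝ :=
  ∫ s : sphere (0 : 𝔼 d) 1, f (x + t • (s : 𝔼 d)) ∂surface d

/-- Integration in polar coordinates. -/
lemma integral_polar [NeZero d] {f : 𝔼 d → ℝ} (hf : Integrable f) :
    ∫ y, f y = ∫ t in Ioi (0 : ℝ), t ^ (d - 1) *
      ∫ s : sphere (0 : 𝔼 d) 1, f (t • (s : 𝔼 d)) ∂surface d := by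
  have hdim : Module.finrank ℝ (𝔼 d) = d := by simp
  have hmp := (volume : Measure (𝔼 d)).measurePreserving_homeomorphUnitSphereProd
  rw [hdim] at hmp
  have hme := (Homeomorph.measurableEmbedding (homeomorphUnitSphereProd (𝔼 d)))
  set F : sphere (0 : 𝔼 d) 1 × Ioi (0 : ℝ) → ℝ := fun q => f (q.2.1 • (q.1 : 𝔼 d)) with hF
  have hcomp : ∀ y : ({(0)}ᶜ : Set (𝔼 d)), F (homeomorphUnitSphereProd (𝔼 d) y) = f y := by
    intro y
    have : ‖(y : 𝔼 d)‖ ≠ 0 := norm_ne_zero_iff.2 y.2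
    simp [hF, smul_smul, this]
  have hcomp' : F ∘ (homeomorphUnitSphereProd (𝔼 d)) = f ∘ Subtype.val := funext hcomp
  have hFi : Integrable F ((surface d).prod (Measure.volumeIoiPow (d - 1))) := by
    rw [← hmp.integrable_comp_emb hme, hcomp', ← (MeasurableEmbedding.subtype_coe
      (measurableSet_singleton (0 : 𝔼 d)).compl).integrableOn_range_iff_comap]
    exact hf.integrableOn
  calc ∫ y, f y = ∫ y : ({(0)}ᶜ : Set (𝔼 d)), f y ∂(Measure.comap Subtype.val volume) := by
        rw [integral_subtype_comap (measurableSet_singleton _).compl fun x => f x,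
          restrict_compl_singleton]
    _ = ∫ q, F q ∂((surface d).prod (Measure.volumeIoiPow (d - 1))) := by
        rw [← hmp.integral_comp hme]
        exact integral_congr_ae (Eventually.of_forall fun y => (hcomp y).symm)
    _ = ∫ t, (∫ s, F (s, t) ∂surface d) ∂(Measure.volumeIoiPow (d - 1)) :=
        integral_prod_symm _ hFi
    _ = _ := by
        simp only [Measure.volumeIoiPow, ENNReal.ofReal]
        rw [integral_withDensity_eq_integral_smul, integral_subtype_comap measurableSet_Ioi
          fun a => Real.toNNReal (a ^ (d - 1)) •
            ∫ s : sphere (0 : 𝔼 d) 1, f (a • (s : 𝔼 d)) ∂surface d]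
        · refine setIntegral_congr_fun measurableSet_Ioi fun t ht => ?_
          simp only [NNReal.smul_def, Real.coe_toNNReal _ (pow_nonneg (le_of_lt ht) _), smul_eq_mul]
        · exact (measurable_subtype_coe.pow_const _).real_toNNReal

lemma continuous_sphInt {f : 𝔼 d → ℝ} (hf : Continuous f) (x : 𝔼 d) : Continuous (sphInt f x) := by
  have h := continuous_parametric_integral_of_continuous (μ := surface d) (s := univ)
    (f := fun (t : ℝ) (s : sphere (0 : 𝔼 d) 1) => f (x + t • (s : 𝔼 d))) (by fun_prop) isCompact_univ
  rw [Measure.restrict_univ] at h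
  exact h

lemma integrable_sphere {f : 𝔼 d → ℝ} (hf : Continuous f) (x : 𝔼 d) (t : ℝ) :
    Integrable (fun s : sphere (0 : 𝔼 d) 1 => f (x + t • (s : 𝔼 d))) (surface d) :=
  Continuous.integrable_of_hasCompactSupport (by fun_prop) (HasCompactSupport.of_compactSpace _)

lemma integral_ball_eq [NeZero d] {f : 𝔼 d → ℝ} (hf : Continuous f) (x : 𝔼 d) {R : ℝ}
    (hR : 0 ≤ R) :
    ∫ y in ball x R, f y = ∫ t in (0 : ℝ)..R, t ^ (d - 1) * sphInt f x t := by
  have hi : IntegrableOn f (ball x R) :=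
    (hf.continuousOn.integrableOn_compact (isCompact_closedBall x R)).mono_set ball_subset_closedBall
  rw [← integral_indicator measurableSet_ball, ← integral_add_left_eq_self _ x, integral_polar]
  · rw [intervalIntegral.integral_of_le hR, integral_Ioc_eq_integral_Ioo,
      ← integral_indicator measurableSet_Ioi, ← integral_indicator measurableSet_Ioo]
    congr 1
    ext t
    by_cases ht : 0 < t
    · have key : ∀ s : sphere (0 : 𝔼 d) 1, (x + t • (s : 𝔼 d)) ∈ ball x R ↔ t < R := fun s => by
        simp [norm_smul, abs_of_pos ht]
      by_cases htR : t < R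
      · have : ∀ s : sphere (0 : 𝔼 d) 1, (x + t • (s : 𝔼 d)) ∈ ball x R := fun s => (key s).2 htR
        simp only [indicator_of_mem (mem_Ioi.2 ht), indicator_of_mem (mem_Ioo.2 ⟨ht, htR⟩),
          indicator_of_mem (this _), sphInt]
      · have : ∀ s : sphere (0 : 𝔼 d) 1, (x + t • (s : 𝔼 d)) ∉ ball x R :=
          fun s h => htR ((key s).1 h)
        simp only [indicator_of_mem (mem_Ioi.2 ht), indicator_of_notMem (fun h => htR (mem_Ioo.1 h).2),
          indicator_of_notMem (this _), integral_zero, mul_zero]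
    · rw [indicator_of_notMem (by simpa using ht), indicator_of_notMem fun h => ht h.1]
  · exact ((integrable_indicator_iff measurableSet_ball).2 hi).comp_add_left x

lemma integral_annulus_eq [NeZero d] {f : 𝔼 d → ℝ} (hf : Continuous f) (x : 𝔼 d) {r R : ℝ}
    (hr : 0 ≤ r) (hrR : r ≤ R) :
    ∫ y in ball x R \ ball x r, f y = ∫ t in r..R, t ^ (d - 1) * sphInt f x t := by
  have hi : IntegrableOn f (ball x R) :=
    (hf.continuousOn.integrableOn_compact (isCompact_closedBall x R)).mono_set ball_subset_closedBall
  have hc : Continuous fun t : ℝ => t ^ (d - 1) * sphInt f x t :=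
    (continuous_pow _).mul (continuous_sphInt hf x)
  rw [setIntegral_sdiff measurableSet_ball hi (ball_subset_ball hrR), integral_ball_eq hf x hr,
    integral_ball_eq hf x (hr.trans hrR), sub_eq_iff_eq_add, add_comm,
    intervalIntegral.integral_add_adjacent_intervals (hc.intervalIntegrable _ _)
      (hc.intervalIntegrable _ _)]

/-- The derivative of a spherical mean is the spherical mean of the normal derivative. -/
noncomputable def sphNormal (v : 𝔼 d → ℝ) (x : 𝔼 d) (t : ℝ) : ℝ :=
  ∫ s : sphere (0 : 𝔼 d) 1, inner ℝ (gradient v (x + t • (s : 𝔼 d))) (s : 𝔼 d) ∂surface d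

lemma continuous_sphNormal {v : 𝔼 d → ℝ} (hv : ContDiff ℝ 1 v) (x : 𝔼 d) :
    Continuous (sphNormal v x) := by
  have hg := continuous_gradient hv
  have h := continuous_parametric_integral_of_continuous (μ := surface d) (s := univ)
    (f := fun (t : ℝ) (s : sphere (0 : 𝔼 d) 1) =>
      inner ℝ (gradient v (x + t • (s : 𝔼 d))) (s : 𝔼 d)) (by
      refine Continuous.inner (hg.comp (by fun_prop)) (by fun_prop)) isCompact_univ
  rw [Measure.restrict_univ] at h
  exact h

lemma sphInt_sub_sphInt {v : 𝔼 d → ℝ} (hv : ContDiff ℝ 1 v) (x : 𝔼 d) (a b : ℝ) :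
    sphInt v x b - sphInt v x a = ∫ t in a..b, sphNormal v x t := by
  have hg := continuous_gradient hv
  have hc : Continuous fun q : ℝ × sphere (0 : 𝔼 d) 1 =>
      inner ℝ (gradient v (x + q.1 • (q.2 : 𝔼 d))) (q.2 : 𝔼 d) :=
    Continuous.inner (hg.comp (by fun_prop)) (by fun_prop)
  have hd : ∀ (s : sphere (0 : 𝔼 d) 1) (t : ℝ), HasDerivAt (fun t : ℝ => v (x + t • (s : 𝔼 d)))
      (inner ℝ (gradient v (x + t • (s : 𝔼 d))) (s : 𝔼 d)) t := by
    intro s t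
    rw [inner_gradient_eq]
    have h1 : HasDerivAt (fun t : ℝ => x + t • (s : 𝔼 d)) ((1 : ℝ) • (s : 𝔼 d)) t :=
      ((hasDerivAt_id t).smul_const _).const_add x
    rw [one_smul] at h1
    exact ((hv.differentiable (by simp)) _).hasFDerivAt.comp_hasDerivAt t h1
  have h2 : ∀ s : sphere (0 : 𝔼 d) 1, v (x + b • (s : 𝔼 d)) - v (x + a • (s : 𝔼 d)) =
      ∫ t in a..b, inner ℝ (gradient v (x + t • (s : 𝔼 d))) (s : 𝔼 d) := fun s =>
    (intervalIntegral.integral_eq_sub_of_hasDerivAt (fun t _ => hd s t)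
      ((hc.comp (by fun_prop : Continuous fun t : ℝ => (t, s))).intervalIntegrable _ _)).symm
  rw [sphInt, sphInt, ← integral_sub (integrable_sphere hv.continuous x b)
    (integrable_sphere hv.continuous x a)]
  simp only [h2]
  symm
  refine intervalIntegral_integral_swap (f := fun (t : ℝ) (s : sphere (0 : 𝔼 d) 1) =>
      inner ℝ (gradient v (x + t • (s : 𝔼 d))) (s : 𝔼 d)) ?_
  have : IsFiniteMeasure (volume.restrict (Set.uIoc a b) : Measure ℝ) :=
    isFiniteMeasure_restrict.2 (by simp [Set.uIoc])
  obtain ⟨C, hC⟩ := ((isCompact_uIcc (a := a) (b := b)).prod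
    (isCompact_univ (X := sphere (0 : 𝔼 d) 1))).exists_bound_of_continuousOn hc.continuousOn
  refine Integrable.of_bound hc.aestronglyMeasurable C ?_
  have : ((volume.restrict (Set.uIoc a b)).prod (surface d)) =
      (volume.prod (surface d)).restrict (Set.uIoc a b ×ˢ univ) := by
    rw [← Measure.prod_restrict, Measure.restrict_univ]
  rw [this]
  filter_upwards [ae_restrict_mem (measurableSet_uIoc.prod MeasurableSet.univ)] with q hq
  exact hC q ⟨uIoc_subset_uIcc hq.1, trivial⟩

lemma hasDerivAt_sphInt {v : 𝔼 d → ℝ} (hv : ContDiff ℝ 1 v) (x : 𝔼 d) (t : ℝ) :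
    HasDerivAt (sphInt v x) (sphNormal v x t) t := by
  have h : sphInt v x = fun b => sphInt v x 0 + ∫ t in (0 : ℝ)..b, sphNormal v x t := by
    ext b
    rw [← sphInt_sub_sphInt hv]
    ring
  rw [h]
  exact ((continuous_sphNormal hv x).integral_hasStrictDerivAt 0 t).hasDerivAt.const_add _

/-- Spherical means of a radial multiple of the radial derivative. -/
lemma sphInt_radial (v : 𝔼 d → ℝ) (θ : ℝ → ℝ) (x : 𝔼 d) (t : ℝ) :
    sphInt (fun z => θ (‖z - x‖ ^ 2) * inner ℝ (gradient v z) (z - x)) x t =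
      θ (t ^ 2) * t * sphNormal v x t := by
  rw [sphInt, sphNormal, ← integral_const_mul]
  congr 1
  ext s
  have hs : ‖(s : 𝔼 d)‖ = 1 := by simp
  rw [add_sub_cancel_left, norm_smul, hs, mul_one, Real.norm_eq_abs, sq_abs, inner_smul_right]
  ring

lemma inner_gradient_radial {Φ : ℝ → ℝ} (hΦ : Differentiable ℝ Φ) (x z w : 𝔼 d) :
    inner ℝ w (gradient (fun z => Φ (‖z - x‖ ^ 2)) z) =
      (2 * deriv Φ (‖z - x‖ ^ 2)) * inner ℝ w (z - x) := by
  have h1 : HasFDerivAt (fun z : 𝔼 d => ‖z - x‖ ^ 2) (2 • (innerSL ℝ (z - x))) z := by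
    simpa using ((hasFDerivAt_id z).sub_const x).norm_sq
  have h2 := (hΦ (‖z - x‖ ^ 2)).hasDerivAt.comp_hasFDerivAt z h1
  rw [real_inner_comm, inner_gradient_eq]
  have h3 : fderiv ℝ (fun z => Φ (‖z - x‖ ^ 2)) z = deriv Φ (‖z - x‖ ^ 2) • (2 • innerSL ℝ (z - x)) :=
    h2.fderiv
  rw [h3]
  simp only [ContinuousLinearMap.smul_apply, innerSL_apply_apply, smul_eq_mul, nsmul_eq_mul]
  rw [real_inner_comm]
  push_cast
  ring

/-- A weakly subharmonic `C¹` function has nonnegative flux through spheres: otherwise a radial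
cutoff, decreasing only where the flux is negative, is a forbidden test function. -/
lemma sphNormal_nonneg [NeZero d] {v : 𝔼 d → ℝ} (hv : ContDiff ℝ 1 v) {x : 𝔼 d} {R : ℝ}
    (hs : WeaklySubharmonic (ball x R) (gradient v)) {t : ℝ} (ht : 0 < t) (htR : t < R) :
    0 ≤ sphNormal v x t := by
  by_contra! hneg
  have hopen : {t | sphNormal v x t < 0} ∩ Ioo 0 R ∈ 𝓝 t :=
    inter_mem ((continuous_sphNormal hv x).continuousAt.eventually_lt_const hneg)
      (Ioo_mem_nhds ht htR)
  obtain ⟨l, u, htlu, hlu⟩ := mem_nhds_iff_exists_Ioo_subset.1 hopen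
  obtain ⟨a, hla, hat⟩ := exists_between htlu.1
  obtain ⟨b, htb, hbu⟩ := exists_between htlu.2
  have hmem : ∀ q ∈ Icc a b, sphNormal v x q < 0 ∧ q ∈ Ioo 0 R := fun q hq =>
    hlu ⟨hla.trans_le hq.1, hq.2.trans_lt hbu⟩
  have hab : a < b := hat.trans htb
  have ha0 : 0 < a := (hmem a ⟨le_rfl, hab.le⟩).2.1
  have hbR : b < R := (hmem b ⟨hab.le, le_rfl⟩).2.2
  have hsq : 0 < b ^ 2 - a ^ 2 := by nlinarith
  set Φ : ℝ → ℝ := fun q => 1 - Real.smoothTransition ((q - a ^ 2) / (b ^ 2 - a ^ 2)) with hΦ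
  have hΦc : ContDiff ℝ ∞ Φ := contDiff_const.sub
    (Real.smoothTransition.contDiff.comp ((contDiff_id.sub contDiff_const).div_const _))
  have hΦd : Differentiable ℝ Φ := hΦc.differentiable (by simp)
  have hanti : Antitone Φ := fun p q hpq => by
    have := Real.smoothTransition.monotone
      (div_le_div_of_nonneg_right (sub_le_sub_right hpq (a ^ 2)) hsq.le)
    simp only [hΦ]
    linarith
  have hΦ' : ∀ q, deriv Φ q ≤ 0 := fun q => hanti.deriv_nonpos
  have hΦ1 : ∀ q, q < a ^ 2 → deriv Φ q = 0 := fun q hq => by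
    have : Φ =ᶠ[𝓝 q] fun _ => 1 := by
      filter_upwards [Iio_mem_nhds hq] with p hp
      simp only [hΦ]
      rw [Real.smoothTransition.zero_of_nonpos, sub_zero]
      exact div_nonpos_of_nonpos_of_nonneg (by linarith [mem_Iio.1 hp]) hsq.le
    rw [this.deriv_eq, deriv_const]
  have hΦ2 : ∀ q, b ^ 2 ≤ q → Φ q = 0 := fun q hq => by
    simp only [hΦ]
    rw [Real.smoothTransition.one_of_one_le, sub_self]
    rw [le_div_iff₀ hsq]
    linarith
  have hΦ3 : ∀ q, b ^ 2 < q → deriv Φ q = 0 := fun q hq => by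
    have : Φ =ᶠ[𝓝 q] fun _ => 0 := by
      filter_upwards [Ioi_mem_nhds hq] with p hp
      exact hΦ2 p (le_of_lt hp)
    rw [this.deriv_eq, deriv_const]
  have htest : IsTest (ball x R) fun z => Φ (‖z - x‖ ^ 2) := by
    have hsub : tsupport (fun z : 𝔼 d => Φ (‖z - x‖ ^ 2)) ⊆ closedBall x b := by
      refine closure_minimal (fun z hz => ?_) isClosed_closedBall
      by_contra hzb
      rw [mem_closedBall, dist_eq_norm, not_le] at hzb
      have hb0 : 0 ≤ b := (ha0.trans hab).le
      exact hz (hΦ2 _ (by gcongr))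
    exact ⟨hΦc.comp (contDiff_norm_sq ℝ |>.comp (contDiff_id.sub contDiff_const)),
      (isCompact_closedBall x b).of_isClosed_subset (isClosed_tsupport _) hsub,
      hsub.trans (closedBall_subset_ball hbR)⟩
  have hle := hs _ htest fun z => by
    simp only [hΦ]
    linarith [Real.smoothTransition.le_one ((‖z - x‖ ^ 2 - a ^ 2) / (b ^ 2 - a ^ 2))]
  simp only [inner_gradient_radial hΦd] at hle
  have hdc : Continuous (deriv Φ) := hΦc.continuous_deriv (by simp)
  have hfc : Continuous fun z : 𝔼 d =>
      2 * deriv Φ (‖z - x‖ ^ 2) * inner ℝ (gradient v z) (z - x) :=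
    (continuous_const.mul (hdc.comp (by fun_prop))).mul
      ((continuous_gradient hv).inner (by fun_prop))
  rw [integral_ball_eq hfc x (ht.trans htR).le] at hle
  simp only [sphInt_radial v (fun q => 2 * deriv Φ q)] at hle
  refine absurd hle (not_le.2 ?_)
  have hsign : ∀ t, 0 < t → 0 ≤ 2 * deriv Φ (t ^ 2) * t * sphNormal v x t := fun t ht0 => by
    by_cases h : t ∈ Icc a b
    · exact mul_nonneg_of_nonpos_of_nonpos
        (mul_nonpos_of_nonpos_of_nonneg (by linarith [hΦ' (t ^ 2)]) ht0.le) (hmem t h).1.le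
    · have : deriv Φ (t ^ 2) = 0 := by
        rcases lt_or_ge t a with h' | h'
        · exact hΦ1 _ (by gcongr)
        · have hbt : b < t := not_le.1 fun h'' => h ⟨h', h''⟩
          exact hΦ3 _ (pow_lt_pow_left₀ hbt (ha0.trans hab).le two_ne_zero)
      simp [this]
  obtain ⟨q, hq, hqd⟩ := exists_deriv_eq_slope Φ (show a ^ 2 < b ^ 2 by linarith)
    hΦc.continuous.continuousOn hΦd.differentiableOn
  have hq0 : 0 < q := (by positivity : (0 : ℝ) < a ^ 2).trans hq.1
  have hsqrt : √q ^ 2 = q := Real.sq_sqrt hq0.le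
  have hqa : a ≤ √q := Real.le_sqrt_of_sq_le hq.1.le
  have hqb : √q ≤ b := Real.sqrt_le_iff.2 ⟨(ha0.trans hab).le, hq.2.le⟩
  refine intervalIntegral.integral_pos (ht.trans htR) ?_ (fun t ht' =>
    mul_nonneg (pow_nonneg ht'.1.le _) (hsign t ht'.1)) ⟨√q, ⟨Real.sqrt_nonneg _,
      hqb.trans hbR.le⟩, ?_⟩
  · exact ((continuous_pow _).mul (((continuous_const.mul (hdc.comp (continuous_pow 2))).mul
      continuous_id).mul (continuous_sphNormal hv x))).continuousOn
  · have h1 : deriv Φ q < 0 := by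
      have e1 : Φ (a ^ 2) = 1 := by simp [hΦ]
      rw [hqd, hΦ2 _ le_rfl, e1]
      exact div_neg_of_neg_of_pos (by norm_num) hsq
    rw [hsqrt]
    exact mul_pos (pow_pos (Real.sqrt_pos.2 hq0) _) (mul_pos_of_neg_of_neg
      (mul_neg_of_neg_of_pos (by linarith) (Real.sqrt_pos.2 hq0)) (hmem _ ⟨hqa, hqb⟩).1)

/-- Spherical means of a smooth subharmonic function increase with the radius. -/
lemma sphInt_mono_of_weaklySubharmonic [NeZero d] {v : 𝔼 d → ℝ} (hv : ContDiff ℝ 1 v) {x : 𝔼 d}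
    {R : ℝ} (hs : WeaklySubharmonic (ball x R) (gradient v)) {a b : ℝ} (ha : 0 ≤ a) (hab : a ≤ b)
    (hbR : b < R) : sphInt v x a ≤ sphInt v x b := by
  rw [← sub_nonneg, sphInt_sub_sphInt hv]
  rw [intervalIntegral.integral_of_le hab]
  exact setIntegral_nonneg measurableSet_Ioc fun t ht =>
    sphNormal_nonneg hv hs (ha.trans_lt ht.1) (ht.2.trans_lt hbR)

/-- Integration by parts on an annulus against a radial field whose flux `t ^ d θ(t²)` is
nonnegative and decreasing. -/
lemma neg_integral_radial_le [NeZero d] {f : 𝔼 d → ℝ} (hf : ContDiff ℝ 1 f) {x : 𝔼 d} {r R : ℝ}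
    (hr : 0 ≤ r) (hrR : r ≤ R) (hf0 : ∀ y, 0 ≤ f y) {θ h' : ℝ → ℝ} (hθ : Continuous θ)
    (hθ0 : 0 ≤ θ (R ^ 2))
    (hd : ∀ t, HasDerivAt (fun t => t ^ d * θ (t ^ 2)) (h' t) t) (hc : Continuous h')
    (hneg : ∀ t ∈ Icc r R, h' t ≤ 0) :
    -∫ z in ball x R \ ball x r, θ (‖z - x‖ ^ 2) * inner ℝ (gradient f z) (z - x) ≤
      r ^ d * θ (r ^ 2) * sphInt f x r := by
  have hfc : Continuous fun z : 𝔼 d => θ (‖z - x‖ ^ 2) * inner ℝ (gradient f z) (z - x) :=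
    (hθ.comp (by fun_prop)).mul ((continuous_gradient hf).inner (by fun_prop))
  have hS0 : ∀ t, 0 ≤ sphInt f x t := fun t => integral_nonneg fun s => hf0 _
  rw [integral_annulus_eq hfc x hr hrR]
  simp only [sphInt_radial]
  have e : ∀ t : ℝ, t ^ (d - 1) * (θ (t ^ 2) * t * sphNormal f x t) =
      (t ^ d * θ (t ^ 2)) * sphNormal f x t := fun t => by
    have : t ^ d = t ^ (d - 1) * t := by rw [← pow_succ, Nat.sub_add_cancel NeZero.one_le]
    rw [this]
    ring
  simp only [e]
  rw [intervalIntegral.integral_mul_deriv_eq_deriv_mul (fun t _ => hd t)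
    (fun t _ => hasDerivAt_sphInt hf x t) (hc.intervalIntegrable _ _)
    ((continuous_sphNormal hf x).intervalIntegrable _ _)]
  have h1 : ∫ t in r..R, h' t * sphInt f x t ≤ 0 := by
    rw [intervalIntegral.integral_of_le hrR]
    refine setIntegral_nonpos measurableSet_Ioc fun t ht =>
      mul_nonpos_of_nonpos_of_nonneg (hneg t ⟨ht.1.le, ht.2⟩) (hS0 t)
  have h2 : 0 ≤ R ^ d * θ (R ^ 2) * sphInt f x R :=
    mul_nonneg (mul_nonneg (pow_nonneg (hr.trans hrR) _) hθ0) (hS0 R)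
  linarith

lemma sphNormal_le_sphInt_norm {v : 𝔼 d → ℝ} (hv : ContDiff ℝ 1 v) (x : 𝔼 d) (t : ℝ) :
    sphNormal v x t ≤ sphInt (fun z => ‖gradient v z‖) x t := by
  have hg := continuous_gradient hv
  refine integral_mono (Continuous.integrable_of_hasCompactSupport ?_
    (HasCompactSupport.of_compactSpace _)) (integrable_sphere hg.norm x t) fun s => ?_
  · exact Continuous.inner (hg.comp (by fun_prop)) (by fun_prop)
  · refine (real_inner_le_norm _ _).trans ?_
    have hs : ‖(s : 𝔼 d)‖ = 1 := by simp
    rw [hs, mul_one]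

/-- The growth of the spherical means from radius `ρ` to radius `r` is controlled by the gradient in the
annulus between. -/
lemma sphInt_le_add_gradient [NeZero d] {v : 𝔼 d → ℝ} (hv : ContDiff ℝ 1 v) (x : 𝔼 d) {ρ r : ℝ}
    (hρ : 0 < ρ) (hρr : ρ ≤ r) :
    sphInt v x r ≤ sphInt v x ρ +
      (ρ ^ (d - 1))⁻¹ * ∫ y in ball x r \ ball x ρ, ‖gradient v y‖ := by
  have hg := (continuous_gradient hv).norm
  rw [integral_annulus_eq hg x hρ.le hρr, ← sub_le_iff_le_add', sphInt_sub_sphInt hv,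
    ← intervalIntegral.integral_const_mul]
  refine intervalIntegral.integral_mono_on hρr ((continuous_sphNormal hv x).intervalIntegrable _ _)
    (Continuous.intervalIntegrable (by
      exact continuous_const.mul ((continuous_pow _).mul (continuous_sphInt hg x))) _ _)
    fun t ht => ?_
  have h0 : 0 ≤ sphInt (fun z => ‖gradient v z‖) x t := integral_nonneg fun s => norm_nonneg _
  refine (sphNormal_le_sphInt_norm hv x t).trans ?_
  rw [← mul_assoc]
  refine le_mul_of_one_le_left h0 ?_
  rw [inv_mul_eq_div, one_le_div (by positivity)]
  gcongr
  exact ht.1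

lemma sphInt_zero (v : 𝔼 d → ℝ) (x : 𝔼 d) : sphInt v x 0 = (surface d).real univ * v x := by
  simp [sphInt]

lemma surface_real_univ : (surface d).real univ = d * volume.real (ball (0 : 𝔼 d) 1) := by
  simpa using (volume : Measure (𝔼 d)).toSphere_real_apply_univ

lemma volume_real_ball_eq [NeZero d] (x : 𝔼 d) {s : ℝ} (hs : 0 ≤ s) :
    volume.real (ball x s) = s ^ d * volume.real (ball (0 : 𝔼 d) 1) := by
  rw [measureReal_def, Measure.addHaar_ball _ x hs, ENNReal.toReal_mul,
    ENNReal.toReal_ofReal (by positivity), finrank_euclideanSpace_fin, measureReal_def]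

lemma integral_pow_pred [NeZero d] (s : ℝ) : ∫ t in (0 : ℝ)..s, t ^ (d - 1) = s ^ d / d := by
  have : d - 1 + 1 = d := Nat.sub_add_cancel NeZero.one_le
  rw [integral_pow, this, zero_pow (NeZero.ne d), sub_zero, Nat.cast_sub NeZero.one_le]
  simp

/-- The sub-mean-value property over balls. -/
lemma mul_le_integral_ball [NeZero d] {v : 𝔼 d → ℝ} (hv : ContDiff ℝ 1 v) {x : 𝔼 d}
    {R : ℝ} (hs : WeaklySubharmonic (ball x R) (gradient v)) {s : ℝ} (hs0 : 0 ≤ s) (hsR : s < R) :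
    volume.real (ball x s) * v x ≤ ∫ y in ball x s, v y := by
  have hdpos : (0 : ℝ) < d := Nat.cast_pos.2 (Nat.pos_of_ne_zero (NeZero.ne d))
  rw [integral_ball_eq hv.continuous x hs0]
  have : volume.real (ball x s) * v x = ∫ t in (0 : ℝ)..s, t ^ (d - 1) * sphInt v x 0 := by
    rw [intervalIntegral.integral_mul_const, integral_pow_pred, sphInt_zero, surface_real_univ,
      volume_real_ball_eq x hs0]
    field_simp
  rw [this]
  refine intervalIntegral.integral_mono_on hs0 (Continuous.intervalIntegrable (by fun_prop) _ _)
    (((continuous_pow _).mul (continuous_sphInt hv.continuous x)).intervalIntegrable _ _)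
    fun t ht => mul_le_mul_of_nonneg_left ?_ (pow_nonneg ht.1 _)
  exact sphInt_mono_of_weaklySubharmonic hv hs le_rfl ht.1 (ht.2.trans_lt hsR)

lemma integral_ball_le [NeZero d] {v : 𝔼 d → ℝ} (hv : ContDiff ℝ 1 v) {x : 𝔼 d}
    {R : ℝ} (hs : WeaklySubharmonic (ball x R) (gradient v)) {s : ℝ} (hs0 : 0 ≤ s) (hsR : s < R) :
    ∫ y in ball x s, v y ≤ s ^ d / d * sphInt v x s := by
  rw [integral_ball_eq hv.continuous x hs0, ← integral_pow_pred,
    ← intervalIntegral.integral_mul_const]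
  refine intervalIntegral.integral_mono_on hs0
    (((continuous_pow _).mul (continuous_sphInt hv.continuous x)).intervalIntegrable _ _)
    (Continuous.intervalIntegrable (by fun_prop) _ _)
    fun t ht => mul_le_mul_of_nonneg_left ?_ (pow_nonneg ht.1 _)
  exact sphInt_mono_of_weaklySubharmonic hv hs ht.1 ht.2 hsR

/-- A mollification is a weighted average of spherical means; this is why mollifications of a
subharmonic function are monotone in the scale. -/
lemma mol_eq_integral_sphInt [NeZero d] {v : 𝔼 d → ℝ} (hv : Continuous v) (x : 𝔼 d) (δ : ℝ) :
    mol δ v x = ∫ t in (0 : ℝ)..1, t ^ (d - 1) *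
      ((∫ z : 𝔼 d, expNegInvGlue (1 - ‖z‖ ^ 2))⁻¹ * expNegInvGlue (1 - t ^ 2) *
        sphInt v x (δ * t)) := by
  have hc : Continuous fun y : 𝔼 d => rho y * v (x + δ • y) :=
    continuous_rho.mul (hv.comp (by fun_prop))
  have h1 : mol δ v x = ∫ y in ball (0 : 𝔼 d) 1, rho y * v (x + δ • y) := by
    rw [mol, integral_molMeasure, ← integral_neg_eq_self, setIntegral_eq_integral_of_forall_compl_eq_zero]
    · congr 1
      ext y
      rw [rho_eq_of_norm_eq (norm_neg y), smul_neg, sub_neg_eq_add, smul_eq_mul]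
    · intro y hy
      rw [rho_eq_zero (by simpa using hy), zero_mul]
  rw [h1, integral_ball_eq hc 0 zero_le_one]
  congr 1
  ext t
  congr 1
  rw [sphInt, sphInt, ← integral_const_mul]
  congr 1
  ext s
  have hs : ‖(s : 𝔼 d)‖ = 1 := by simp
  rw [zero_add, rho, norm_smul, hs, mul_one, Real.norm_eq_abs, sq_abs, smul_smul]

/-- Mollifications of a subharmonic function increase with the radius. -/
lemma mol_le_mol_of_weaklySubharmonic [NeZero d] {v : 𝔼 d → ℝ} (hv : ContDiff ℝ 1 v) {x : 𝔼 d}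
    {R : ℝ} (hs : WeaklySubharmonic (ball x R) (gradient v)) {a b : ℝ} (ha : 0 ≤ a) (hab : a ≤ b)
    (hbR : b < R) : mol a v x ≤ mol b v x := by
  rw [mol_eq_integral_sphInt hv.continuous, mol_eq_integral_sphInt hv.continuous]
  have hcont : ∀ δ : ℝ, Continuous fun t : ℝ => t ^ (d - 1) *
      ((∫ z : 𝔼 d, expNegInvGlue (1 - ‖z‖ ^ 2))⁻¹ * expNegInvGlue (1 - t ^ 2) *
        sphInt v x (δ * t)) := fun δ =>
    (continuous_pow _).mul ((continuous_const.mul (expNegInvGlue.contDiff (n := 0)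
      |>.continuous.comp (by fun_prop))).mul
      ((continuous_sphInt hv.continuous x).comp (by fun_prop)))
  refine intervalIntegral.integral_mono_on zero_le_one ((hcont a).intervalIntegrable _ _)
    ((hcont b).intervalIntegrable _ _) fun t ht => ?_
  refine mul_le_mul_of_nonneg_left (mul_le_mul_of_nonneg_left ?_
    (mul_nonneg (inv_nonneg.2 (integral_nonneg fun z => expNegInvGlue.nonneg _))
      (expNegInvGlue.nonneg _))) (pow_nonneg ht.1 _)
  have hb : 0 ≤ b := ha.trans hab
  exact sphInt_mono_of_weaklySubharmonic hv hs (mul_nonneg ha ht.1)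
    (mul_le_mul_of_nonneg_right hab ht.1) ((mul_le_of_le_one_right hb ht.2).trans_lt hbR)

end polar

/-! ### Weakly subharmonic functions in `H¹` -/

section subharmonic

lemma memLp_comp_shift {g : 𝔼 d → 𝔼 d} (hsm : StronglyMeasurable g) (hg : MemLp g 2) (δ : ℝ) :
    MemLp (fun q : 𝔼 d × 𝔼 d => g (q.1 - δ • q.2)) 2 (volume.prod (molMeasure d)) := by
  have hm : StronglyMeasurable (fun q : 𝔼 d × 𝔼 d => g (q.1 - δ • q.2)) :=
    hsm.comp_measurable (by fun_prop)
  refine ⟨hm.aestronglyMeasurable, ?_⟩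
  have key : eLpNorm (fun q : 𝔼 d × 𝔼 d => g (q.1 - δ • q.2)) 2 (volume.prod (molMeasure d)) ^ 2 =
      eLpNorm g 2 volume ^ 2 := by
    rw [eLpNorm_two_sq, lintegral_prod_symm _ (hm.enorm.pow_const 2).aemeasurable]
    have h3 : ∀ y : 𝔼 d, ∫⁻ x, ‖g (x - δ • y)‖ₑ ^ 2 = eLpNorm g 2 volume ^ 2 := fun y => by
      rw [eLpNorm_two_sq]
      exact lintegral_sub_right_eq_self (μ := volume) (fun x => ‖g x‖ₑ ^ 2) (δ • y)
    simp only [h3, lintegral_const, measure_univ, mul_one]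
  exact (ENNReal.pow_lt_top_iff.1 (key ▸ ENNReal.pow_lt_top hg.2)).resolve_right (by norm_num)

lemma integral_inner_gradient {D : Set (𝔼 d)} {G : 𝔼 d → 𝔼 d} {ψ : 𝔼 d → ℝ} (hψ : IsTest D ψ) :
    ∫ x in D, inner ℝ (G x) (gradient ψ x) = ∫ x, inner ℝ (G x) (gradient ψ x) := by
  refine setIntegral_eq_integral_of_forall_compl_eq_zero fun x hx => ?_
  rw [gradient, hψ.fderiv_eq_zero hx]
  simp

lemma IsTest.comp_add_right {D B : Set (𝔼 d)} {ψ : 𝔼 d → ℝ} (hψ : IsTest B ψ) (c : 𝔼 d)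
    (h : ∀ y ∈ B, y - c ∈ D) : IsTest D fun y => ψ (y + c) := by
  refine ⟨hψ.contDiff.comp (contDiff_id.add contDiff_const),
    hψ.compact.comp_homeomorph (Homeomorph.addRight c), fun y hy => ?_⟩
  have h1 : y + c ∈ tsupport ψ := by
    have := tsupport_comp_eq_preimage ψ (Homeomorph.addRight c)
    have h2 : y ∈ tsupport (ψ ∘ (Homeomorph.addRight c)) := hy
    rw [this] at h2
    exact h2
  simpa using h _ (hψ.subset h1)

lemma gradient_comp_add_right (ψ : 𝔼 d → ℝ) (c y : 𝔼 d) :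
    gradient (fun y => ψ (y + c)) y = gradient ψ (y + c) := by
  rw [gradient, gradient, fderiv_comp_add_right]

/-- Mollification preserves weak subharmonicity, on a smaller ball. -/
lemma WeaklySubharmonic.mol {D : Set (𝔼 d)} {G : 𝔼 d → 𝔼 d} (hG : MemLp G 2)
    (hs : WeaklySubharmonic D G) {x : 𝔼 d} {R δ : ℝ} (hδ : 0 < δ) (hB : ball x (R + δ) ⊆ D) :
    WeaklySubharmonic (ball x R) (mol δ G) := by
  intro ψ hψ hψ0
  rw [integral_inner_gradient hψ, mol_congr hG.1.ae_eq_mk hδ.ne']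
  have hs' : ∀ φ, IsTest D φ → (∀ x, 0 ≤ φ x) →
      ∫ x, inner ℝ (hG.1.mk G x) (gradient φ x) ≤ 0 := fun φ hφ hφ0 => by
    have := hs φ hφ hφ0
    rw [integral_inner_gradient hφ] at this
    refine le_of_eq_of_le (integral_congr_ae ?_) this
    filter_upwards [hG.1.ae_eq_mk] with y hy
    rw [hy]
  have hg : MemLp (hG.1.mk G) 2 := hG.ae_eq hG.1.ae_eq_mk
  have hsm := hG.1.stronglyMeasurable_mk
  generalize hG.1.mk G = g at hs' hg hsm
  have cψ := continuous_gradient (hψ.contDiff.of_le (by simp))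
  have mψ : MemLp (gradient ψ) 2 := cψ.memLp_of_hasCompactSupport hψ.compact_gradient
  have hint : Integrable (fun q : 𝔼 d × 𝔼 d => inner ℝ (g (q.1 - δ • q.2)) (gradient ψ q.1))
      (volume.prod (molMeasure d)) :=
    integrable_inner_of_memLp (memLp_comp_shift hsm hg δ) (mψ.comp_fst (molMeasure d))
  have e1 : ∀ y, inner ℝ (MultiphaseBernoulli.mol δ g y) (gradient ψ y) =
      ∫ z, inner ℝ (g (y - δ • z)) (gradient ψ y) ∂(molMeasure d) := fun y => by
    rw [MultiphaseBernoulli.mol, real_inner_comm, ← integral_inner (integrable_mol hg y hδ.ne')]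
    simp only [real_inner_comm]
  simp only [e1]
  rw [integral_integral_swap hint]
  refine integral_nonpos_of_ae ?_
  filter_upwards [ae_molMeasure_norm_lt] with z hz
  have e2 : ∫ y, inner ℝ (g (y - δ • z)) (gradient ψ y) =
      ∫ y, inner ℝ (g y) (gradient (fun y => ψ (y + δ • z)) y) := by
    rw [← integral_add_right_eq_self _ (δ • z)]
    simp only [add_sub_cancel_right, gradient_comp_add_right]
  change ∫ y, inner ℝ (g (y - δ • z)) (gradient ψ y) ≤ 0
  rw [e2]
  refine hs' _ (hψ.comp_add_right _ fun y hy => hB ?_) fun y => hψ0 _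
  rw [mem_ball] at hy ⊢
  calc dist (y - δ • z) x ≤ dist (y - δ • z) y + dist y x := dist_triangle _ _ _
    _ < R + δ := by
      have : dist (y - δ • z) y ≤ δ := by
        rw [dist_eq_norm, sub_sub_cancel_left, norm_neg, norm_smul, Real.norm_eq_abs, abs_of_pos hδ]
        exact mul_le_of_le_one_right hδ.le hz.le
      linarith

/-- A nonnegative weakly subharmonic function `u ∈ H¹(D)` with gradient `G`; both are extended to
the whole space as elements of `L²`. -/
structure IsSubharmonic (D : Set (𝔼 d)) (u : 𝔼 d → ℝ) (G : 𝔼 d → 𝔼 d) : Prop where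
  nonneg : ∀ x, 0 ≤ u x
  memLp : MemLp u 2
  memLp_grad : MemLp G 2
  isWeakGrad : IsWeakGrad D u G
  sub : WeaklySubharmonic D G

/-- The upper limit of the averages of `|u|` over small balls. -/
noncomputable def upperRep (u : 𝔼 d → ℝ) (x : 𝔼 d) : ℝ≥0∞ :=
  limsup (fun r : ℝ => ⨍⁻ y in ball x r, ‖u y‖ₑ ∂volume) (𝓝[>] (0 : ℝ))

/-- The canonical representative, with real values. -/
noncomputable def rep (u : 𝔼 d → ℝ) (x : 𝔼 d) : ℝ := (upperRep u x).toReal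

lemma rep_nonneg (u : 𝔼 d → ℝ) (x : 𝔼 d) : 0 ≤ rep u x := ENNReal.toReal_nonneg

lemma tendsto_scale_nhdsGT : Tendsto scale atTop (𝓝[>] 0) :=
  tendsto_nhdsWithin_iff.2 ⟨tendsto_scale, Eventually.of_forall scale_pos⟩

section tendsto

variable {F : Type*} [NormedAddCommGroup F]

lemma tendsto_setIntegral_norm {f : 𝔼 d → F} {fn : ℕ → 𝔼 d → F} (hf : MemLp f 2)
    (hfn : ∀ n, MemLp (fn n) 2)
    (h : Tendsto (fun n => eLpNorm (fun x => fn n x - f x) 2) atTop (𝓝 0))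
    {A : Set (𝔼 d)} (hA : MeasurableSet A) (hAv : volume A ≠ ⊤) :
    Tendsto (fun n => ∫ y in A, ‖fn n y‖) atTop (𝓝 (∫ y in A, ‖f y‖)) := by
  have mA : MemLp (A.indicator fun _ => (1 : ℝ)) 2 (volume : Measure (𝔼 d)) :=
    memLp_indicator_const 2 hA 1 (Or.inr hAv)
  have h1 : Tendsto (fun n => eLpNorm (fun x => ‖fn n x‖ - ‖f x‖) 2) atTop (𝓝 0) := by
    refine tendsto_of_tendsto_of_tendsto_of_le_of_le tendsto_const_nhds h (fun _ => zero_le) ?_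
    refine fun n => eLpNorm_mono fun x => ?_
    simpa using abs_norm_sub_norm_le (fn n x) (f x)
  have key := tendsto_integral_inner hf.norm mA (fun n => (hfn n).norm) (fun _ => mA) h1
    (by simp)
  have e : ∀ g : 𝔼 d → F, ∫ x, inner ℝ (‖g x‖) (A.indicator (fun _ => (1 : ℝ)) x) =
      ∫ y in A, ‖g y‖ := fun g => by
    rw [← integral_indicator hA]
    congr 1
    ext x
    by_cases hx : x ∈ A <;> simp [hx]
  simpa only [e] using key

end tendsto

lemma tendsto_mol_scale {F : Type*} [NormedAddCommGroup F] [NormedSpace ℝ F] [CompleteSpace F]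
    {f : 𝔼 d → F} (hf : MemLp f 2) :
    Tendsto (fun n => eLpNorm (fun x => mol (scale n) f x - f x) 2) atTop (𝓝 0) :=
  (tendsto_mol hf).comp tendsto_scale_nhdsGT

lemma tendsto_mol_mol {f : 𝔼 d → ℝ} (hf : MemLp f 2) {δ : ℝ} (hδ : 0 < δ) (x : 𝔼 d) :
    Tendsto (fun n => mol δ (mol (scale n) f) x) atTop (𝓝 (mol δ f x)) := by
  have mρ : MemLp (fun z => rhoScaled δ (x - z)) 2 (volume : Measure (𝔼 d)) := by
    have ht := isTest_rhoScaled (D := univ) hδ (x := x) (subset_univ _)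
    exact ht.continuous.memLp_of_hasCompactSupport ht.compact
  have key := tendsto_integral_inner hf mρ (fun n => memLp_two_mol hf (scale_pos n)) (fun _ => mρ)
    (tendsto_mol_scale hf) (by simp)
  have e : ∀ g : 𝔼 d → ℝ, ∫ z, inner ℝ (g z) (rhoScaled δ (x - z)) = mol δ g x := fun g => by
    rw [mol_eq_integral g hδ]
    rfl
  simpa only [e] using key

lemma exists_subseq_mol_ae {f : 𝔼 d → ℝ} (hf : MemLp f 2) :
    ∃ ns : ℕ → ℕ, StrictMono ns ∧
      ∀ᵐ x, Tendsto (fun n => mol (scale (ns n)) f x) atTop (𝓝 (f x)) :=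
  (tendstoInMeasure_of_tendsto_eLpNorm (by norm_num)
    (fun n => (memLp_two_mol hf (scale_pos n)).1) hf.1 (tendsto_mol_scale hf)).exists_seq_tendsto_ae

namespace IsSubharmonic

variable {D : Set (𝔼 d)} {u : 𝔼 d → ℝ} {G : 𝔼 d → 𝔼 d}

lemma contDiff_mol (h : IsSubharmonic D u G) {δ : ℝ} (hδ : 0 < δ) : ContDiff ℝ 1 (mol δ u) :=
  (MultiphaseBernoulli.contDiff_mol h.memLp hδ).of_le (by simp)

lemma gradient_mol (h : IsSubharmonic D u G) {x : 𝔼 d} {R δ : ℝ} (hδ : 0 < δ)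
    (hB : ball x (R + δ) ⊆ D) {y : 𝔼 d} (hy : y ∈ ball x R) :
    gradient (mol δ u) y = mol δ G y := by
  refine MultiphaseBernoulli.gradient_mol h.isWeakGrad h.memLp h.memLp_grad hδ fun z hz => hB ?_
  rw [mem_ball] at hy ⊢
  rw [mem_closedBall] at hz
  linarith [dist_triangle z y x]

lemma weaklySubharmonic_mol (h : IsSubharmonic D u G) {x : 𝔼 d} {R δ : ℝ} (hδ : 0 < δ)
    (hB : ball x (R + δ) ⊆ D) : WeaklySubharmonic (ball x R) (gradient (mol δ u)) := by
  intro ψ hψ hψ0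
  refine le_of_eq_of_le (setIntegral_congr_fun measurableSet_ball fun y hy => ?_)
    (h.sub.mol h.memLp_grad hδ hB ψ hψ hψ0)
  simp only [h.gradient_mol hδ hB hy]

lemma setLAverage_eq (h : IsSubharmonic D u G) (x : 𝔼 d) {s : ℝ} (hs : 0 < s) :
    ⨍⁻ y in ball x s, ‖u y‖ₑ ∂volume =
      ENNReal.ofReal ((volume.real (ball x s))⁻¹ * ∫ y in ball x s, u y) := by
  have hi : Integrable u (volume.restrict (ball x s)) :=
    have : IsFiniteMeasure ((volume : Measure (𝔼 d)).restrict (ball x s)) :=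
      isFiniteMeasure_restrict.2 measure_ball_lt_top.ne
    (h.memLp.restrict _).integrable (by norm_num)
  have hv : 0 < volume.real (ball x s) :=
    ENNReal.toReal_pos (measure_ball_pos _ _ hs).ne' measure_ball_lt_top.ne
  rw [MeasureTheory.setLAverage_eq, ENNReal.ofReal_mul (inv_nonneg.2 hv.le), ENNReal.ofReal_inv_of_pos hv,
    measureReal_def, ENNReal.ofReal_toReal measure_ball_lt_top.ne,
    ofReal_integral_eq_lintegral_ofReal hi (Eventually.of_forall h.nonneg), ENNReal.div_eq_inv_mul]
  congr 2
  ext y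
  rw [Real.enorm_eq_ofReal (h.nonneg y)]

lemma tendsto_setIntegral (h : IsSubharmonic D u G) {A : Set (𝔼 d)} (hA : MeasurableSet A)
    (hAv : volume A ≠ ⊤) :
    Tendsto (fun n => ∫ y in A, mol (scale n) u y) atTop (𝓝 (∫ y in A, u y)) := by
  have := tendsto_setIntegral_norm h.memLp (fun n => memLp_two_mol h.memLp (scale_pos n))
    (tendsto_mol_scale h.memLp) hA hAv
  simpa only [Real.norm_of_nonneg (h.nonneg _),
    Real.norm_of_nonneg (mol_nonneg h.nonneg _ _)] using this

variable [NeZero d]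

lemma mol_le_mol (h : IsSubharmonic D u G) {x : 𝔼 d} {R : ℝ} (hB : ball x R ⊆ D) {a b : ℝ}
    (ha : 0 < a) (hab : a ≤ b) (hbR : b < R) : mol a u x ≤ mol b u x := by
  refine le_of_tendsto_of_tendsto (tendsto_mol_mol h.memLp ha x)
    (tendsto_mol_mol h.memLp (ha.trans_le hab) x) ?_
  filter_upwards [tendsto_scale.eventually_lt_const (sub_pos.2 hbR)] with n hn
  exact mol_le_mol_of_weaklySubharmonic (R := R - scale n) (h.contDiff_mol (scale_pos n))
    (h.weaklySubharmonic_mol (scale_pos n) (by simpa using hB)) ha.le hab (by linarith)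

/-- A subharmonic function lies below its mollifications almost everywhere. -/
lemma ae_le_mol (h : IsSubharmonic D u G) {δ : ℝ} (hδ : 0 < δ) :
    ∀ᵐ y, ∀ R, δ < R → ball y R ⊆ D → u y ≤ mol δ u y := by
  obtain ⟨ns, hns, hae⟩ := exists_subseq_mol_ae h.memLp
  filter_upwards [hae] with y hy R hR hB
  refine le_of_tendsto hy ?_
  filter_upwards [(tendsto_scale.comp hns.tendsto_atTop).eventually_lt_const hδ] with n hn
  exact h.mol_le_mol hB (scale_pos _) hn.le hR

/-- The mollifications decrease to the canonical representative at every point of `D`. -/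
lemma tendsto_mol_rep (h : IsSubharmonic D u G) (hD : IsOpen D) {x : 𝔼 d} (hx : x ∈ D) :
    upperRep u x = ENNReal.ofReal (rep u x) ∧
      Tendsto (fun δ => mol δ u x) (𝓝[>] 0) (𝓝 (rep u x)) := by
  obtain ⟨R, hR, hB⟩ := Metric.isOpen_iff.1 hD x hx
  set L := sInf ((fun δ => mol δ u x) '' Ioo 0 R) with hLdef
  have hbdd : BddBelow ((fun δ => mol δ u x) '' Ioo 0 R) :=
    ⟨0, by rintro _ ⟨δ, _, rfl⟩; exact mol_nonneg h.nonneg δ x⟩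
  have hne : (Ioo 0 R).Nonempty := ⟨R / 2, by constructor <;> linarith⟩
  have hL : Tendsto (fun δ => mol δ u x) (𝓝[>] 0) (𝓝 L) :=
    MonotoneOn.tendsto_nhdsWithin_Ioo_right hne (fun a ha b hb hab => h.mol_le_mol hB ha.1 hab hb.2) hbdd
  have hLle : ∀ δ, 0 < δ → δ < R → L ≤ mol δ u x := fun δ h1 h2 => csInf_le hbdd ⟨δ, ⟨h1, h2⟩, rfl⟩
  have hL0 : 0 ≤ L := le_csInf (hne.image _) (by rintro _ ⟨δ, _, rfl⟩; exact mol_nonneg h.nonneg δ x)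
  have hlow : ENNReal.ofReal L ≤ upperRep u x := by
    refine le_limsup_of_frequently_le (Eventually.frequently ?_)
    filter_upwards [Ioo_mem_nhdsGT hR] with s hs
    have hv : 0 < volume.real (ball x s) :=
      ENNReal.toReal_pos (measure_ball_pos _ _ hs.1).ne' measure_ball_lt_top.ne
    rw [h.setLAverage_eq x hs.1]
    refine ENNReal.ofReal_le_ofReal ?_
    rw [le_inv_mul_iff₀ hv]
    refine ge_of_tendsto (h.tendsto_setIntegral measurableSet_ball measure_ball_lt_top.ne) ?_
    filter_upwards [tendsto_scale.eventually_lt_const (sub_pos.2 hs.2)] with n hn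
    refine le_trans (mul_le_mul_of_nonneg_left (hLle _ (scale_pos n) (by linarith [hs.1])) hv.le) ?_
    exact mul_le_integral_ball (R := R - scale n) (h.contDiff_mol (scale_pos n))
      (h.weaklySubharmonic_mol (scale_pos n) (by simpa using hB)) hs.1.le (by linarith)
  have hup : ∀ δ, 0 < δ → δ < R → upperRep u x ≤ ENNReal.ofReal (mol δ u x) := by
    intro δ hδ hδR
    have hcont : Continuous fun y => ENNReal.ofReal (mol δ u y) :=
      ENNReal.continuous_ofReal.comp (h.contDiff_mol hδ).continuous
    refine le_of_forall_gt fun c hc => ?_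
    obtain ⟨c', hc1, hc2⟩ := exists_between hc
    obtain ⟨s₀, hs₀, hball⟩ := Metric.eventually_nhds_iff_ball.1
      (hcont.continuousAt.eventually_lt_const hc1)
    refine lt_of_le_of_lt ?_ hc2
    refine limsup_le_of_le (by isBoundedDefault) ?_
    filter_upwards [Ioo_mem_nhdsGT (lt_min hs₀ (sub_pos.2 hδR))] with s hs
    have hvs : (volume : Measure (𝔼 d)).restrict (ball x s) univ ≠ 0 := by
      simpa using (measure_ball_pos volume x hs.1).ne'
    rw [MeasureTheory.setLAverage_eq]
    refine ENNReal.div_le_of_le_mul ?_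
    rw [← setLIntegral_const]
    refine lintegral_mono_ae ?_
    rw [ae_restrict_iff' measurableSet_ball]
    filter_upwards [h.ae_le_mol hδ] with y hy hys
    rw [Real.enorm_eq_ofReal (h.nonneg y)]
    have hys' : dist y x < s := hys
    have h1 := hy (R - s) (by linarith [hs.2.trans_le (min_le_right _ _)]) fun z hz => hB (by
      rw [mem_ball] at hz ⊢
      linarith [dist_triangle z y x])
    exact (ENNReal.ofReal_le_ofReal h1).trans
      (hball y (mem_ball.2 (hys'.trans (hs.2.trans_le (min_le_left _ _))))).le
  have heq : upperRep u x = ENNReal.ofReal L := by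
    refine le_antisymm ?_ hlow
    refine ge_of_tendsto ((ENNReal.continuous_ofReal.tendsto L).comp hL) ?_
    filter_upwards [Ioo_mem_nhdsGT hR] with δ hδ using hup δ hδ.1 hδ.2
  have hrep : rep u x = L := by rw [rep, heq, ENNReal.toReal_ofReal hL0]
  rw [hrep]
  exact ⟨heq, hL⟩

lemma rep_le_mol (h : IsSubharmonic D u G) (hD : IsOpen D) {x : 𝔼 d} {R : ℝ} (hB : ball x R ⊆ D)
    {δ : ℝ} (hδ : 0 < δ) (hδR : δ < R) : rep u x ≤ mol δ u x := by
  refine le_of_tendsto (h.tendsto_mol_rep hD (hB (mem_ball_self (hδ.trans hδR)))).2 ?_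
  filter_upwards [Ioo_mem_nhdsGT hδ] with a ha
  exact h.mol_le_mol hB ha.1 ha.2.le hδR

end IsSubharmonic

end subharmonic

/-! ### Estimates for subharmonic functions -/

section estimates

lemma surface_real_univ_pos [NeZero d] : 0 < (surface d).real univ := by
  rw [surface_real_univ]
  exact mul_pos (Nat.cast_pos.2 (Nat.pos_of_ne_zero (NeZero.ne d)))
    (ENNReal.toReal_pos (measure_ball_pos _ _ one_pos).ne' measure_ball_lt_top.ne)

lemma add_smul_sphere_mem_ball {x : 𝔼 d} {r ρ : ℝ} (hr : 0 ≤ r) (hrρ : r < ρ)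
    (s : sphere (0 : 𝔼 d) 1) : x + r • (s : 𝔼 d) ∈ ball x ρ := by
  simpa [norm_smul, abs_of_nonneg hr] using hrρ

lemma ball_add_smul_sphere_subset {x : 𝔼 d} {r R : ℝ} (hr : 0 ≤ r) (s : sphere (0 : 𝔼 d) 1) :
    ball (x + r • (s : 𝔼 d)) (R - r) ⊆ ball x R := by
  intro z hz
  rw [mem_ball] at hz ⊢
  have : dist (x + r • (s : 𝔼 d)) x = r := by simp [norm_smul, abs_of_nonneg hr]
  linarith [dist_triangle z (x + r • (s : 𝔼 d)) x]

/-- Averaging the fundamental theorem of calculus over the radii gives a trace inequality. -/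
lemma sphInt_mul_le [NeZero d] {v : 𝔼 d → ℝ} (hv : ContDiff ℝ 1 v) (x : 𝔼 d) {s : ℝ}
    (hs : 0 ≤ s) :
    sphInt v x s * (s ^ d / d) ≤ (∫ y in ball x s, v y) + s * ∫ y in ball x s, ‖gradient v y‖ := by
  have hg := (continuous_gradient hv).norm
  have hgi : IntegrableOn (fun y => ‖gradient v y‖) (ball x s) :=
    (hg.continuousOn.integrableOn_compact (isCompact_closedBall x s)).mono_set ball_subset_closedBall
  rw [integral_ball_eq hv.continuous x hs, mul_comm, ← integral_pow_pred,
    ← intervalIntegral.integral_mul_const]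
  have e : s * ∫ y in ball x s, ‖gradient v y‖ =
      ∫ t in (0 : ℝ)..s, ∫ y in ball x s, ‖gradient v y‖ := by
    simp
  have hc : Continuous fun t : ℝ => t ^ (d - 1) * sphInt v x t :=
    (continuous_pow _).mul (continuous_sphInt hv.continuous x)
  rw [e, ← intervalIntegral.integral_add (hc.intervalIntegrable _ _)
    (continuous_const.intervalIntegrable _ _)]
  rw [intervalIntegral.integral_of_le hs, intervalIntegral.integral_of_le hs]
  refine setIntegral_mono_on ?_ ?_ measurableSet_Ioc fun t ht => ?_
  · exact (Continuous.intervalIntegrable (by fun_prop) 0 s).1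
  · exact ((hc.add continuous_const).intervalIntegrable 0 s).1
  · have h1 := sphInt_le_add_gradient hv x ht.1 ht.2
    have hpos : 0 < t ^ (d - 1) := pow_pos ht.1 _
    have h2 : ∫ y in ball x s \ ball x t, ‖gradient v y‖ ≤ ∫ y in ball x s, ‖gradient v y‖ :=
      setIntegral_mono_set hgi (Eventually.of_forall fun y => norm_nonneg _)
        sdiff_subset.eventuallyLE
    calc t ^ (d - 1) * sphInt v x s
        ≤ t ^ (d - 1) * (sphInt v x t +
          (t ^ (d - 1))⁻¹ * ∫ y in ball x s \ ball x t, ‖gradient v y‖) := by gcongr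
      _ = t ^ (d - 1) * sphInt v x t + ∫ y in ball x s \ ball x t, ‖gradient v y‖ := by
          field_simp
      _ ≤ _ := by gcongr

namespace IsSubharmonic

variable [NeZero d] {D : Set (𝔼 d)} {u : 𝔼 d → ℝ} {G : 𝔼 d → 𝔼 d} {x : 𝔼 d} {r R : ℝ}

lemma mol_sphere_le (h : IsSubharmonic D u G) (hB : ball x R ⊆ D) (hr : 0 ≤ r)
    {a b : ℝ} (ha : 0 < a) (hab : a ≤ b) (hb : b < R - r) (s : sphere (0 : 𝔼 d) 1) :
    mol a u (x + r • (s : 𝔼 d)) ≤ mol b u (x + r • (s : 𝔼 d)) :=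
  h.mol_le_mol ((ball_add_smul_sphere_subset hr s).trans hB) ha hab hb

lemma tendsto_mol_sphere (h : IsSubharmonic D u G) (hD : IsOpen D) (hB : ball x R ⊆ D)
    (hr : 0 ≤ r) (hrR : r < R) (s : sphere (0 : 𝔼 d) 1) :
    Tendsto (fun n => mol (scale n) u (x + r • (s : 𝔼 d))) atTop
      (𝓝 (rep u (x + r • (s : 𝔼 d)))) :=
  (h.tendsto_mol_rep hD (hB (add_smul_sphere_mem_ball hr hrR s))).2.comp tendsto_scale_nhdsGT

lemma integrable_rep_sphere (h : IsSubharmonic D u G) (hD : IsOpen D) (hB : ball x R ⊆ D)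
    (hr : 0 ≤ r) (hrR : r < R) :
    Integrable (fun s : sphere (0 : 𝔼 d) 1 => rep u (x + r • (s : 𝔼 d))) (surface d) := by
  have hδ : 0 < (R - r) / 2 := by linarith
  refine (integrable_sphere (h.contDiff_mol hδ).continuous x r).mono
    (aestronglyMeasurable_of_tendsto_ae atTop (fun n =>
      (integrable_sphere (h.contDiff_mol (scale_pos n)).continuous x r).1)
      (Eventually.of_forall (h.tendsto_mol_sphere hD hB hr hrR))) (Eventually.of_forall fun s => ?_)
  rw [Real.norm_of_nonneg (rep_nonneg _ _), Real.norm_of_nonneg (mol_nonneg h.nonneg _ _)]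
  exact h.rep_le_mol hD ((ball_add_smul_sphere_subset hr s).trans hB) hδ (by linarith)

lemma tendsto_sphInt (h : IsSubharmonic D u G) (hD : IsOpen D) (hB : ball x R ⊆ D)
    (hr : 0 ≤ r) (hrR : r < R) :
    Tendsto (fun n => sphInt (mol (scale n) u) x r) atTop (𝓝 (sphInt (rep u) x r)) := by
  have hδ : 0 < (R - r) / 2 := by linarith
  refine tendsto_integral_filter_of_dominated_convergence
    (fun s : sphere (0 : 𝔼 d) 1 => mol ((R - r) / 2) u (x + r • (s : 𝔼 d))) ?_ ?_
    (integrable_sphere (h.contDiff_mol hδ).continuous x r)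
    (Eventually.of_forall (h.tendsto_mol_sphere hD hB hr hrR))
  · exact Eventually.of_forall fun n =>
      (integrable_sphere (h.contDiff_mol (scale_pos n)).continuous x r).1
  · filter_upwards [tendsto_scale.eventually_lt_const hδ] with n hn
    refine Eventually.of_forall fun s => ?_
    rw [Real.norm_of_nonneg (mol_nonneg h.nonneg _ _)]
    exact h.mol_sphere_le hB hr (scale_pos n) hn.le (by linarith) s

lemma lintegral_sphere (h : IsSubharmonic D u G) (hD : IsOpen D) (hB : ball x R ⊆ D)
    (hr : 0 ≤ r) (hrR : r < R) :
    ∫⁻ s : sphere (0 : 𝔼 d) 1, upperRep u (x + r • (s : 𝔼 d)) ∂surface d =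
      ENNReal.ofReal (sphInt (rep u) x r) := by
  rw [sphInt, ofReal_integral_eq_lintegral_ofReal (h.integrable_rep_sphere hD hB hr hrR)
    (Eventually.of_forall fun s => rep_nonneg _ _)]
  exact lintegral_congr fun s =>
    (h.tendsto_mol_rep hD (hB (add_smul_sphere_mem_ball hr hrR s))).1

lemma tendsto_setIntegral_gradient (h : IsSubharmonic D u G) (hB : ball x R ⊆ D) (hrR : r < R)
    {A : Set (𝔼 d)} (hA : MeasurableSet A) (hAr : A ⊆ ball x r) :
    Tendsto (fun n => ∫ y in A, ‖gradient (mol (scale n) u) y‖) atTop (𝓝 (∫ y in A, ‖G y‖)) := by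
  refine (tendsto_setIntegral_norm h.memLp_grad
    (fun n => memLp_two_mol h.memLp_grad (scale_pos n)) (tendsto_mol_scale h.memLp_grad) hA
    ((measure_mono hAr).trans_lt measure_ball_lt_top).ne).congr' ?_
  filter_upwards [tendsto_scale.eventually_lt_const (sub_pos.2 hrR)] with n hn
  refine setIntegral_congr_fun hA fun y hy => ?_
  simp only [h.gradient_mol (R := r) (scale_pos n)
    ((ball_subset_ball (by linarith)).trans hB) (hAr hy)]

/-- The gradient bound `sphInt_le_add_gradient` for the canonical representative. -/
lemma sphInt_rep_le_add (h : IsSubharmonic D u G) (hD : IsOpen D) (hB : ball x R ⊆ D)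
    {ρ : ℝ} (hρ : 0 < ρ) (hρr : ρ ≤ r) (hrR : r < R) :
    sphInt (rep u) x r ≤ sphInt (rep u) x ρ +
      (ρ ^ (d - 1))⁻¹ * ∫ y in ball x r \ ball x ρ, ‖G y‖ := by
  refine le_of_tendsto_of_tendsto' (h.tendsto_sphInt hD hB (hρ.le.trans hρr) hrR)
    ((h.tendsto_sphInt hD hB hρ.le (hρr.trans_lt hrR)).add
      ((h.tendsto_setIntegral_gradient hB hrR (measurableSet_ball.diff measurableSet_ball)
        sdiff_subset).const_mul _)) fun n => ?_
  exact sphInt_le_add_gradient (h.contDiff_mol (scale_pos n)) x hρ hρr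

lemma sphInt_rep_mul_le (h : IsSubharmonic D u G) (hD : IsOpen D) (hB : ball x R ⊆ D)
    (hr : 0 ≤ r) (hrR : r < R) :
    sphInt (rep u) x r * (r ^ d / d) ≤ (∫ y in ball x r, u y) + r * ∫ y in ball x r, ‖G y‖ := by
  refine le_of_tendsto_of_tendsto' ((h.tendsto_sphInt hD hB hr hrR).mul_const _)
    ((h.tendsto_setIntegral measurableSet_ball measure_ball_lt_top.ne).add
      ((h.tendsto_setIntegral_gradient hB hrR measurableSet_ball subset_rfl).const_mul _))
    fun n => ?_
  exact sphInt_mul_le (h.contDiff_mol (scale_pos n)) x hr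

/-- A subharmonic function is bounded on a ball by its mean over a concentric sphere. -/
lemma ae_le_sphInt (h : IsSubharmonic D u G) (hD : IsOpen D) (hB : ball x R ⊆ D)
    (hr : 0 < r) (hrR : r < R) :
    ∀ᵐ y, y ∈ ball x (r / 2) → u y ≤ 2 ^ d / (surface d).real univ * sphInt (rep u) x r := by
  obtain ⟨ns, hns, hae⟩ := exists_subseq_mol_ae h.memLp
  filter_upwards [hae] with y hy hyr
  rw [mem_ball] at hyr
  refine le_of_tendsto_of_tendsto hy (((h.tendsto_sphInt hD hB hr.le hrR).comp
    hns.tendsto_atTop).const_mul _) ?_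
  filter_upwards [(tendsto_scale.comp hns.tendsto_atTop).eventually_lt_const (sub_pos.2 hrR)]
    with n hn
  simp only [Function.comp] at hn ⊢
  generalize ns n = m at hn
  have hcd := h.contDiff_mol (scale_pos m)
  have hball : ball y (r / 2) ⊆ ball x r := ball_subset_ball' (by linarith)
  have hr2 : 0 < r / 2 := by linarith
  have h1 := mul_le_integral_ball (x := y) (R := R - scale m - r / 2) hcd
    (h.weaklySubharmonic_mol (scale_pos m)
      ((ball_subset_ball' (by linarith)).trans hB)) hr2.le (by linarith)
  have h2 : ∫ z in ball y (r / 2), mol (scale m) u z ≤ ∫ z in ball x r, mol (scale m) u z :=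
    setIntegral_mono_set ((hcd.continuous.continuousOn.integrableOn_compact
      (isCompact_closedBall x r)).mono_set ball_subset_closedBall)
      (Eventually.of_forall fun z => mol_nonneg h.nonneg _ _) hball.eventuallyLE
  have h3 := integral_ball_le (x := x) (R := R - scale m) hcd
    (h.weaklySubharmonic_mol (scale_pos m) (by simpa using hB)) hr.le (by linarith)
  have h4 := (h1.trans h2).trans h3
  have hω : 0 < volume.real (ball (0 : 𝔼 d) 1) :=
    ENNReal.toReal_pos (measure_ball_pos _ _ one_pos).ne' measure_ball_lt_top.ne
  have hd : (0 : ℝ) < d := Nat.cast_pos.2 (Nat.pos_of_ne_zero (NeZero.ne d))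
  rw [volume_real_ball_eq y hr2.le] at h4
  rw [surface_real_univ]
  have hrd : 0 < r ^ d := pow_pos hr d
  rw [div_pow] at h4
  rw [div_mul_eq_mul_div, le_div_iff₀ (mul_pos hd hω)]
  have e : r ^ d / 2 ^ d * volume.real (ball (0 : 𝔼 d) 1) * mol (scale m) u y =
      (r ^ d / (2 ^ d * d)) * (mol (scale m) u y * (d * volume.real (ball (0 : 𝔼 d) 1))) := by
    field_simp
  have e' : r ^ d / d * sphInt (mol (scale m) u) x r =
      (r ^ d / (2 ^ d * d)) * (2 ^ d * sphInt (mol (scale m) u) x r) := by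
    field_simp
  rw [e, e'] at h4
  exact le_of_mul_le_mul_left h4 (by positivity)

/-- A subharmonic function is locally bounded above, being dominated by a mollification. -/
lemma exists_ae_le (h : IsSubharmonic D u G) (hB : ball x R ⊆ D) (hrR : r < R) :
    ∃ M, ∀ᵐ y, y ∈ ball x r → u y ≤ M := by
  have hδ : 0 < (R - r) / 2 := by linarith
  obtain ⟨M, hM⟩ := (isCompact_closedBall x r).exists_bound_of_continuousOn
    (h.contDiff_mol hδ).continuous.continuousOn
  refine ⟨M, ?_⟩
  filter_upwards [h.ae_le_mol hδ] with y hy hyr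
  refine (hy (R - r) (by linarith) ((ball_subset_ball' ?_).trans hB)).trans
    ((le_abs_self _).trans (hM y (ball_subset_closedBall hyr)))
  have : dist y x < r := hyr
  linarith

/-- An almost everywhere bound in the open ball bounds the spherical mean of the representative over the
boundary sphere, although that sphere is a null set. -/
lemma sphInt_rep_le (h : IsSubharmonic D u G) (hD : IsOpen D) (hB : ball x R ⊆ D)
    (hr : 0 < r) (hrR : r < R) {M : ℝ} (hM : ∀ᵐ y, y ∈ ball x r → u y ≤ M) :
    sphInt (rep u) x r ≤ (surface d).real univ * M := by
  have hρ : ∀ ρ, 0 < ρ → ρ < r → sphInt (rep u) x ρ ≤ (surface d).real univ * M := by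
    intro ρ hρ0 hρr
    refine le_of_tendsto (h.tendsto_sphInt hD hB hρ0.le (hρr.trans hrR)) ?_
    filter_upwards [tendsto_scale.eventually_lt_const (sub_pos.2 hρr)] with n hn
    have : (surface d).real univ * M = ∫ s : sphere (0 : 𝔼 d) 1, M ∂surface d := by simp
    rw [this]
    refine integral_mono (integrable_sphere (h.contDiff_mol (scale_pos n)).continuous x ρ)
      (integrable_const _) fun s => ?_
    have : M = ∫ y, M ∂molMeasure d := by simp
    simp only
    rw [this]
    refine integral_mono_ae (integrable_mol h.memLp _ (scale_pos n).ne') (integrable_const _) ?_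
    filter_upwards [ae_comp_sub_smul hM (x + ρ • (s : 𝔼 d)) (scale_pos n).ne',
      ae_molMeasure_norm_lt] with y hy1 hy2
    refine hy1 (ball_add_smul_sphere_subset hρ0.le s (mem_ball.2 ?_))
    rw [dist_eq_norm, sub_sub_cancel_left, norm_neg, norm_smul, Real.norm_eq_abs,
      abs_of_pos (scale_pos n)]
    exact (mul_le_of_le_one_right (scale_pos n).le hy2.le).trans_lt hn
  have hi : IntegrableOn (fun y => ‖G y‖) (ball x r) :=
    have : IsFiniteMeasure ((volume : Measure (𝔼 d)).restrict (ball x r)) :=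
      isFiniteMeasure_restrict.2 measure_ball_lt_top.ne
    ((h.memLp_grad.restrict _).integrable (by norm_num)).norm
  have hlim : Tendsto (fun n => ∫ y in ball x r \ ball x (r - r / 2 * scale n), ‖G y‖) atTop
      (𝓝 0) := by
    have hempty : ⋂ n, (ball x r \ ball x (r - r / 2 * scale n)) = ∅ := by
      refine eq_empty_of_forall_notMem fun y hy => ?_
      rw [mem_iInter] at hy
      have hyr : dist y x < r := (hy 0).1
      have h1 : Tendsto (fun n => r - r / 2 * scale n) atTop (𝓝 r) := by
        simpa using (tendsto_scale.const_mul (r / 2)).const_sub r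
      obtain ⟨n, hn⟩ := (h1.eventually_const_lt hyr).exists
      exact (hy n).2 hn
    have := tendsto_setIntegral_of_antitone (μ := volume) (f := fun y => ‖G y‖)
      (s := fun n => ball x r \ ball x (r - r / 2 * scale n))
      (fun n => measurableSet_ball.diff measurableSet_ball) (fun m n hmn => by
        refine sdiff_subset_sdiff_right (ball_subset_ball ?_)
        have : scale n ≤ scale m := by
          simp only [scale]
          gcongr
        nlinarith) ⟨0, hi.mono_set sdiff_subset⟩
    rwa [hempty, setIntegral_empty] at this
  have hlim2 := (hlim.const_mul ((r / 2) ^ (d - 1))⁻¹).const_add ((surface d).real univ * M)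
  rw [mul_zero, add_zero] at hlim2
  refine ge_of_tendsto hlim2 (Eventually.of_forall fun n => ?_)
  have hn0 : 0 < r / 2 * scale n := mul_pos (by linarith) (scale_pos n)
  have hn1 : r / 2 * scale n ≤ r / 2 := mul_le_of_le_one_right (by linarith) (scale_le_one n)
  refine (h.sphInt_rep_le_add hD hB (ρ := r - r / 2 * scale n) (by linarith) (by linarith)
    hrR).trans (add_le_add (hρ _ (by linarith) (by linarith)) ?_)
  refine mul_le_mul_of_nonneg_right ?_ (integral_nonneg fun y => norm_nonneg _)
  have : r / 2 ≤ r - r / 2 * scale n := by linarith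
  have h2 : 0 < r / 2 := by linarith
  gcongr

end IsSubharmonic

end estimates

/-! ### The radial barrier -/

section barrier

variable (d) in
/-- The normalizing constant of the barrier. -/
noncomputable def barrierConst : ℝ := Real.exp (-d) - Real.exp (-(9 / 4 * d))

variable (d) in
/-- The radial barrier `w(z) = barrier (|z - x|²)`: it is negative in `B_r(x)`, vanishes on the
sphere of radius `r`, and is at least `M` outside `B_{3r/2}(x)`. -/
noncomputable def barrier (M r q : ℝ) : ℝ :=
  M * (Real.exp (-d) - Real.exp (-(d / r ^ 2 * q))) / barrierConst d

variable (d) in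
/-- The gradient of the barrier is `barrierSlope (|z - x|²) (z - x)`. -/
noncomputable def barrierSlope (M r q : ℝ) : ℝ :=
  2 * (M * (d / r ^ 2 * Real.exp (-(d / r ^ 2 * q))) / barrierConst d)

variable {M r : ℝ}

lemma barrierConst_pos [NeZero d] : 0 < barrierConst d := by
  have hd : (0 : ℝ) < d := Nat.cast_pos.2 (Nat.pos_of_ne_zero (NeZero.ne d))
  exact sub_pos.2 (Real.exp_lt_exp.2 (by linarith))

lemma contDiff_barrier : ContDiff ℝ 1 (barrier d M r) := by
  unfold barrier
  fun_prop

lemma continuous_barrierSlope : Continuous (barrierSlope d M r) := by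
  unfold barrierSlope
  fun_prop

lemma hasDerivAt_exp_neg_mul (a q : ℝ) :
    HasDerivAt (fun q => Real.exp (-(a * q))) (-(a * Real.exp (-(a * q)))) q := by
  have := (((hasDerivAt_id q).const_mul a).neg).exp
  refine this.congr_deriv ?_
  change Real.exp (-(a * q)) * -(a * 1) = _
  ring

lemma deriv_barrier (q : ℝ) : 2 * deriv (barrier d M r) q = barrierSlope d M r q := by
  have h := (((hasDerivAt_exp_neg_mul (d / r ^ 2) q).const_sub (Real.exp (-d))).const_mul
    M).div_const (barrierConst d)
  have h' : deriv (barrier d M r) q = _ := h.deriv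
  rw [h', barrierSlope, neg_neg]

lemma barrier_nonpos [NeZero d] (hM : 0 ≤ M) (hr : 0 < r) {q : ℝ} (hq : q ≤ r ^ 2) :
    barrier d M r q ≤ 0 := by
  refine div_nonpos_of_nonpos_of_nonneg (mul_nonpos_of_nonneg_of_nonpos hM ?_) barrierConst_pos.le
  refine sub_nonpos.2 (Real.exp_le_exp.2 (neg_le_neg ?_))
  rw [div_mul_eq_mul_div, div_le_iff₀ (by positivity)]
  gcongr

lemma barrier_pos [NeZero d] (hM : 0 < M) (hr : 0 < r) {q : ℝ} (hq : r ^ 2 < q) :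
    0 < barrier d M r q := by
  have hd : (0 : ℝ) < d := Nat.cast_pos.2 (Nat.pos_of_ne_zero (NeZero.ne d))
  refine div_pos (mul_pos hM ?_) barrierConst_pos
  refine sub_pos.2 (Real.exp_lt_exp.2 (neg_lt_neg ?_))
  rw [div_mul_eq_mul_div, lt_div_iff₀ (by positivity)]
  gcongr

lemma le_barrier [NeZero d] (hM : 0 ≤ M) (hr : 0 < r) {q : ℝ} (hq : (3 / 2 * r) ^ 2 ≤ q) :
    M ≤ barrier d M r q := by
  rw [barrier, mul_div_assoc]
  refine le_mul_of_one_le_right hM ?_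
  rw [one_le_div barrierConst_pos, barrierConst]
  refine sub_le_sub_left (Real.exp_le_exp.2 (neg_le_neg ?_)) _
  rw [div_mul_eq_mul_div (d : ℝ), le_div_iff₀ (by positivity)]
  have hd : (0 : ℝ) ≤ d := Nat.cast_nonneg d
  nlinarith

lemma barrierSlope_nonneg [NeZero d] (hM : 0 ≤ M) (q : ℝ) : 0 ≤ barrierSlope d M r q := by
  have := (barrierConst_pos (d := d)).le
  unfold barrierSlope
  positivity

/-- The flux of the barrier through spheres. -/
lemma hasDerivAt_barrier_flux [NeZero d] (hr : r ≠ 0) (t : ℝ) :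
    HasDerivAt (fun t => t ^ d * barrierSlope d M r (t ^ 2))
      (d * t ^ (d - 1) * (1 - 2 * (t / r) ^ 2) * barrierSlope d M r (t ^ 2)) t := by
  have h1 := (hasDerivAt_exp_neg_mul (d / r ^ 2) (t ^ 2)).comp t (hasDerivAt_pow 2 t)
  have h2 := ((((h1.const_mul ((d : ℝ) / r ^ 2)).const_mul M).div_const (barrierConst d)).const_mul 2)
  have h3 := (hasDerivAt_pow d t).mul h2
  refine h3.congr_deriv ?_
  have e : t ^ d = t ^ (d - 1) * t := by rw [← pow_succ, Nat.sub_add_cancel NeZero.one_le]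
  simp only [Function.comp, barrierSlope, e]
  have := (barrierConst_pos (d := d)).ne'
  field_simp
  push_cast
  ring

end barrier

/-! ### Cutting off the modulus below the barrier -/

section cutoff

variable {ι : Type*} [Fintype ι] [DecidableEq ι]

lemma sum_dirDeriv_smul (y : ι → ℝ) (v : ι → 𝔼 d) (b : ℝ) (i : ι) (hy : √(∑ i, y i ^ 2) ≠ 0) :
    ∑ j, (b * dirDeriv 0 i j y) • v j = (b / √(∑ i, y i ^ 2)) •
      (v i - (y i / √(∑ i, y i ^ 2)) • ∑ j, (y j / √(∑ i, y i ^ 2)) • v j) := by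
  have hq : regNorm 0 y = √(∑ i, y i ^ 2) := by simp [regNorm]
  set N := √(∑ i, y i ^ 2)
  simp only [dirDeriv, hq, mul_sub, sub_smul, Finset.sum_sub_distrib, smul_sub, Finset.smul_sum,
    smul_smul]
  congr 1
  · rw [Finset.sum_eq_single i]
    · rw [if_pos rfl]
      congr 1
      ring
    · intro l _ hl
      simp [hl.symm]
    · simp
  · refine Finset.sum_congr rfl fun j _ => ?_
    congr 1
    field_simp

/-- The Dirichlet energy of `(1 - b/|V|) V` is at most that of `V`, up to the energy of the change
`|V| ↦ |V| - b` of the modulus. -/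
lemma sum_norm_sq_sub_le (y : ι → ℝ) (v : ι → 𝔼 d) {b : ℝ} (w : 𝔼 d) (hb0 : 0 ≤ b)
    (hb : b ≤ √(∑ i, y i ^ 2)) :
    ∑ i, ‖v i - ((y i / √(∑ i, y i ^ 2)) • w + ∑ j, (b * dirDeriv 0 i j y) • v j)‖ ^ 2 ≤
      ∑ i, ‖v i‖ ^ 2 + (‖w‖ ^ 2 - 2 * inner ℝ (∑ i, (y i / √(∑ i, y i ^ 2)) • v i) w) := by
  by_cases hN : √(∑ i, y i ^ 2) = 0
  · have hb' : b = 0 := le_antisymm (hb.trans hN.le) hb0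
    simp [hN, hb', sq_nonneg]
  simp only [sum_dirDeriv_smul y v b _ hN]
  have hN2 : √(∑ i, y i ^ 2) ^ 2 = ∑ i, y i ^ 2 :=
    Real.sq_sqrt (Finset.sum_nonneg fun i _ => sq_nonneg _)
  have hNpos : 0 < √(∑ i, y i ^ 2) := lt_of_le_of_ne (Real.sqrt_nonneg _) (Ne.symm hN)
  have hη1 : b / √(∑ i, y i ^ 2) ≤ 1 := (div_le_one hNpos).2 hb
  have hη0 : 0 ≤ b / √(∑ i, y i ^ 2) := div_nonneg hb0 hNpos.le
  generalize √(∑ i, y i ^ 2) = N at *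
  set e : ι → ℝ := fun i => y i / N with he
  set m := ∑ j, e j • v j with hm
  set η := 1 - b / N with hη
  have hsum : ∑ i, e i ^ 2 = 1 := by
    simp only [he, div_pow, ← Finset.sum_div, ← hN2]
    exact div_self (pow_ne_zero 2 hN)
  have hcross : ∑ i, e i * inner ℝ (v i - e i • m) (m - w) = 0 := by
    have : ∑ i, e i • (v i - e i • m) = 0 := by
      simp only [smul_sub, smul_smul, Finset.sum_sub_distrib, ← Finset.sum_smul, ← pow_two, hsum,
        one_smul]
      rw [← hm, sub_self]
    simp only [← real_inner_smul_left, ← sum_inner, this, inner_zero_left]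
  have hpyth : ∑ i, ‖v i - e i • m‖ ^ 2 = ∑ i, ‖v i‖ ^ 2 - ‖m‖ ^ 2 := by
    have h1 : ∀ i, ‖v i - e i • m‖ ^ 2 =
        ‖v i‖ ^ 2 - 2 * inner ℝ (e i • v i) m + e i ^ 2 * ‖m‖ ^ 2 := fun i => by
      rw [norm_sub_sq_real, norm_smul, mul_pow, Real.norm_eq_abs, sq_abs, real_inner_smul_right,
        real_inner_smul_left]
    simp only [h1, Finset.sum_add_distrib, Finset.sum_sub_distrib, ← Finset.mul_sum, ← sum_inner,
      ← Finset.sum_mul, hsum]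
    rw [← hm, real_inner_self_eq_norm_sq]
    ring
  have h2 : ∀ i, ‖v i - (e i • w + (b / N) • (v i - e i • m))‖ ^ 2 =
      η ^ 2 * ‖v i - e i • m‖ ^ 2 + 2 * η * (e i * inner ℝ (v i - e i • m) (m - w)) +
        e i ^ 2 * ‖m - w‖ ^ 2 := fun i => by
    have : v i - (e i • w + (b / N) • (v i - e i • m)) =
        η • (v i - e i • m) + e i • (m - w) := by
      simp only [hη, sub_smul, one_smul, smul_sub]
      abel
    rw [this, norm_add_sq_real, norm_smul, norm_smul, mul_pow, mul_pow, Real.norm_eq_abs,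
      Real.norm_eq_abs, sq_abs, sq_abs, real_inner_smul_right, real_inner_smul_left]
    ring
  change ∑ i, ‖v i - (e i • w + (b / N) • (v i - e i • m))‖ ^ 2 ≤ _
  simp only [h2, Finset.sum_add_distrib, ← Finset.mul_sum, ← Finset.sum_mul, hsum, hcross, hpyth]
  have h3 : 0 ≤ ∑ i, ‖v i‖ ^ 2 - ‖m‖ ^ 2 := hpyth ▸ Finset.sum_nonneg fun i _ => sq_nonneg _
  have h4 : η ^ 2 ≤ 1 := by
    have : 0 ≤ η := by linarith
    have : η ≤ 1 := by linarith
    nlinarith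
  rw [norm_sub_sq_real]
  nlinarith [mul_le_mul_of_nonneg_right h4 h3]

lemma gradient_barrier {x : 𝔼 d} {M r : ℝ} (z w : 𝔼 d) :
    inner ℝ w (gradient (fun z => barrier d M r (‖z - x‖ ^ 2)) z) =
      barrierSlope d M r (‖z - x‖ ^ 2) * inner ℝ w (z - x) := by
  rw [inner_gradient_radial (contDiff_barrier.differentiable (by simp)), deriv_barrier]

/-- The part `b` of `|V|` above the barrier. -/
lemma exists_cutoff [NeZero d] {V : ι → 𝔼 d → ℝ} {G : ι → 𝔼 d → 𝔼 d} {x : 𝔼 d} {r M : ℝ}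
    (hr : 0 < r) (hM : 0 ≤ M) (hV : ∀ i, MemLp (V i) 2 (volume.restrict (ball x (2 * r))))
    (hG : ∀ i, IsWeakGrad (ball x (2 * r)) (V i) (G i))
    (hVM : ∀ᵐ y ∂(volume.restrict (ball x (2 * r))), √(∑ i, V i y ^ 2) ≤ M) :
    ∃ (b : 𝔼 d → ℝ) (Gb : 𝔼 d → 𝔼 d), (∀ y, 0 ≤ b y) ∧ (∀ y, b y ≤ √(∑ i, V i y ^ 2)) ∧
      MemLp b 2 (volume.restrict (ball x (2 * r))) ∧ IsWeakGrad (ball x (2 * r)) b Gb ∧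
      (∀ y ∈ ball x r, b y = √(∑ i, V i y ^ 2)) ∧
      (∀ᵐ y ∂(volume.restrict (ball x (2 * r))), y ∉ closedBall x (3 / 2 * r) → b y = 0) ∧
      (∀ᵐ y ∂(volume.restrict (ball x (2 * r))), y ∉ ball x r →
        ‖Gb y‖ ^ 2 - 2 * inner ℝ (∑ i, (V i y / √(∑ i, V i y ^ 2)) • G i y) (Gb y) ≤
          -(2 * (barrierSlope d M r (‖y - x‖ ^ 2) * inner ℝ (Gb y) (y - x)))) := by
  have hBv : volume (ball x (2 * r)) ≠ ⊤ := measure_ball_lt_top.ne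
  have : IsFiniteMeasure ((volume : Measure (𝔼 d)).restrict (ball x (2 * r))) :=
    isFiniteMeasure_restrict.2 hBv
  set w : 𝔼 d → ℝ := fun z => barrier d M r (‖z - x‖ ^ 2) with hw
  have cw : ContDiff ℝ 1 w :=
    contDiff_barrier.comp ((contDiff_norm_sq ℝ).comp (contDiff_id.sub contDiff_const))
  have memLp_of_cont : ∀ {F : Type} [NormedAddCommGroup F] {f : 𝔼 d → F}, Continuous f →
      AEStronglyMeasurable f volume → MemLp f 2 (volume.restrict (ball x (2 * r))) := by
    intro F _ f hf hfm
    obtain ⟨C, hC⟩ := (isCompact_closedBall x (2 * r)).exists_bound_of_continuousOn hf.continuousOn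
    refine MemLp.of_bound hfm.restrict C ?_
    filter_upwards [ae_restrict_mem measurableSet_ball] with y hy
    exact hC y (ball_subset_closedBall hy)
  have mw : MemLp w 2 (volume.restrict (ball x (2 * r))) :=
    memLp_of_cont cw.continuous cw.continuous.aestronglyMeasurable
  have cgw := continuous_gradient cw
  have mgw : MemLp (gradient w) 2 (volume.restrict (ball x (2 * r))) :=
    memLp_of_cont cgw cgw.aestronglyMeasurable
  have hw' : IsWeakGrad (ball x (2 * r)) w (gradient w) := ContDiff.isWeakGrad cw mgw
  obtain ⟨mp, hp⟩ := IsWeakGrad.posPart isOpen_ball hBv mw hw'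
  obtain ⟨mN, hN⟩ := IsWeakGrad.modulus isOpen_ball hBv hV hG
  obtain ⟨mb, hb⟩ := IsWeakGrad.posPart isOpen_ball hBv (mN.sub mp) (hN.sub hp mN mp)
  refine ⟨_, _, fun y => le_max_right _ _, fun y => max_le ?_ (Real.sqrt_nonneg _), mb, hb, ?_, ?_, ?_⟩
  · simp only [Pi.sub_apply]
    linarith [le_max_right (w y) 0]
  · intro y hy
    have hy' : ‖y - x‖ < r := by rwa [mem_ball, dist_eq_norm] at hy
    have : w y ≤ 0 := barrier_nonpos hM hr (by gcongr)
    simp only [Pi.sub_apply, max_eq_right this, sub_zero]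
    exact max_eq_left (Real.sqrt_nonneg _)
  · filter_upwards [hVM] with y hy hyK
    rw [mem_closedBall, dist_eq_norm, not_le] at hyK
    have : M ≤ w y := le_barrier hM hr (by gcongr)
    simp only [Pi.sub_apply]
    refine max_eq_right ?_
    linarith [le_max_left (w y) 0]
  · have hsph : ∀ᵐ y ∂(volume.restrict (ball x (2 * r))), y ∉ sphere x r :=
      ae_restrict_of_ae (measure_eq_zero_iff_ae_notMem.1 (Measure.addHaar_sphere volume x r))
    filter_upwards [hsph] with y hy hyr
    rw [← gradient_barrier]
    have hpos : ((1 + w y / |w y|) / 2) • gradient w y = gradient w y := by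
      rcases hM.eq_or_lt with h0 | h0
      · have : gradient w y = 0 := by
          refine ext_inner_left ℝ fun v => ?_
          rw [hw, gradient_barrier, barrierSlope, ← h0]
          simp
        rw [this, smul_zero]
      · have hlt : r < ‖y - x‖ := by
          rw [mem_ball, dist_eq_norm, not_lt] at hyr
          rw [mem_sphere, dist_eq_norm] at hy
          exact lt_of_le_of_ne hyr (Ne.symm hy)
        have : 0 < w y := barrier_pos h0 hr (by gcongr)
        rw [abs_of_pos this, div_self this.ne']
        norm_num
    simp only [Pi.sub_apply, hpos]
    set a := ∑ i, (V i y / √(∑ i, V i y ^ 2)) • G i y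
    set s := √(∑ i, V i y ^ 2) - max (w y) 0
    have hθ : 0 ≤ (1 + s / |s|) / 2 ∧ (1 + s / |s|) / 2 ≤ 1 := by
      rcases lt_trichotomy s 0 with h | h | h
      · rw [abs_of_neg h, div_neg, div_self h.ne]; norm_num
      · rw [h]; norm_num
      · rw [abs_of_pos h, div_self h.ne']; norm_num
    generalize (1 + s / |s|) / 2 = θ at hθ
    generalize gradient w y = g
    rw [norm_smul, mul_pow, Real.norm_eq_abs, sq_abs, real_inner_smul_right, real_inner_smul_left]
    have e1 : ‖a - g‖ ^ 2 = inner ℝ a (a - g) - inner ℝ (a - g) g := by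
      rw [← real_inner_self_eq_norm_sq, inner_sub_left, real_inner_comm g (a - g)]
    have e2 : 0 ≤ ‖a - g‖ ^ 2 := sq_nonneg _
    have e3 : 0 ≤ θ * (1 - θ) * ‖a - g‖ ^ 2 := mul_nonneg (mul_nonneg hθ.1 (by linarith [hθ.2])) e2
    have e4 : 0 ≤ θ * ‖a - g‖ ^ 2 := mul_nonneg hθ.1 e2
    change θ ^ 2 * ‖a - g‖ ^ 2 - 2 * (θ * inner ℝ a (a - g)) ≤ -(2 * (θ * inner ℝ (a - g) g))
    nlinarith

end cutoff

/-! ### The energy estimate on balls -/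

section energy

/-- The flux of the barrier against a function `0 ≤ b ≤ u` with compact support in `B_{2r}(x)` is
controlled by the mean of `u` over `∂B_r(x)`. -/
lemma IsSubharmonic.neg_integral_barrier_le [NeZero d] {D : Set (𝔼 d)} {u : 𝔼 d → ℝ}
    {G : 𝔼 d → 𝔼 d} (h : IsSubharmonic D u G) (hD : IsOpen D) {x : 𝔼 d} {r R M : ℝ}
    (hB : ball x R ⊆ D) (hr : 0 < r) (hrR : 2 * r < R) (hM : 0 ≤ M) {b : 𝔼 d → ℝ} {Gb : 𝔼 d → 𝔼 d}
    (hb0 : ∀ y, 0 ≤ b y) (mb : MemLp b 2 (volume.restrict (ball x (2 * r))))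
    (hb : IsWeakGrad (ball x (2 * r)) b Gb)
    (hbu : ∀ y ∈ ball x (2 * r), b y ≤ u y)
    (hbK : ∀ᵐ y ∂(volume.restrict (ball x (2 * r))), y ∉ closedBall x (3 / 2 * r) → b y = 0) :
    -∫ z in ball x (2 * r) \ ball x r,
        barrierSlope d M r (‖z - x‖ ^ 2) * inner ℝ (Gb z) (z - x) ≤
      r ^ d * barrierSlope d M r (r ^ 2) * sphInt (rep u) x r := by
  set K := closedBall x (3 / 2 * r) with hK
  set A := ball x (2 * r) \ ball x r with hA
  have hAm : MeasurableSet A := measurableSet_ball.diff measurableSet_ball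
  have hKB : K ⊆ ball x (2 * r) := closedBall_subset_ball (by linarith)
  have hKm : MeasurableSet K := measurableSet_closedBall
  -- extension of `b` by zero
  have hbe : b =ᵐ[volume.restrict (ball x (2 * r))] K.indicator b := by
    filter_upwards [hbK] with y hy
    by_cases hyK : y ∈ K
    · rw [indicator_of_mem hyK]
    · rw [indicator_of_notMem hyK, hy hyK]
  have hext : IsWeakGrad univ (K.indicator b) (K.indicator Gb) :=
    (hb.congr hbe Filter.EventuallyEq.rfl).extend isOpen_ball (isCompact_closedBall _ _) hKB
      fun y hy => indicator_of_notMem hy _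
  have mb' : MemLp (K.indicator b) 2 := memLp_indicator_of_restrict hKm
    (mb.mono_measure (Measure.restrict_mono hKB le_rfl))
  have mG' : MemLp (K.indicator Gb) 2 := by simpa using hext.1
  have hGb0 : ∀ᵐ y, y ∈ A → Gb y = K.indicator Gb y := by
    have := (hb.mono (B := ball x (2 * r) \ K) sdiff_subset).ae_eq_zero
      (isOpen_ball.sdiff isClosed_closedBall) (by
        refine (ae_restrict_iff' (isOpen_ball.sdiff isClosed_closedBall).measurableSet).2 ?_
        filter_upwards [(ae_restrict_iff' measurableSet_ball).1 hbK] with y hy hyB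
        exact hy hyB.1 hyB.2)
    rw [ae_restrict_iff' (isOpen_ball.sdiff isClosed_closedBall).measurableSet] at this
    filter_upwards [this] with y hy hyA
    by_cases hyK : y ∈ K
    · rw [indicator_of_mem hyK]
    · rw [indicator_of_notMem hyK, hy ⟨hyA.1, hyK⟩]
  have hle : K.indicator b ≤ᵐ[volume] u := Eventually.of_forall fun y => by
    by_cases hyK : y ∈ K
    · rw [indicator_of_mem hyK]; exact hbu y (hKB hyK)
    · rw [indicator_of_notMem hyK]; exact h.nonneg y
  have hb0' : ∀ y, 0 ≤ K.indicator b y := fun y => indicator_nonneg (fun y _ => hb0 y) y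
  -- the weight of the radial field
  set Q : 𝔼 d → 𝔼 d := A.indicator fun z => barrierSlope d M r (‖z - x‖ ^ 2) • (z - x) with hQ
  have cQ : Continuous fun z : 𝔼 d => barrierSlope d M r (‖z - x‖ ^ 2) • (z - x) :=
    (continuous_barrierSlope.comp (by fun_prop)).smul (by fun_prop)
  have mQ : MemLp Q 2 := by
    refine memLp_indicator_of_restrict hAm ?_
    obtain ⟨C, hC⟩ := (isCompact_closedBall x (2 * r)).exists_bound_of_continuousOn cQ.continuousOn
    have : IsFiniteMeasure ((volume : Measure (𝔼 d)).restrict A) :=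
      isFiniteMeasure_restrict.2 ((measure_mono sdiff_subset).trans_lt measure_ball_lt_top).ne
    refine MemLp.of_bound cQ.aestronglyMeasurable.restrict C ?_
    filter_upwards [ae_restrict_mem hAm] with y hy
    exact hC y (ball_subset_closedBall hy.1)
  have eQ : ∀ g : 𝔼 d → 𝔼 d, ∫ z, inner ℝ (g z) (Q z) =
      ∫ z in A, barrierSlope d M r (‖z - x‖ ^ 2) * inner ℝ (g z) (z - x) := fun g => by
    rw [← integral_indicator hAm]
    congr 1
    ext z
    by_cases hz : z ∈ A
    · simp only [hQ, indicator_of_mem hz, real_inner_smul_right]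
    · simp only [hQ, indicator_of_notMem hz, inner_zero_right]
  have hlim := tendsto_integral_inner mG' mQ (fun n => memLp_two_mol mG' (scale_pos n))
    (fun _ => mQ) (tendsto_mol_scale mG') (by simp)
  simp only [eQ] at hlim
  have e0 : ∫ z in A, barrierSlope d M r (‖z - x‖ ^ 2) * inner ℝ (Gb z) (z - x) =
      ∫ z in A, barrierSlope d M r (‖z - x‖ ^ 2) * inner ℝ (K.indicator Gb z) (z - x) := by
    refine setIntegral_congr_ae hAm ?_
    filter_upwards [hGb0] with y hy hyA
    rw [hy hyA]
  rw [e0]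
  have hflux0 : 0 ≤ r ^ d * barrierSlope d M r (r ^ 2) :=
    mul_nonneg (pow_nonneg hr.le _) (barrierSlope_nonneg hM _)
  refine le_of_tendsto_of_tendsto' hlim.neg ((h.tendsto_sphInt hD hB hr.le
    (by linarith)).const_mul (r ^ d * barrierSlope d M r (r ^ 2))) fun n => ?_
  have hcd : ContDiff ℝ 1 (mol (scale n) (K.indicator b)) :=
    (MultiphaseBernoulli.contDiff_mol mb' (scale_pos n)).of_le (by simp)
  have hgrad : ∀ z, gradient (mol (scale n) (K.indicator b)) z = mol (scale n) (K.indicator Gb) z :=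
    fun z => MultiphaseBernoulli.gradient_mol hext mb' mG' (scale_pos n) (subset_univ _)
  have key := neg_integral_radial_le (x := x) (r := r) (R := 2 * r) hcd hr.le (by linarith)
    (mol_nonneg hb0' _) (continuous_barrierSlope (M := M) (r := r)) (barrierSlope_nonneg hM _)
    (hasDerivAt_barrier_flux hr.ne') (by
      have : Continuous fun t : ℝ => barrierSlope d M r (t ^ 2) :=
        continuous_barrierSlope.comp (continuous_pow 2)
      fun_prop) (fun t ht => by
      have h1 : 1 ≤ t / r := (one_le_div hr).2 ht.1
      have h2 : 1 - 2 * (t / r) ^ 2 ≤ 0 := by nlinarith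
      exact mul_nonpos_of_nonpos_of_nonneg (mul_nonpos_of_nonneg_of_nonpos
        (mul_nonneg (Nat.cast_nonneg _) (pow_nonneg (hr.le.trans ht.1) _)) h2)
        (barrierSlope_nonneg hM _))
  simp only [hgrad] at key
  refine key.trans (mul_le_mul_of_nonneg_left ?_ hflux0)
  exact integral_mono (integrable_sphere hcd.continuous x r)
    (integrable_sphere (h.contDiff_mol (scale_pos n)).continuous x r)
    fun s => mol_mono mb' h.memLp hle (scale_pos n).ne' _

variable {D : Set (𝔼 d)} {k n : ℕ} {p : Fin k → Fin n} {j : Fin n} {Λ : Fin n → ℝ}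
  {g U : 𝔼 d → 𝔼 k}

/-- The modulus of a phase of a minimizer, extended by zero. -/
lemma IsMinimizer.isSubharmonic (hU : IsMinimizer p Λ D g U) (hg : MemH1Sigma p D g)
    (hD : IsOpen D) (hDb : Bornology.IsBounded D)
    {G : Fin k → 𝔼 d → 𝔼 d} (hG : ∀ i, IsWeakGrad D (fun x => phase p j U x i) (G i)) :
    IsSubharmonic D (D.indicator fun x => √(∑ i, phase p j U x i ^ 2))
      (D.indicator fun x => ∑ i, (phase p j U x i / √(∑ i, phase p j U x i ^ 2)) • G i x) := by
  have mV : ∀ i, MemLp (fun x => phase p j U x i) 2 (volume.restrict D) :=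
    memLp_piLp_iff.1 (memLp_phase hU.1.1.1)
  obtain ⟨mN, hN⟩ := IsWeakGrad.modulus hD hDb.measure_lt_top.ne mV hG
  refine ⟨fun x => indicator_nonneg (fun _ _ => Real.sqrt_nonneg _) x,
    memLp_indicator_of_restrict hD.measurableSet mN,
    memLp_indicator_of_restrict hD.measurableSet hN.1, hN.indicator hD.measurableSet,
    fun ψ hψ hψ0 => ?_⟩
  refine le_of_eq_of_le (setIntegral_congr_fun hD.measurableSet fun y hy => ?_)
    (hU.weaklySubharmonic hg hD hDb hG ψ hψ hψ0)
  simp only [indicator_of_mem hy]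

lemma lintegral_split {S K : Set (𝔼 d)} (hS : MeasurableSet S) (hK : MeasurableSet K)
    (hSK : S ⊆ K) (hKD : K ⊆ D) (f : 𝔼 d → ℝ≥0∞) :
    ∫⁻ y in D, f y = (∫⁻ y in S, f y) + (∫⁻ y in K \ S, f y) + ∫⁻ y in D \ K, f y := by
  rw [← lintegral_inter_add_sdiff f D hK, inter_eq_right.2 hKD,
    ← lintegral_inter_add_sdiff f K hS, inter_eq_right.2 hSK]

/-- Comparison with `(1 - b/|U_j|) U_j`, where `b` is the part of `|U_j|` above the barrier. -/
lemma IsMinimizer.energy_le [NeZero d] (hU : IsMinimizer p Λ D g U) (hg : MemH1Sigma p D g)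
    (hD : IsOpen D) (hDb : Bornology.IsBounded D)
    {G : Fin k → 𝔼 d → 𝔼 d} (hG : ∀ i, IsWeakGrad D (fun x => phase p j U x i) (G i))
    {x : 𝔼 d} {r R M : ℝ} (hr : 0 < r) (hrR : 2 * r < R) (hB : ball x R ⊆ D) (hM : 0 ≤ M)
    (hVM : ∀ᵐ y ∂(volume.restrict (ball x (2 * r))), √(∑ i, phase p j U y i ^ 2) ≤ M) :
    (∑ i, ∫⁻ y in ball x r, ‖G i y‖ₑ ^ 2) +
        ENNReal.ofReal (Λ j) * volume (phaseSet p j D U ∩ ball x r) ≤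
      ENNReal.ofReal (2 * (r ^ d * barrierSlope d M r (r ^ 2) *
        sphInt (rep (D.indicator fun x => √(∑ i, phase p j U x i ^ 2))) x r)) := by
  have hDv : volume D ≠ ⊤ := hDb.measure_lt_top.ne
  have hBD : ball x (2 * r) ⊆ D := (ball_subset_ball hrR.le).trans hB
  have hsub := hU.isSubharmonic hg hD hDb hG
  have mV : ∀ i, MemLp (fun x => phase p j U x i) 2 (volume.restrict D) :=
    memLp_piLp_iff.1 (memLp_phase hU.1.1.1)
  have mVB : ∀ i, MemLp (fun x => phase p j U x i) 2 (volume.restrict (ball x (2 * r))) :=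
    fun i => (mV i).mono_measure (Measure.restrict_mono hBD le_rfl)
  have hGB : ∀ i, IsWeakGrad (ball x (2 * r)) (fun x => phase p j U x i) (G i) :=
    fun i => (hG i).mono hBD
  obtain ⟨b, Gb, hb0, hbN, mb, hb, hbr, hbK, hbA⟩ := exists_cutoff hr hM mVB hGB hVM
  set N : 𝔼 d → ℝ := fun x => √(∑ i, phase p j U x i ^ 2) with hN
  set K := closedBall x (3 / 2 * r) with hK
  set S := ball x r with hS
  have hSK : S ⊆ K := ball_subset_closedBall.trans (closedBall_subset_closedBall (by linarith))
  have hKB : K ⊆ ball x (2 * r) := closedBall_subset_ball (by linarith)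
  have hKm : MeasurableSet K := measurableSet_closedBall
  have hSm : MeasurableSet S := measurableSet_ball
  have hN0 : ∀ y, N y = 0 → phase p j U y = 0 := fun y hy => by
    rw [← norm_eq_zero, EuclideanSpace.norm_eq]
    simpa [hN] using hy
  have hVN : ∀ i y, N y = 0 → phase p j U y i = 0 := fun i y hy => by rw [hN0 y hy]; rfl
  -- the competitor
  set Z : Fin k → 𝔼 d → 𝔼 d := fun i y => (phase p j U y i / N y) • Gb y +
    ∑ l, (b y * dirDeriv 0 i l fun i => phase p j U y i) • G l y with hZ
  have hdir := fun i => IsWeakGrad.mul_dir isOpen_ball (measure_ball_lt_top (x := x)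
    (r := 2 * r)).ne mVB hGB mb hb (fun y => by rw [abs_of_nonneg (hb0 y)]; exact hbN y) i
  have mZ : ∀ i, MemLp (Z i) 2 (volume.restrict (ball x (2 * r))) := fun i => (hdir i).2.1
  set c : 𝔼 d → ℝ := fun y => 1 - K.indicator (fun y => b y / N y) y with hc
  have hcK : ∀ y ∉ K, c y = 1 := fun y hy => by simp [hc, indicator_of_notMem hy]
  have hcZ : ∀ i, (fun y => -1 * (b y * (phase p j U y i / N y)))
      =ᵐ[volume.restrict (ball x (2 * r))] fun y => (c y - 1) * phase p j U y i := fun i => by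
    filter_upwards [hbK] with y hy
    by_cases hyK : y ∈ K
    · simp only [hc, indicator_of_mem hyK]
      ring
    · rw [hcK y hyK, hy hyK]
      ring
  have hext : ∀ i, IsWeakGrad univ (fun y => (c y - 1) * phase p j U y i)
      (K.indicator fun y => (-1 : ℝ) • Z i y) := fun i =>
    (((hdir i).2.const_mul (-1)).congr (hcZ i) Filter.EventuallyEq.rfl).extend isOpen_ball
      (isCompact_closedBall _ _) hKB fun y hy => by rw [hcK y hy]; ring
  have mH : ∀ i, MemLp (fun y => (c y - 1) * phase p j U y i) 2 (volume.restrict D) := fun i => by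
    have h1 := memLp_indicator_of_restrict measurableSet_ball
      (((hdir i).1.const_mul (-1)).ae_eq (hcZ i))
    have h2 : (ball x (2 * r)).indicator (fun y => (c y - 1) * phase p j U y i) =
        fun y => (c y - 1) * phase p j U y i := by
      refine indicator_eq_self.2 fun y hy => ?_
      by_contra hyB
      exact hy (by simp [hcK y fun h => hyB (hKB h)])
    rw [h2] at h1
    exact h1.restrict _
  have hmin := hU.rescale hg hD hDb hG (c := c) (isCompact_closedBall x (3 / 2 * r))
    (hKB.trans hBD) hcK mH (fun i => (hext i).mono (subset_univ _))
  -- the part of the energy in `B_r` disappears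
  have hS0 : ∀ i, ∫⁻ y in S, ‖G i y + K.indicator (fun y => (-1 : ℝ) • Z i y) y‖ₑ ^ 2 = 0 := by
    intro i
    have hSD : S ⊆ D := (hSK.trans hKB).trans hBD
    have h1 := ((hG i).mono hSD).add ((hext i).mono (subset_univ S))
      ((mV i).mono_measure (Measure.restrict_mono hSD le_rfl))
      ((mH i).mono_measure (Measure.restrict_mono hSD le_rfl))
    have h2 := h1.ae_eq_zero isOpen_ball (by
      filter_upwards [ae_restrict_mem hSm] with y hy
      simp only [hc, indicator_of_mem (hSK hy), hbr y hy]
      by_cases h0 : N y = 0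
      · rw [hVN i y h0]; ring
      · rw [div_self h0]; ring)
    rw [lintegral_eq_zero_iff' ((h1.1.1.enorm).pow_const 2)]
    filter_upwards [h2] with y hy
    change ‖G i y + K.indicator (fun y => (-1 : ℝ) • Z i y) y‖ₑ ^ 2 = 0
    rw [hy]
    simp
  -- the measure of the support in `B_r` disappears
  have hvol : volume {y | y ∈ D ∧ c y ≠ 0 ∧ phase p j U y ≠ 0} ≤ volume (phaseSet p j D U \ S) := by
    have h1 : (phaseSet p j D U \ S : Set (𝔼 d)) =ᵐ[volume]
        ({y | y ∈ D ∧ phase p j U y ≠ 0} \ S : Set (𝔼 d)) :=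
      (phaseSet_ae hD hDv hU.1.1.1).diff (ae_eq_refl S)
    rw [measure_congr h1]
    refine measure_mono fun y hy => ⟨⟨hy.1, hy.2.2⟩, fun hyS => hy.2.1 ?_⟩
    have h0 : N y ≠ 0 := fun h0 => hy.2.2 (hN0 y h0)
    simp only [hc, indicator_of_mem (hSK hyS), hbr y hyS]
    rw [div_self h0, sub_self]
  -- the energy in the annulus
  set P := r ^ d * barrierSlope d M r (r ^ 2) * sphInt (rep (D.indicator N)) x r with hP
  have hP0 : 0 ≤ P := mul_nonneg (mul_nonneg (pow_nonneg hr.le _) (barrierSlope_nonneg hM _))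
    (integral_nonneg fun s => rep_nonneg _ _)
  have hKS : K \ S ⊆ ball x (2 * r) := sdiff_subset.trans hKB
  have hKSm : MeasurableSet (K \ S) := hKm.diff hSm
  have mGA : ∀ i, MemLp (G i) 2 (volume.restrict (K \ S)) := fun i =>
    (hGB i).1.mono_measure (Measure.restrict_mono hKS le_rfl)
  have mZA : ∀ i, MemLp (fun y => G i y - Z i y) 2 (volume.restrict (K \ S)) := fun i =>
    (mGA i).sub ((mZ i).mono_measure (Measure.restrict_mono hKS le_rfl))
  have mGbA : MemLp Gb 2 (volume.restrict (ball x (2 * r) \ S)) :=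
    hb.1.mono_measure (Measure.restrict_mono sdiff_subset le_rfl)
  set q : 𝔼 d → ℝ := fun y => barrierSlope d M r (‖y - x‖ ^ 2) * inner ℝ (Gb y) (y - x) with hq
  have iq : IntegrableOn q (ball x (2 * r) \ S) := by
    have cQ : Continuous fun z : 𝔼 d => barrierSlope d M r (‖z - x‖ ^ 2) • (z - x) :=
      (continuous_barrierSlope.comp (by fun_prop)).smul (by fun_prop)
    obtain ⟨C, hC⟩ := (isCompact_closedBall x (2 * r)).exists_bound_of_continuousOn cQ.continuousOn
    have : IsFiniteMeasure ((volume : Measure (𝔼 d)).restrict (ball x (2 * r) \ S)) :=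
      isFiniteMeasure_restrict.2 ((measure_mono sdiff_subset).trans_lt measure_ball_lt_top).ne
    have mQ : MemLp (fun z : 𝔼 d => barrierSlope d M r (‖z - x‖ ^ 2) • (z - x)) 2
        (volume.restrict (ball x (2 * r) \ S)) := by
      refine MemLp.of_bound cQ.aestronglyMeasurable.restrict C ?_
      filter_upwards [ae_restrict_mem (measurableSet_ball.diff hSm)] with y hy
      exact hC y (ball_subset_closedBall hy.1)
    have := integrable_inner_of_memLp mGbA mQ
    simp only [real_inner_smul_right] at this
    exact this
  have hAq : -∫ y in K \ S, q y ≤ P := by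
    have h1 := hsub.neg_integral_barrier_le hD hB hr hrR hM hb0 mb hb
      (fun y hy => by rw [indicator_of_mem (hBD hy)]; exact hbN y) hbK
    have h2 : ∫ y in ball x (2 * r) \ S, q y = ∫ y in K \ S, q y := by
      refine setIntegral_eq_of_subset_of_ae_sdiff_eq_zero (measurableSet_ball.diff hSm).nullMeasurableSet
        (sdiff_subset_sdiff_left hKB) ?_
      have h3 := (hb.mono (B := ball x (2 * r) \ K) sdiff_subset).ae_eq_zero
        (isOpen_ball.sdiff isClosed_closedBall) (by
          refine (ae_restrict_iff' (isOpen_ball.sdiff isClosed_closedBall).measurableSet).2 ?_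
          filter_upwards [(ae_restrict_iff' measurableSet_ball).1 hbK] with y hy hyB
          exact hy hyB.1 hyB.2)
      rw [ae_restrict_iff' (isOpen_ball.sdiff isClosed_closedBall).measurableSet] at h3
      filter_upwards [h3] with y hy hyA
      simp only [hq]
      rw [hy ⟨hyA.1.1, fun h => hyA.2 ⟨h, hyA.1.2⟩⟩, inner_zero_left, mul_zero]
    rw [← h2]
    exact h1
  have hann : (∑ i, ∫⁻ y in K \ S, ‖G i y + K.indicator (fun y => (-1 : ℝ) • Z i y) y‖ₑ ^ 2) ≤
      (∑ i, ∫⁻ y in K \ S, ‖G i y‖ₑ ^ 2) + ENNReal.ofReal (2 * P) := by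
    have e1 : ∀ i, ∫⁻ y in K \ S, ‖G i y + K.indicator (fun y => (-1 : ℝ) • Z i y) y‖ₑ ^ 2 =
        ENNReal.ofReal (∫ y in K \ S, ‖G i y - Z i y‖ ^ 2) := fun i => by
      rw [← lintegral_enorm_sq_eq (mZA i)]
      refine setLIntegral_congr_fun hKSm fun y hy => ?_
      simp only [indicator_of_mem hy.1, neg_smul, one_smul, ← sub_eq_add_neg]
    simp only [e1, fun i => lintegral_enorm_sq_eq (mGA i)]
    rw [← ENNReal.ofReal_sum_of_nonneg (fun i _ => by positivity),
      ← ENNReal.ofReal_sum_of_nonneg (fun i _ => by positivity),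
      ← ENNReal.ofReal_add (Finset.sum_nonneg fun i _ => by positivity) (by positivity)]
    refine ENNReal.ofReal_le_ofReal ?_
    have i1 : ∀ i, Integrable (fun y => ‖G i y - Z i y‖ ^ 2) (volume.restrict (K \ S)) :=
      fun i => (mZA i).integrable_norm_pow (by norm_num)
    have i2 : ∀ i, Integrable (fun y => ‖G i y‖ ^ 2) (volume.restrict (K \ S)) :=
      fun i => (mGA i).integrable_norm_pow (by norm_num)
    have i3 : Integrable q (volume.restrict (K \ S)) :=
      iq.mono_set (sdiff_subset_sdiff_left hKB)
    rw [← integral_finsetSum _ fun i _ => i1 i, ← integral_finsetSum _ fun i _ => i2 i]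
    have h4 : ∫ y in K \ S, ∑ i, ‖G i y - Z i y‖ ^ 2 ≤
        ∫ y in K \ S, (∑ i, ‖G i y‖ ^ 2 + -2 * q y) := by
      refine integral_mono_ae (integrable_finsetSum _ fun i _ => i1 i)
        ((integrable_finsetSum _ fun i _ => i2 i).add (i3.const_mul _)) ?_
      rw [EventuallyLE, ae_restrict_iff' hKSm]
      filter_upwards [(ae_restrict_iff' measurableSet_ball).1 hbA] with y hy hyA
      have h5 := sum_norm_sq_sub_le (fun i => phase p j U y i) (fun i => G i y) (Gb y) (hb0 y)
        (hbN y)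
      have h6 := hy (hKS hyA) hyA.2
      simp only [hZ, hq, hN] at h5 h6 ⊢
      linarith
    rw [integral_add (integrable_finsetSum _ fun i _ => i2 i) (i3.const_mul _),
      integral_const_mul] at h4
    linarith
  -- cancellation of the common terms
  simp only [lintegral_split (D := D) hSm hKm hSK (hKB.trans hBD), Finset.sum_add_distrib] at hmin
  rw [Finset.sum_eq_zero fun i _ => hS0 i, zero_add] at hmin
  have hout : ∀ i, ∫⁻ y in D \ K, ‖G i y + K.indicator (fun y => (-1 : ℝ) • Z i y) y‖ₑ ^ 2 =
      ∫⁻ y in D \ K, ‖G i y‖ₑ ^ 2 := fun i =>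
    setLIntegral_congr_fun (hD.measurableSet.diff hKm) fun y hy => by
      simp only [indicator_of_notMem hy.2, add_zero]
  simp only [hout] at hmin
  rw [← measure_inter_add_sdiff (phaseSet p j D U) hSm, mul_add] at hmin
  have hfin1 : ∑ i, ∫⁻ y in K \ S, ‖G i y‖ₑ ^ 2 ≠ ⊤ := by
    refine (ENNReal.sum_lt_top.2 fun i _ => ?_).ne
    rw [lintegral_enorm_sq_eq (mGA i)]
    exact ENNReal.ofReal_lt_top
  have hfin2 : ∑ i, ∫⁻ y in D \ K, ‖G i y‖ₑ ^ 2 ≠ ⊤ := by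
    refine (ENNReal.sum_lt_top.2 fun i _ => ?_).ne
    rw [lintegral_enorm_sq_eq ((hG i).1.mono_measure (Measure.restrict_mono sdiff_subset le_rfl))]
    exact ENNReal.ofReal_lt_top
  have hfin3 : ENNReal.ofReal (Λ j) * volume (phaseSet p j D U \ S) ≠ ⊤ :=
    ENNReal.mul_ne_top ENNReal.ofReal_ne_top
      ((measure_mono fun y hy => hy.1.1).trans_lt hDv.lt_top).ne
  have hvol' := mul_le_mul_right hvol (ENNReal.ofReal (Λ j))
  refine (ENNReal.add_le_add_iff_right (ENNReal.add_ne_top.2 ⟨ENNReal.add_ne_top.2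
    ⟨hfin1, hfin2⟩, hfin3⟩)).1 ?_
  refine le_trans (le_of_eq ?_) (hmin.trans ((add_le_add (add_le_add hann le_rfl) hvol').trans
    (le_of_eq ?_)))
  · ring
  · ring

end energy

/-! ### Spherical means of the canonical representative -/

section sphere

/-- A point of `closure D` at positive distance from the frontier lies in `D`, and a ball that does not
meet the frontier is connected, so it stays in `D`. -/
lemma ball_infDist_frontier_subset {D : Set (𝔼 d)} (hD : IsOpen D) {x : 𝔼 d}
    (hx : x ∈ closure D) : ball x (infDist x (frontier D)) ⊆ D := by
  rcases (ball x (infDist x (frontier D))).eq_empty_or_nonempty with h | h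
  · rw [h]; exact empty_subset D
  have hpos : 0 < infDist x (frontier D) := nonempty_ball.1 h
  refine IsPreconnected.subset_left_of_subset_union hD (v := (closure D)ᶜ)
    isClosed_closure.isOpen_compl (disjoint_compl_right_iff_subset.2 subset_closure)
    (fun y hy => ?_) ?_ (convex_ball x _).isPreconnected
  · by_contra hne
    rw [mem_union, not_or, mem_compl_iff, not_not] at hne
    exact ball_infDist_subset_compl hy (by rw [hD.frontier_eq]; exact ⟨hne.2, hne.1⟩)
  · obtain ⟨y, hy1, hy2⟩ := mem_closure_iff.1 hx _ isOpen_ball (mem_ball_self hpos)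
    exact ⟨y, hy1, hy2⟩

lemma upperRep_eq_preciseModulus {D : Set (𝔼 d)} (hD : IsOpen D) {k : ℕ} (V : 𝔼 d → 𝔼 k)
    {x : 𝔼 d} (hx : x ∈ D) :
    upperRep (D.indicator fun y => √(∑ i, V y i ^ 2)) x = preciseModulus V x := by
  obtain ⟨R, hR, hB⟩ := Metric.isOpen_iff.1 hD x hx
  refine limsup_congr ?_
  filter_upwards [Ioo_mem_nhdsGT hR] with r hr
  rw [setLAverage_eq, setLAverage_eq]
  congr 1
  refine setLIntegral_congr_fun measurableSet_ball fun y hy => ?_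
  simp only [indicator_of_mem (hB (ball_subset_ball hr.2.le hy))]
  rw [Real.enorm_eq_ofReal (Real.sqrt_nonneg _), ← ofReal_norm, EuclideanSpace.norm_eq]
  simp only [Real.norm_eq_abs, sq_abs]

variable [NeZero d] {D : Set (𝔼 d)} {k : ℕ} {V : 𝔼 d → 𝔼 k} {G : 𝔼 d → 𝔼 d} {x : 𝔼 d} {r R : ℝ}

lemma sphereIntegral_preciseModulus
    (h : IsSubharmonic D (D.indicator fun y => √(∑ i, V y i ^ 2)) G) (hD : IsOpen D)
    (hB : ball x R ⊆ D) (hr : 0 ≤ r) (hrR : r < R) :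
    sphereIntegral (preciseModulus V) x r = ENNReal.ofReal
      (r ^ (d - 1) * sphInt (rep (D.indicator fun y => √(∑ i, V y i ^ 2))) x r) := by
  rw [sphereIntegral, ENNReal.ofReal_mul (pow_nonneg hr _), ← h.lintegral_sphere hD hB hr hrR]
  congr 1
  refine lintegral_congr fun s => ?_
  rw [upperRep_eq_preciseModulus hD V (hB (add_smul_sphere_mem_ball hr hrR s))]

/-- On spheres inside `D` the `ℝ≥0∞`-valued mean is the real one: the modulus is subharmonic, so the
representative is integrable over every such sphere. -/
lemma sphereMean_preciseModulus
    (h : IsSubharmonic D (D.indicator fun y => √(∑ i, V y i ^ 2)) G) (hD : IsOpen D)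
    (hB : ball x R ⊆ D) (hr : 0 < r) (hrR : r < R) :
    sphereMean (preciseModulus V) x r = ENNReal.ofReal
      (sphInt (rep (D.indicator fun y => √(∑ i, V y i ^ 2))) x r / (surface d).real univ) := by
  have hσ := surface_real_univ_pos (d := d)
  have h1 : sphereIntegral (fun _ : 𝔼 d => 1) x r =
      ENNReal.ofReal (r ^ (d - 1) * (surface d).real univ) := by
    rw [sphereIntegral, ENNReal.ofReal_mul (pow_nonneg hr.le _), measureReal_def,
      ENNReal.ofReal_toReal (measure_ne_top _ _)]
    simp
  rw [sphereMean, sphereIntegral_preciseModulus h hD hB hr.le hrR, h1,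
    ← ENNReal.ofReal_div_of_pos (by positivity), mul_div_mul_left _ _ (by positivity)]

lemma ae_sqrt_le_of_eLpNorm_lt_top (h : eLpNorm V ⊤ (volume.restrict (ball x r)) < ⊤) :
    ∀ᵐ y ∂(volume.restrict (ball x r)),
      √(∑ i, V y i ^ 2) ≤ (eLpNorm V ⊤ (volume.restrict (ball x r))).toReal := by
  rw [eLpNorm_exponent_top] at h ⊢
  filter_upwards [ae_le_eLpNormEssSup (f := V) (μ := volume.restrict (ball x r))] with y hy
  have h1 : √(∑ i, V y i ^ 2) = ‖V y‖ := by
    rw [EuclideanSpace.norm_eq]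
    simp only [Real.norm_eq_abs, sq_abs]
  rw [h1, ← toReal_enorm]
  exact ENNReal.toReal_mono h.ne hy

lemma eLpNorm_top_lt_top (h : IsSubharmonic D (D.indicator fun y => √(∑ i, V y i ^ 2)) G)
    (hB : ball x R ⊆ D) (hrR : r < R) : eLpNorm V ⊤ (volume.restrict (ball x r)) < ⊤ := by
  obtain ⟨M, hM⟩ := h.exists_ae_le hB hrR
  rw [eLpNorm_exponent_top]
  refine (eLpNormEssSup_le_of_ae_bound (C := M) ?_).trans_lt ENNReal.ofReal_lt_top
  rw [ae_restrict_iff' measurableSet_ball]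
  filter_upwards [hM] with y hy hyr
  have := hy hyr
  rw [indicator_of_mem (hB (ball_subset_ball hrR.le hyr))] at this
  rw [EuclideanSpace.norm_eq]
  simpa only [Real.norm_eq_abs, sq_abs] using this

lemma ae_indicator_le (hB : ball x R ⊆ D) (hrR : r ≤ R) {M : ℝ}
    (hM : ∀ᵐ y ∂(volume.restrict (ball x r)), √(∑ i, V y i ^ 2) ≤ M) :
    ∀ᵐ y, y ∈ ball x r → D.indicator (fun y => √(∑ i, V y i ^ 2)) y ≤ M := by
  filter_upwards [(ae_restrict_iff' measurableSet_ball).1 hM] with y hy hyr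
  rw [indicator_of_mem (hB (ball_subset_ball hrR hyr))]
  exact hy hyr

lemma sphereMean_le_eLpNorm (h : IsSubharmonic D (D.indicator fun y => √(∑ i, V y i ^ 2)) G)
    (hD : IsOpen D) (hB : ball x R ⊆ D) (hr : 0 < r) (hrR : r < R) :
    sphereMean (preciseModulus V) x r ≤ eLpNorm V ⊤ (volume.restrict (ball x r)) := by
  have hfin := eLpNorm_top_lt_top h hB hrR
  rw [sphereMean_preciseModulus h hD hB hr hrR, ← ENNReal.ofReal_toReal hfin.ne]
  refine ENNReal.ofReal_le_ofReal ((div_le_iff₀' surface_real_univ_pos).2 ?_)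
  exact h.sphInt_rep_le hD hB hr hrR
    (ae_indicator_le hB hrR.le (ae_sqrt_le_of_eLpNorm_lt_top hfin))

end sphere

/-! ### Non-degeneracy -/

section nondegeneracy

variable (d) in
/-- The constant of the energy estimate. -/
noncomputable def energyConst : ℝ := 4 * d * Real.exp (-d) / barrierConst d

lemma energyConst_pos [NeZero d] : 0 < energyConst d := by
  have hd : (0 : ℝ) < d := Nat.cast_pos.2 (Nat.pos_of_ne_zero (NeZero.ne d))
  have := barrierConst_pos (d := d)
  unfold energyConst
  positivity

lemma two_mul_barrierSlope [NeZero d] {M r : ℝ} (hr : r ≠ 0) (I : ℝ) :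
    2 * (r ^ d * barrierSlope d M r (r ^ 2) * I) =
      energyConst d * r⁻¹ * M * (r ^ (d - 1) * I) := by
  have e : r ^ d = r ^ (d - 1) * r := by rw [← pow_succ, Nat.sub_add_cancel NeZero.one_le]
  have e2 : (d : ℝ) / r ^ 2 * r ^ 2 = d := by field_simp
  have := (barrierConst_pos (d := d)).ne'
  rw [barrierSlope, energyConst, e2, e]
  field_simp
  ring

lemma norm_sum_smul_sq_le {ι : Type*} [Fintype ι] (y : ι → ℝ) (v : ι → 𝔼 d) :
    ‖∑ i, (y i / √(∑ i, y i ^ 2)) • v i‖ ^ 2 ≤ ∑ i, ‖v i‖ ^ 2 := by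
  classical
  have h := sum_norm_sq_sub_le y v (b := 0) (∑ i, (y i / √(∑ i, y i ^ 2)) • v i) le_rfl
    (Real.sqrt_nonneg _)
  rw [real_inner_self_eq_norm_sq] at h
  have h2 := (Finset.sum_nonneg fun i _ => sq_nonneg _).trans h
  linarith

variable {D : Set (𝔼 d)} {k n : ℕ} {p : Fin k → Fin n} {j : Fin n} {Λ : Fin n → ℝ}
  {g U : 𝔼 d → 𝔼 k} {x : 𝔼 d} {r R M : ℝ}

lemma exists_isWeakGrad_phase {W : 𝔼 d → 𝔼 k} (hW : ∀ i, MemH1 D fun x => W x i) :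
    ∃ G : Fin k → 𝔼 d → 𝔼 d, ∀ i, IsWeakGrad D (fun x => phase p j W x i) (G i) := by
  refine Classical.skolem.1 fun i => ?_
  by_cases hi : p i = j
  · simpa only [phase_apply, hi, if_true] using (hW i).2
  · exact ⟨0, MemLp.zero, by simp [phase_apply, hi]⟩

lemma norm_phase_eq (W : 𝔼 d → 𝔼 k) :
    (fun y => ‖phase p j W y‖) = fun y => √(∑ i, phase p j W y i ^ 2) := by
  ext y
  rw [EuclideanSpace.norm_eq]
  simp only [Real.norm_eq_abs, sq_abs]

lemma memH1_norm_phase (hD : IsOpen D) (hDv : volume D ≠ ⊤) {W : 𝔼 d → 𝔼 k}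
    (hW : ∀ i, MemH1 D fun x => W x i) : MemH1 D fun y => ‖phase p j W y‖ := by
  obtain ⟨G, hG⟩ := exists_isWeakGrad_phase (p := p) (j := j) hW
  obtain ⟨h1, h2⟩ := IsWeakGrad.modulus hD hDv (memLp_piLp_iff.1 (memLp_phase hW)) hG
  rw [norm_phase_eq]
  exact ⟨h1, _, h2⟩

variable [NeZero d]

/-- The energy estimate for the modulus. -/
lemma IsMinimizer.modulus_energy_le (hU : IsMinimizer p Λ D g U) (hg : MemH1Sigma p D g)
    (hD : IsOpen D) (hDb : Bornology.IsBounded D)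
    {G : Fin k → 𝔼 d → 𝔼 d} (hG : ∀ i, IsWeakGrad D (fun x => phase p j U x i) (G i))
    (hr : 0 < r) (hrR : 2 * r < R) (hB : ball x R ⊆ D) (hM : 0 ≤ M)
    (hVM : ∀ᵐ y ∂(volume.restrict (ball x (2 * r))), √(∑ i, phase p j U y i ^ 2) ≤ M) :
    (∫⁻ y in ball x r,
        ‖∑ i, (phase p j U y i / √(∑ i, phase p j U y i ^ 2)) • G i y‖ₑ ^ 2) +
        ENNReal.ofReal (Λ j) * volume (phaseSet p j D U ∩ ball x r) ≤
      ENNReal.ofReal (energyConst d * r⁻¹ * M * (r ^ (d - 1) *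
        sphInt (rep (D.indicator fun x => √(∑ i, phase p j U x i ^ 2))) x r)) := by
  have hrD : ball x r ⊆ D := (ball_subset_ball (by linarith)).trans hB
  rw [← two_mul_barrierSlope hr.ne']
  refine le_trans (add_le_add ?_ le_rfl) (hU.energy_le hg hD hDb hG hr hrR hB hM hVM)
  rw [← lintegral_finsetSum' _ fun i _ =>
    (((hG i).1.1.mono_measure (Measure.restrict_mono hrD le_rfl)).enorm.pow_const 2)]
  refine lintegral_mono fun y => ?_
  have h := norm_sum_smul_sq_le (fun i => phase p j U y i) fun i => G i y
  have h2 := ENNReal.ofReal_le_ofReal h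
  rw [ENNReal.ofReal_sum_of_nonneg fun i _ => sq_nonneg _] at h2
  simpa only [ENNReal.ofReal_pow (norm_nonneg _), ofReal_norm] using h2

/-- The energy estimate `IsMinimizer.energy_le` for the weak gradient of `|U_j|`, which is pointwise at
most that of `U_j`. -/
lemma IsMinimizer.gradient_energy_le (hU : IsMinimizer p Λ D g U) (hg : MemH1Sigma p D g)
    (hD : IsOpen D) (hDb : Bornology.IsBounded D) (hr : 0 < r) (hrR : 2 * r < R)
    (hB : ball x R ⊆ D) :
    eLpNorm (phase p j U) ⊤ (volume.restrict (ball x (2 * r))) < ⊤ ∧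
    (1 / 2 : ℝ≥0∞) * (∫⁻ y in ball x r, ‖weakGrad D (fun z => ‖phase p j U z‖) y‖ₑ ^ 2) +
        ENNReal.ofReal (Λ j) * volume (phaseSet p j D U ∩ ball x r) ≤
      ENNReal.ofReal (energyConst d * r⁻¹) *
        eLpNorm (phase p j U) ⊤ (volume.restrict (ball x (2 * r))) *
        sphereIntegral (preciseModulus (phase p j U)) x r := by
  have mV : ∀ i, MemLp (fun x => phase p j U x i) 2 (volume.restrict D) :=
    memLp_piLp_iff.1 (memLp_phase hU.1.1.1)
  obtain ⟨G, hG⟩ := exists_isWeakGrad_phase (p := p) (j := j) hU.1.1.1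
  have hsub := hU.isSubharmonic hg hD hDb hG
  have hfin := eLpNorm_top_lt_top hsub hB hrR
  refine ⟨hfin, ?_⟩
  have hrD : ball x r ⊆ D := (ball_subset_ball (by linarith)).trans hB
  obtain ⟨mN, hN⟩ := IsWeakGrad.modulus hD hDb.measure_lt_top.ne mV hG
  have hwg := hN.weakGrad_ae hD mN
  have key := hU.modulus_energy_le hg hD hDb hG hr hrR hB ENNReal.toReal_nonneg
    (ae_sqrt_le_of_eLpNorm_lt_top hfin)
  rw [sphereIntegral_preciseModulus hsub hD hB hr.le (by linarith), norm_phase_eq,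
    ← ENNReal.ofReal_toReal hfin.ne, ← ENNReal.ofReal_mul
      (mul_nonneg energyConst_pos.le (inv_nonneg.2 hr.le)), ← ENNReal.ofReal_mul
      (mul_nonneg (mul_nonneg energyConst_pos.le (inv_nonneg.2 hr.le)) ENNReal.toReal_nonneg)]
  refine le_trans (add_le_add ?_ le_rfl) key
  have h1 : ∫⁻ y in ball x r, ‖weakGrad D (fun y => √(∑ i, phase p j U y i ^ 2)) y‖ₑ ^ 2 =
      ∫⁻ y in ball x r,
        ‖∑ i, (phase p j U y i / √(∑ i, phase p j U y i ^ 2)) • G i y‖ₑ ^ 2 := by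
    refine lintegral_congr_ae ?_
    filter_upwards [ae_mono (Measure.restrict_mono hrD le_rfl) hwg] with y hy
    rw [hy]
  rw [h1]
  refine mul_le_of_le_one_left zero_le ?_
  simp

/-- If `|U_j|` is small on `B_{2s}(x)`, compared with `√Λ_j s`, then the energy estimate and the
trace inequality show that the energy in `B_s(x)` is at most half of itself. -/
lemma IsMinimizer.volume_phaseSet_eq_zero (hU : IsMinimizer p Λ D g U) (hg : MemH1Sigma p D g)
    (hD : IsOpen D) (hDb : Bornology.IsBounded D) (hΛ : 0 < Λ j) {s : ℝ} (hs : 0 < s)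
    (hsR : 2 * s < R) (hB : ball x R ⊆ D) (hM : 0 ≤ M)
    (hVM : ∀ᵐ y ∂(volume.restrict (ball x (2 * s))), √(∑ i, phase p j U y i ^ 2) ≤ M)
    (hsmall : energyConst d * d * ((M / (√(Λ j) * s)) ^ 2 + M / (√(Λ j) * s)) ≤ 1 / 2) :
    volume (phaseSet p j D U ∩ ball x s) = 0 := by
  obtain ⟨G, hG⟩ := exists_isWeakGrad_phase (p := p) (j := j) hU.1.1.1
  have hsub := hU.isSubharmonic hg hD hDb hG
  have hsD : ball x s ⊆ D := (ball_subset_ball (by linarith)).trans hB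
  have mV : ∀ i, MemLp (fun x => phase p j U x i) 2 (volume.restrict D) :=
    memLp_piLp_iff.1 (memLp_phase hU.1.1.1)
  have hgrad := (IsWeakGrad.modulus hD hDb.measure_lt_top.ne mV hG).2
  set N : 𝔼 d → ℝ := fun x => √(∑ i, phase p j U x i ^ 2) with hN
  set Gu : 𝔼 d → 𝔼 d := fun y => ∑ i, (phase p j U y i / N y) • G i y with hGu
  set Ω : Set (𝔼 d) := {y | y ∈ D ∧ phase p j U y ≠ 0} with hΩ
  have hN0 : ∀ y, phase p j U y = 0 → N y = 0 := fun y hy => by simp [hN, hy]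
  have hΩv : volume (phaseSet p j D U ∩ ball x s) = volume (Ω ∩ ball x s) :=
    measure_congr ((phaseSet_ae hD hDb.measure_lt_top.ne hU.1.1.1).inter (ae_eq_refl _))
  have hΩfin : volume (Ω ∩ ball x s) ≠ ⊤ :=
    ((measure_mono inter_subset_right).trans_lt measure_ball_lt_top).ne
  have : IsFiniteMeasure ((volume : Measure (𝔼 d)).restrict (ball x s)) :=
    isFiniteMeasure_restrict.2 measure_ball_lt_top.ne
  have mGu : MemLp Gu 2 (volume.restrict (ball x s)) :=
    hgrad.1.mono_measure (Measure.restrict_mono hsD le_rfl)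
  have mN : MemLp (D.indicator N) 2 (volume.restrict (ball x s)) := hsub.memLp.restrict _
  set m := volume.real (Ω ∩ ball x s) with hm
  set A := ∫ y in ball x s, ‖Gu y‖ ^ 2 with hA
  set I := sphInt (rep (D.indicator N)) x s with hI
  set l := √(Λ j) with hl
  have hl0 : 0 < l := Real.sqrt_pos.2 hΛ
  have hl2 : l ^ 2 = Λ j := Real.sq_sqrt hΛ.le
  have hC := energyConst_pos (d := d)
  have hd : (0 : ℝ) < d := Nat.cast_pos.2 (Nat.pos_of_ne_zero (NeZero.ne d))
  have hm0 : 0 ≤ m := measureReal_nonneg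
  have hA0 : 0 ≤ A := integral_nonneg fun y => sq_nonneg _
  have hI0 : 0 ≤ I := integral_nonneg fun _ => rep_nonneg _ _
  have hE : A + l ^ 2 * m ≤ energyConst d * s⁻¹ * M * (s ^ (d - 1) * I) := by
    have h1 := hU.modulus_energy_le hg hD hDb hG hs hsR hB hM hVM
    have h2 : ∫⁻ y in ball x s, ‖Gu y‖ₑ ^ 2 = ENNReal.ofReal A := lintegral_enorm_sq_eq mGu
    have h3 : volume (Ω ∩ ball x s) = ENNReal.ofReal m := (ENNReal.ofReal_toReal hΩfin).symm
    rw [hΩv, h3] at h1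
    have h4 : ENNReal.ofReal A + ENNReal.ofReal (Λ j) * ENNReal.ofReal m ≤
        ENNReal.ofReal (energyConst d * s⁻¹ * M * (s ^ (d - 1) * I)) := by
      rw [← h2]
      exact h1
    rw [← ENNReal.ofReal_mul hΛ.le, ← ENNReal.ofReal_add hA0 (mul_nonneg hΛ.le hm0),
      ENNReal.ofReal_le_ofReal_iff (by positivity), ← hl2] at h4
    exact h4
  have htr := hsub.sphInt_rep_mul_le hD hB hs.le (by linarith)
  have h1 : ∫ y in ball x s, D.indicator N y ≤ M * m := by
    rw [setIntegral_eq_of_subset_of_forall_sdiff_eq_zero measurableSet_ball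
      (inter_subset_right (s := Ω)) fun y hy => ?_]
    · have : M * m = ∫ y in Ω ∩ ball x s, M := by
        rw [setIntegral_const, smul_eq_mul, mul_comm]
      rw [this]
      have : IsFiniteMeasure ((volume : Measure (𝔼 d)).restrict (Ω ∩ ball x s)) :=
        isFiniteMeasure_restrict.2 hΩfin
      refine integral_mono_ae ((mN.mono_measure (Measure.restrict_mono inter_subset_right
        le_rfl)).integrable (by norm_num)) (integrable_const _) ?_
      filter_upwards [ae_mono (Measure.restrict_mono (inter_subset_right.trans
        (ball_subset_ball (by linarith))) le_rfl) hVM] with y hy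
      exact (indicator_le_self' (fun _ _ => Real.sqrt_nonneg _) y).trans hy
    · rw [indicator_of_mem (hsD hy.1)]
      refine hN0 y ?_
      by_contra h0
      exact hy.2 ⟨⟨hsD hy.1, h0⟩, hy.1⟩
  have h2 : ∫ y in ball x s, ‖D.indicator Gu y‖ ≤ A / (2 * l) + l / 2 * m := by
    have e1 : ∫ y in ball x s, ‖D.indicator Gu y‖ = ∫ y in ball x s, ‖Gu y‖ :=
      setIntegral_congr_fun measurableSet_ball fun y hy => by
        simp only [indicator_of_mem (hsD hy)]
    rw [e1, setIntegral_eq_of_subset_of_forall_sdiff_eq_zero measurableSet_ball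
      (inter_subset_right (s := Ω)) fun y hy => ?_]
    · have : IsFiniteMeasure ((volume : Measure (𝔼 d)).restrict (Ω ∩ ball x s)) :=
        isFiniteMeasure_restrict.2 hΩfin
      have mGu' : MemLp Gu 2 (volume.restrict (Ω ∩ ball x s)) :=
        mGu.mono_measure (Measure.restrict_mono inter_subset_right le_rfl)
      have i2 : Integrable (fun y => ‖Gu y‖ ^ 2) (volume.restrict (Ω ∩ ball x s)) :=
        mGu'.integrable_norm_pow (by norm_num)
      have h3 : ∫ y in Ω ∩ ball x s, ‖Gu y‖ ≤
          ∫ y in Ω ∩ ball x s, (‖Gu y‖ ^ 2 / (2 * l) + l / 2) := by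
        refine integral_mono (mGu'.integrable (by norm_num)).norm
          ((i2.div_const _).add (integrable_const _)) fun y => ?_
        change ‖Gu y‖ ≤ ‖Gu y‖ ^ 2 / (2 * l) + l / 2
        have : ‖Gu y‖ ^ 2 / (2 * l) + l / 2 - ‖Gu y‖ = (‖Gu y‖ - l) ^ 2 / (2 * l) := by
          field_simp
          ring
        have h4 : 0 ≤ (‖Gu y‖ - l) ^ 2 / (2 * l) := by positivity
        linarith
      refine h3.trans ?_
      rw [integral_add (i2.div_const _) (integrable_const _), integral_div, setIntegral_const,
        smul_eq_mul, mul_comm (volume.real _)]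
      refine add_le_add (div_le_div_of_nonneg_right ?_ (by positivity)) le_rfl
      exact setIntegral_mono_set (mGu.integrable_norm_pow (by norm_num))
        (Eventually.of_forall fun y => sq_nonneg _) inter_subset_right.eventuallyLE
    · have h0 : phase p j U y = 0 := by
        by_contra h0
        exact hy.2 ⟨⟨hsD hy.1, h0⟩, hy.1⟩
      simp [hGu, hN0 y h0]
  set E := A + l ^ 2 * m with hEdef
  have hE0 : 0 ≤ E := by positivity
  have h3 : M * m + s * (A / (2 * l) + l / 2 * m) ≤ (M / l ^ 2 + s / l) * E := by
    have e : (M / l ^ 2 + s / l) * E - (M * m + s * (A / (2 * l) + l / 2 * m)) =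
        M / l ^ 2 * A + s / (2 * l) * E := by
      rw [hEdef]
      field_simp
      ring
    have : 0 ≤ M / l ^ 2 * A + s / (2 * l) * E := by positivity
    linarith
  have h4 : s ^ (d - 1) * I ≤ d / s * ((M / l ^ 2 + s / l) * E) := by
    have e : s ^ d = s ^ (d - 1) * s := by rw [← pow_succ, Nat.sub_add_cancel NeZero.one_le]
    have e2 : s ^ (d - 1) * I = d / s * (I * (s ^ d / d)) := by
      rw [e]
      field_simp
    rw [e2]
    refine mul_le_mul_of_nonneg_left ?_ (by positivity)
    calc I * (s ^ d / d) ≤ _ := htr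
      _ ≤ M * m + s * (A / (2 * l) + l / 2 * m) := by gcongr
      _ ≤ _ := h3
  have h5 : E ≤ 1 / 2 * E := by
    calc E ≤ energyConst d * s⁻¹ * M * (s ^ (d - 1) * I) := hE
      _ ≤ energyConst d * s⁻¹ * M * (d / s * ((M / l ^ 2 + s / l) * E)) := by gcongr
      _ = energyConst d * d * ((M / (l * s)) ^ 2 + M / (l * s)) * E := by field_simp
      _ ≤ 1 / 2 * E := mul_le_mul_of_nonneg_right hsmall hE0
  have h6 : m = 0 := by
    have h7 : l ^ 2 * m ≤ 0 := by linarith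
    have h8 : 0 < l ^ 2 := by positivity
    nlinarith
  rw [hΩv, ← ENNReal.ofReal_toReal hΩfin]
  change ENNReal.ofReal m = 0
  rw [h6, ENNReal.ofReal_zero]

variable (d) in
/-- The non-degeneracy constant. -/
noncomputable def nondegConst : ℝ := 1 / (4 * (energyConst d * d) + 1) / (4 * 2 ^ d)

lemma nondegConst_pos : 0 < nondegConst d := by
  have := energyConst_pos (d := d)
  unfold nondegConst
  positivity

/-- If the phase vanishes almost everywhere in a ball, then the ball contains no point of the
phase. -/
lemma IsMinimizer.phaseSet_inter_ball_eq_empty (hU : IsMinimizer p Λ D g U) (hD : IsOpen D)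
    (hDb : Bornology.IsBounded D) {s : ℝ} (h0 : volume (phaseSet p j D U ∩ ball x s) = 0) :
    phaseSet p j D U ∩ ball x s = ∅ := by
  refine eq_empty_of_forall_notMem fun z hz => hz.1.2 ?_
  obtain ⟨ε, hε, hball⟩ := Metric.isOpen_iff.1 (hD.inter isOpen_ball) z ⟨hz.1.1, hz.2⟩
  have hae : ∀ᵐ y, y ∈ D → y ∈ ball x s → phase p j U y = 0 := by
    filter_upwards [measure_eq_zero_iff_ae_notMem.1 h0,
      (phaseSet_ae (p := p) (j := j) hD hDb.measure_lt_top.ne hU.1.1.1).mem_iff] with y h1 h2 h3 h4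
    by_contra h5
    exact h1 ⟨h2.2 ⟨h3, h5⟩, h4⟩
  have hev : ∀ᶠ ρ in 𝓝[>] (0 : ℝ), ⨍⁻ y in ball z ρ, ‖phase p j U y‖ₑ ∂volume = 0 := by
    filter_upwards [Ioo_mem_nhdsGT hε] with ρ hρ
    rw [setLAverage_eq]
    have : ∫⁻ y in ball z ρ, ‖phase p j U y‖ₑ = 0 := by
      rw [← lintegral_zero (μ := volume.restrict (ball z ρ))]
      refine lintegral_congr_ae ?_
      rw [EventuallyEq, ae_restrict_iff' measurableSet_ball]
      filter_upwards [hae] with y hy hyz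
      have := hball (ball_subset_ball hρ.2.le hyz)
      rw [hy this.1 this.2, enorm_zero]
    rw [this, ENNReal.zero_div]
  rw [preciseModulus, limsup_congr hev]
  simp

/-- If the mean over `∂B_r(x)` were below the threshold, then `Ω_{U_j}` would have measure zero in a
neighbourhood of `x`, so `|U_j|` and its representative would vanish there. -/
lemma IsMinimizer.nondegenerate (hU : IsMinimizer p Λ D g U) (hg : MemH1Sigma p D g)
    (hD : IsOpen D) (hDb : Bornology.IsBounded D) (hΛ : 0 < Λ j)
    (hx : x ∈ closure (phaseSet p j D U)) (hr : 0 < r) (hrR : r < R) (hB : ball x R ⊆ D) :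
    ENNReal.ofReal (nondegConst d * √(Λ j) * r) ≤
      sphereMean (preciseModulus (phase p j U)) x r := by
  by_contra! hlt
  obtain ⟨G, hG⟩ := exists_isWeakGrad_phase (p := p) (j := j) hU.1.1.1
  have hsub := hU.isSubharmonic hg hD hDb hG
  have hσ := surface_real_univ_pos (d := d)
  have hl0 : 0 < √(Λ j) := Real.sqrt_pos.2 hΛ
  have hC := energyConst_pos (d := d)
  have hd : (0 : ℝ) < d := Nat.cast_pos.2 (Nat.pos_of_ne_zero (NeZero.ne d))
  rw [sphereMean_preciseModulus hsub hD hB hr hrR, ENNReal.ofReal_lt_ofReal_iff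
    (by have := nondegConst_pos (d := d); positivity)] at hlt
  have hsup := hsub.ae_le_sphInt hD hB hr hrR
  have hI0 : 0 ≤ sphInt (rep (D.indicator fun y => √(∑ i, phase p j U y i ^ 2))) x r :=
    integral_nonneg fun _ => rep_nonneg _ _
  generalize sphInt (rep (D.indicator fun y => √(∑ i, phase p j U y i ^ 2))) x r = I at *
  set a₀ := 1 / (4 * (energyConst d * d) + 1) with ha₀
  have ha₀1 : a₀ ≤ 1 := by
    rw [ha₀, div_le_one (by positivity)]
    have : 0 < energyConst d * d := by positivity
    linarith
  have ha₀2 : energyConst d * d * a₀ ≤ 1 / 4 := by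
    rw [ha₀, mul_one_div, div_le_div_iff₀ (by positivity) (by norm_num)]
    linarith
  set M := 2 ^ d / (surface d).real univ * I with hM
  have hM0 : 0 ≤ M := by positivity
  have hMa : M / (√(Λ j) * (r / 4)) ≤ a₀ := by
    rw [div_le_iff₀ (by positivity)]
    have e1 : M = 2 ^ d * (I / (surface d).real univ) := by rw [hM]; ring
    have e2 : a₀ * (√(Λ j) * (r / 4)) = 2 ^ d * (nondegConst d * √(Λ j) * r) := by
      rw [nondegConst, ← ha₀]
      field_simp
    rw [e1, e2]
    gcongr
  have hzero := hU.volume_phaseSet_eq_zero (s := r / 4) hg hD hDb hΛ (by linarith) (by linarith) hB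
    hM0 (by
      rw [ae_restrict_iff' measurableSet_ball]
      filter_upwards [hsup] with y hy hyr
      have hyr' : y ∈ ball x (r / 2) := by
        convert hyr using 2
        ring
      have h1 := hy hyr'
      rwa [indicator_of_mem (hB (ball_subset_ball (by linarith) hyr'))] at h1) (by
      have h0 : 0 ≤ M / (√(Λ j) * (r / 4)) := by positivity
      generalize M / (√(Λ j) * (r / 4)) = a at hMa h0
      have h1 : a ^ 2 + a ≤ 2 * a₀ := by nlinarith
      have h2 : energyConst d * d * (a ^ 2 + a) ≤ energyConst d * d * (2 * a₀) := by gcongr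
      linarith)
  obtain ⟨z, hz1, hz2⟩ := mem_closure_iff.1 hx _ isOpen_ball
    (mem_ball_self (show 0 < r / 4 by linarith))
  have := hU.phaseSet_inter_ball_eq_empty hD hDb hzero
  exact (this ▸ (⟨hz2, hz1⟩ : z ∈ phaseSet p j D U ∩ ball x (r / 4)) : z ∈ (∅ : Set (𝔼 d)))

end nondegeneracy

end MultiphaseBernoulli

theorem proposition2p2 (d : ℕ) (hd : 1 ≤ d) :
    ∃ κ C : ℝ, 0 < κ ∧ 0 < C ∧
      ∀ (k n : ℕ) (p : Fin k → Fin n) (Λ : Fin n → ℝ)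
        (D : Set (EuclideanSpace ℝ (Fin d)))
        (g U : EuclideanSpace ℝ (Fin d) → EuclideanSpace ℝ (Fin k)),
        (∀ j, 0 < Λ j) → IsOpen D → Bornology.IsBounded D →
        MemH1Sigma p D g → IsMinimizer p Λ D g U →
        ∀ j : Fin n,
          (∀ x ∈ closure (phaseSet p j D U), ∀ r : ℝ, 0 < r → r < infDist x (frontier D) →
            ENNReal.ofReal (κ * Real.sqrt (Λ j) * r) ≤
                sphereMean (preciseModulus (phase p j U)) x r ∧
              sphereMean (preciseModulus (phase p j U)) x r ≤
                eLpNorm (phase p j U) ⊤ (volume.restrict (ball x r))) ∧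
          MemH1 D (fun y => ‖phase p j U y‖) ∧
          (∀ x ∈ D, ∀ r : ℝ, 0 < r → r < infDist x (frontier D) / 2 →
            eLpNorm (phase p j U) ⊤ (volume.restrict (ball x (2 * r))) < ⊤ ∧
            (1 / 2 : ℝ≥0∞) *
                  (∫⁻ y in ball x r, ‖weakGrad D (fun z => ‖phase p j U z‖) y‖ₑ ^ 2) +
                ENNReal.ofReal (Λ j) * volume (phaseSet p j D U ∩ ball x r) ≤
              ENNReal.ofReal (C * r⁻¹) *
                eLpNorm (phase p j U) ⊤ (volume.restrict (ball x (2 * r))) *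
                sphereIntegral (preciseModulus (phase p j U)) x r) := by
  have : NeZero d := ⟨by omega⟩
  refine ⟨nondegConst d, energyConst d, nondegConst_pos, energyConst_pos,
    fun k n p Λ D g U hΛ hD hDb hg hU j => ⟨fun x hx r hr hrd => ?_,
      memH1_norm_phase hD hDb.measure_lt_top.ne hU.1.1.1, fun x hx r hr hrd => ?_⟩⟩
  · have hxD : x ∈ closure D := closure_mono (fun y hy => hy.1) hx
    have hB := ball_infDist_frontier_subset hD hxD
    obtain ⟨G, hG⟩ := exists_isWeakGrad_phase (p := p) (j := j) hU.1.1.1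
    exact ⟨hU.nondegenerate hg hD hDb (hΛ j) hx hr hrd hB,
      sphereMean_le_eLpNorm (hU.isSubharmonic hg hD hDb hG) hD hB hr hrd⟩
  · exact hU.gradient_energy_le hg hD hDb hr (by linarith)
      (ball_infDist_frontier_subset hD (subset_closure hx))
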